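/- Let $n\ge 1$, $m=2n+1$, and let $\mathbb C_m$ be the complex Clifford algebra generated by $e_1,\dots,e_m$ with $e_j^2=-1$, $e_ie_j=-e_je_i$ ($i\ne j$). Let $Spin(m)$ be the set of products of an even number of unit vectors of $\mathbb R^m\subset\mathbb C_m$, let $S\subset\mathbb C_m$ be a basic spinor representation of $Spin(m)$, i.e. a complex subspace that is irreducible under left multiplication by $Spin(m)$, and put $S^{\pm}=\{u\in S:\theta_{2n}u=\pm u\}$ with $\theta_{2n}=(-i)^ne_1e_2\cdots e_{2n}$. For $d\in\{2n,2n+1\}$ and $T\subset\mathbb C_m$ let $\mathcal M_k(\mathbb R^{d},T)$ be the space of $T$-valued $k$-homogeneous polynomials $P$ in $x_1,\dots,x_d$ with $\sum_{i=1}^d e_i\,\partial P/\partial x_i=0$. For $2\le d\le m$ the Lie algebra $\mathfrak{so}(d)=\langle e_{ab}=e_ae_b: 1\le a<b\le d\rangle$ acts on polynomials by $dL(e_{ab}/2)=\frac{e_{ab}}2+x_b\frac{\partial}{\partial x_a}-x_a\frac{\partial}{\partial x_b}$. For an $\mathfrak{so}(d)$-module $V$, decompose $V$ along the chain $\mathfrak{so}(d)\supset\mathfrak{so}(d-1)\supset\cdots\supset\mathfrak{so}(2)$: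 its components $V(\mu)$ are the last terms $W_2$ of the sequences $V=W_d\supseteq W_{d-1}\supseteq\dots\supseteq W_2$ in which, for $2\le j<d$, $W_j$ is an irreducible $\mathfrak{so}(j)$-submodule of $W_{j+1}$. A Gelfand–Tsetlin (GT) basis of $V$ is a basis of $V$ that is orthogonal with respect to every $\mathfrak{so}(d)$-invariant inner product on $V$ and is obtained by choosing one non-zero vector from each component $V(\mu)$. Let $C^\nu_j(z)=\sum_{i=0}^{[j/2]}\frac{(-1)^i(\nu)_{j-i}}{i!(j-2i)!}(2z)^{j-2i}$ be the Gegenbauer polynomials, where $(\nu)_j=\nu(\nu+1)\cdots(\nu+j-1)$, let $r^2=x_1^2+\dots+x_m^2$, $\underline x=x_1e_1+\dots+x_{m-1}e_{m-1}$, and put $X^{(0)}_k=1$ and, for $j\ge1$, $$X^{(j)}_k=\mu^j_k\,r^j\Big(C_j^{m/2+k-1}\big(\tfrac{x_m}{r}\big)+\tfrac{m+2k-2}{m+2k+j-2}\,C_{j-1}^{m/2+k}\big(\tfrac{x_m}{r}\big)\tfrac{\underline xe_m}{r}\Big),$$ $$\mu^{2l}_k=(-1)^l\big(C_{2l}^{m/2+k-1}(0)\big)^{-1},\qquad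 \mu^{2l+1}_k=(-1)^l\tfrac{m+2k+2l-1}{m+2k-2}\big(C_{2l}^{m/2+k}(0)\big)^{-1}.$$ Let $k\ge 0$ and, for $j=0,\dots,k$, let $\mathcal B^{2n}_j(S^{\pm})$ be GT bases of the $\mathfrak{so}(2n)$-modules $\mathcal M_j(\mathbb R^{2n},S^{\pm})$. Then the set $$\bigcup_{j=0}^k\Big(X^{(j)}_{k-j}\,\mathcal B^{2n}_{k-j}(S^+)\ \cup\ X^{(j)}_{k-j}\,\mathcal B^{2n}_{k-j}(S^-)\Big),\qquad X^{(j)}_{k-j}\mathcal B=\{X^{(j)}_{k-j}\,p : p\in\mathcal B\},$$ is a GT basis of the $\mathfrak{so}(2n+1)$-module $\mathcal M_k(\mathbb R^{2n+1},S)$. -/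

import Mathlib

open scoped TensorProduct Nat

noncomputable section

namespace GTMonogenic

/-! ### The complex Clifford algebra and basic spinor spaces -/

/-- The quadratic form `v ↦ -∑ vᵢ²` on `ℂᴺ`. -/
abbrev negSq (N : ℕ) : QuadraticForm ℂ (Fin N → ℂ) :=
  QuadraticMap.weightedSumSquares ℂ (fun _ : Fin N => (-1 : ℂ))

/-- The complex Clifford algebra `ℂ_N`, generated by `e₁, …, e_N` with `eⱼ² = -1`. -/
abbrev Cl (N : ℕ) : Type := CliffordAlgebra (negSq N)

/-- The generators; the index `i : Fin N` stands for `e_{i+1}`. -/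
def e {N : ℕ} (i : Fin N) : Cl N := CliffordAlgebra.ι (negSq N) (Pi.single i 1)

theorem e_mul_self {N : ℕ} (i : Fin N) : e i * e i = -1 := by
  rw [e, CliffordAlgebra.ι_sq_scalar, QuadraticMap.weightedSumSquares_apply,
    Finset.sum_eq_single i] <;> simp +contextual

/-- A real vector `x`, identified with `x₁e₁ + ⋯ + x_N e_N`. -/
def vec {N : ℕ} (x : EuclideanSpace ℝ (Fin N)) : Cl N := ∑ i, (x i : ℂ) • e i

/-- `Spin(N)`: the products of an even number of unit vectors of `ℝᴺ`. -/
def spin (N : ℕ) : Set (Cl N) :=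
  {s | ∃ l : List (EuclideanSpace ℝ (Fin N)),
    Even l.length ∧ (∀ x ∈ l, ‖x‖ = 1) ∧ s = (l.map vec).prod}

/-- A complex subspace of `ℂ_N` stable under left multiplication by `Spin(N)`. -/
def SpinStable {N : ℕ} (S : Submodule ℂ (Cl N)) : Prop :=
  ∀ s ∈ spin N, ∀ u ∈ S, s * u ∈ S

/-- A basic spinor representation of `Spin(N)`, realized inside `ℂ_N`: a subspace which is
an irreducible `Spin(N)`-module under left multiplication. -/
structure IsBasicSpinor {N : ℕ} (S : Submodule ℂ (Cl N)) : Prop where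
  stable : SpinStable S
  ne_bot : S ≠ ⊥
  eq_bot_or_eq : ∀ T : Submodule ℂ (Cl N), T ≤ S → SpinStable T → T = ⊥ ∨ T = S

/-- `θ_{2n} = (-i)ⁿ e₁ e₂ ⋯ e_{2n}`, as an element of `ℂ_{2n+1}`. -/
def theta (n : ℕ) : Cl (2 * n + 1) :=
  (-Complex.I) ^ n • (List.ofFn fun i : Fin (2 * n) => e i.castSucc).prod

/-- `{u ∈ S : θ_{2n} u = ε u}`; the spaces `S^±` are obtained for `ε = ±1`. -/
def thetaPart {n : ℕ} (S : Submodule ℂ (Cl (2 * n + 1))) (ε : ℂ) :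
    Submodule ℂ (Cl (2 * n + 1)) :=
  S ⊓ LinearMap.ker (LinearMap.mulLeft ℂ (theta n) - ε • LinearMap.id)

/-! ### Clifford algebra valued polynomials and spherical monogenics -/

/-- The algebra `ℂ_N ⊗ ℂ[x₁, …, x_N]` of `ℂ_N`-valued polynomials in `ℝᴺ`
(the variables commute with the elements of `ℂ_N`). -/
abbrev Pol (N : ℕ) : Type := Cl N ⊗[ℂ] MvPolynomial (Fin N) ℂ

/-- A Clifford number as a constant polynomial. -/
def const {N : ℕ} (u : Cl N) : Pol N := u ⊗ₜ[ℂ] 1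

/-- The scalar polynomial given by the coordinate `x_{i+1}`. -/
def var {N : ℕ} (i : Fin N) : Pol N := 1 ⊗ₜ[ℂ] MvPolynomial.X i

/-- The partial derivative `∂/∂x_{i+1}`. -/
def pd {N : ℕ} (i : Fin N) : Pol N →ₗ[ℂ] Pol N :=
  LinearMap.lTensor (Cl N) (MvPolynomial.pderiv (R := ℂ) i).toLinearMap

/-- `𝒫_k(ℝᵈ, S)`: the `S`-valued `k`-homogeneous polynomials in the first `d` variables
(polynomials in `ℝᵈ`, `d ≤ N`, are viewed as polynomials in `ℝᴺ` that do not depend on the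
remaining variables). -/
def homPoly {N : ℕ} (d k : ℕ) (S : Submodule ℂ (Cl N)) : Submodule ℂ (Pol N) :=
  Submodule.span ℂ {P | ∃ s ∈ S, ∃ p : MvPolynomial (Fin N) ℂ, p.IsHomogeneous k ∧
    p ∈ MvPolynomial.supported ℂ {i : Fin N | i.val < d} ∧ P = s ⊗ₜ[ℂ] p}

/-- The Dirac operator `e₁ ∂/∂x₁ + ⋯ + e_d ∂/∂x_d` in `ℝᵈ`. -/
def dirac {N : ℕ} (d : ℕ) : Pol N →ₗ[ℂ] Pol N :=
  ∑ i : Fin N with i.val < d, LinearMap.mulLeft ℂ (const (e i)) ∘ₗ pd i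

/-- The space `ℳ_k(ℝᵈ, S)` of spherical monogenics of degree `k`. -/
def monogenics {N : ℕ} (d k : ℕ) (S : Submodule ℂ (Cl N)) : Submodule ℂ (Pol N) :=
  homPoly d k S ⊓ LinearMap.ker (dirac d)

/-! ### The action of `so(d)` and Gelfand-Tsetlin bases -/

/-- The operator `dL(e_{ab}/2) = e_{ab}/2 + x_b ∂/∂x_a - x_a ∂/∂x_b`, the derivative at `t = 0`
of the action `[L(s)P](x) = s P(s⁻¹ x s)` along `s = exp (t e_{ab}/2)`, where `e_{ab} = e_a e_b`. -/
def rot {N : ℕ} (a b : Fin N) : Pol N →ₗ[ℂ] Pol N :=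
  (1 / 2 : ℂ) • LinearMap.mulLeft ℂ (const (e a * e b))
    + LinearMap.mulLeft ℂ (var b) ∘ₗ pd a - LinearMap.mulLeft ℂ (var a) ∘ₗ pd b

/-- `W` is stable under `so(d) = ⟨e_{ab} : 1 ≤ a < b ≤ d⟩`. -/
def SoStable {N : ℕ} (d : ℕ) (W : Submodule ℂ (Pol N)) : Prop :=
  ∀ a b : Fin N, a < b → b.val < d → ∀ P ∈ W, rot a b P ∈ W

/-- `W` is an irreducible `so(d)`-module. -/
structure SoIrreducible {N : ℕ} (d : ℕ) (W : Submodule ℂ (Pol N)) : Prop where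
  stable : SoStable d W
  ne_bot : W ≠ ⊥
  eq_bot_or_eq : ∀ T : Submodule ℂ (Pol N), T ≤ W → SoStable d T → T = ⊥ ∨ T = W

/-- `GTComponent d V W`: the subspace `W` is one of the `so(2)`-modules `V(μ)` into which the
`so(d)`-module `V` is decomposed along the chain `so(d) ⊃ so(d-1) ⊃ ⋯ ⊃ so(2)`, i.e. there are
subspaces `V = W_d ⊇ W_{d-1} ⊇ ⋯ ⊇ W_2 = W` where, for `j < d`, `W_j` is an irreducible
`so(j)`-submodule of `W_{j+1}`.  (Since the restriction of an irreducible `so(j+1)`-module to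
`so(j)` is multiplicity free, its irreducible `so(j)`-submodules are exactly the summands
of its unique decomposition into irreducibles.) -/
inductive GTComponent {N : ℕ} :
    ℕ → Submodule ℂ (Pol N) → Submodule ℂ (Pol N) → Prop
  | base (V : Submodule ℂ (Pol N)) : GTComponent 2 V V
  | step {d : ℕ} {V U W : Submodule ℂ (Pol N)} (hUV : U ≤ V) (hU : SoIrreducible d U)
      (hW : GTComponent d U W) : GTComponent (d + 1) V W

/-- The inner product `c` on the `so(d)`-module `V` is invariant: the operators
`dL(e_{ab}/2)` are skew-adjoint. -/
def InvariantInner {N : ℕ} (d : ℕ) (V : Submodule ℂ (Pol N))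
    (c : InnerProductSpace.Core ℂ V) : Prop :=
  ∀ a b : Fin N, a < b → b.val < d → ∀ u v u' v' : V,
    (u' : Pol N) = rot a b u → (v' : Pol N) = rot a b v →
      c.inner u' v + c.inner u v' = 0

/-- `E` is a Gelfand-Tsetlin basis of the `so(d)`-module `V`: it consists of one non-zero vector
from each of the `so(2)`-modules `V(μ)`, and is a basis of `V` which is orthogonal with respect
to any invariant inner product. -/
structure IsGTBasis {N : ℕ} (d : ℕ) (V : Submodule ℂ (Pol N)) (E : Set (Pol N)) : Prop where
  select : ∃ f : {W : Submodule ℂ (Pol N) // GTComponent d V W} → Pol N,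
    (∀ W, f W ∈ W.1 ∧ f W ≠ 0) ∧ E = Set.range f
  linearIndependent : LinearIndependent ℂ (Subtype.val : E → Pol N)
  span_eq : Submodule.span ℂ E = V
  orthogonal : ∀ c : InnerProductSpace.Core ℂ V, InvariantInner d V c →
    ∀ u v : V, (u : Pol N) ∈ E → (v : Pol N) ∈ E → u ≠ v → c.inner u v = 0

/-! ### The polynomials `X^{(j)}_k` -/

/-- The number `(-1)^i (ν)_{j-i} / (i! (j-2i)!)`, with `(ν)_l = ν (ν+1) ⋯ (ν+l-1)`. -/
def gegCoeff (ν : ℂ) (j i : ℕ) : ℂ :=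
  (-1) ^ i * (ascPochhammer ℂ (j - i)).eval ν / ((i ! : ℂ) * ((j - 2 * i)! : ℂ))

/-- The value `C^ν_j(z)` of the Gegenbauer polynomial. -/
def gegenbauer (ν : ℂ) (j : ℕ) (z : ℂ) : ℂ :=
  ∑ i ∈ Finset.range (j / 2 + 1), gegCoeff ν j i * (2 * z) ^ (j - 2 * i)

/-- The homogenized Gegenbauer polynomial `r^j C^ν_j(t/r)`, as a polynomial in `t` and
`q = r²` (see `gegenbauerHom_eq`). -/
def gegenbauerHom {A : Type*} [Ring A] [Algebra ℂ A] (ν : ℂ) (j : ℕ) (t q : A) : A :=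
  ∑ i ∈ Finset.range (j / 2 + 1), gegCoeff ν j i • ((2 * t) ^ (j - 2 * i) * q ^ i)

theorem gegenbauerHom_eq (ν : ℂ) (j : ℕ) (t r : ℂ) (hr : r ≠ 0) :
    gegenbauerHom ν j t (r ^ 2) = r ^ j * gegenbauer ν j (t / r) := by
  unfold gegenbauerHom gegenbauer
  rw [Finset.mul_sum]
  refine Finset.sum_congr rfl fun i hi => ?_
  have hij : 2 * i ≤ j := by
    have := Finset.mem_range.1 hi
    omega
  obtain ⟨l, rfl⟩ := Nat.exists_eq_add_of_le hij
  have h : 2 * i + l - 2 * i = l := by omega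
  rw [h, smul_eq_mul, ← mul_div_assoc, div_pow, pow_add, ← pow_mul]
  field_simp

/-- `r² = x₁² + ⋯ + x_N²`. -/
def rSq (N : ℕ) : Pol N := ∑ i, var i ^ 2

/-- `x̲ e_m` in dimension `m = q + 1`, where `x̲ = x₁e₁ + ⋯ + x_{m-1}e_{m-1}`. -/
def xe (q : ℕ) : Pol (q + 1) :=
  (∑ i : Fin q, const (e i.castSucc) * var i.castSucc) * const (e (Fin.last q))

/-- The constants `μ^j_k` in dimension `m`:
`μ^{2l}_k = (-1)^l (C^{m/2+k-1}_{2l}(0))⁻¹` and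
`μ^{2l+1}_k = (-1)^l (m+2k+2l-1)/(m+2k-2) (C^{m/2+k}_{2l}(0))⁻¹`. -/
def muConst (m j k : ℕ) : ℂ :=
  if Even j then (-1) ^ (j / 2) * (gegenbauer ((m : ℂ) / 2 + k - 1) j 0)⁻¹
  else (-1) ^ (j / 2) * (((m : ℂ) + 2 * k + j - 2) / ((m : ℂ) + 2 * k - 2)) *
    (gegenbauer ((m : ℂ) / 2 + k) (j - 1) 0)⁻¹

/-- The polynomial `X^{(j)}_k` in dimension `m = q + 1`: `X^{(0)}_k = 1` and, for `j ≥ 1`,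
`X^{(j)}_k = μ^j_k r^j (C^{m/2+k-1}_j(x_m/r)
  + (m+2k-2)/(m+2k+j-2) C^{m/2+k}_{j-1}(x_m/r) x̲e_m/r)`. -/
def X (q : ℕ) (j k : ℕ) : Pol (q + 1) :=
  let m : ℕ := q + 1
  let t : Pol (q + 1) := var (Fin.last q)
  if j = 0 then 1
  else muConst m j k •
    (gegenbauerHom ((m : ℂ) / 2 + k - 1) j t (rSq (q + 1))
      + (((m : ℂ) + 2 * k - 2) / ((m : ℂ) + 2 * k + j - 2)) •
        (gegenbauerHom ((m : ℂ) / 2 + k) (j - 1) t (rSq (q + 1)) * xe q))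

end GTMonogenic

end

/-! The theorem is the branching of monogenics from so(2n+1) to so(2n), made explicit by
Cauchy-Kovalevskaya extension. A spinor space S is stable only under even Clifford elements, so each
generator e_a is replaced by left multiplication by e_a e_z, where z is the last direction in use;
these operators obey the same relations (`cliffordWeyl`). Write x and D for the resulting vector
variable and Dirac operator; for z = m, x is x̲e_m. Being monogenic in one more dimension then means
∂P/∂x_z = -DP (`dirac_succ_eq_zero_iff`), so a monogenic is determined by its restriction to x_z = 0
(`eq_zero_of_restr_eq_zero`).

For p monogenic of degree s in R^{2n}, X^{(j)}_s p is monogenic in R^{2n+1} by contiguity relations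
of Gegenbauer polynomials (`X_mul_mem_monogenics`), and its restriction is x^j p (`restr_X_mul`).
Hence the Fischer decomposition of restrictions into terms x^j p (`CliffordGraded.fischer`) lifts to
a decomposition of M_k(R^{2n+1},S) into the spaces X^{(j)} M_{k-j}(R^{2n},S^±). Multiplication by
X^{(j)} is injective on monogenics and commutes with so(2n) (`rot_X_mul`), so it transports
Gelfand-Tsetlin components.

The main representation-theoretic input is `IsBasicSpinor.exists_thetaPart_le`: a nonzero
so(2n)-submodule of M_l(R^{2n},S) contains a nonzero M_l(R^{2n},S^ε). For it, restrict once more, to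
x_{2n} = 0. There so(2n) acts through the rotations of R^{2n-1} and the boosts ½g_a + x_a D. The
Casimir operator of so(2n-1) separates the Fischer components, while boosts link neighbouring ones
with nonzero coefficients (`boost_vec_pow`). A nonzero stable space thus descends to some x^l c with
c constant, and climbs back to all monogenics with values in a nonzero subspace S' of S; S' contains
S^+ or S^- because these are irreducible under the even elements of dimension 2n.

This input yields irreducibility of M_l(R^{2n},S^±), the list of irreducible so(2n)-submodules of
M_k(R^{2n+1},S), and the orthogonality of the + and - parts of equal degree, which the Casimir
operator does not separate. Parts of different degree are orthogonal as eigenspaces of the symmetric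
Casimir operator; within one part the inner product pulls back to an invariant one on
M_{k-j}(R^{2n},S^±). -/

open scoped TensorProduct Nat

noncomputable section

namespace GTMonogenic

/-! ### Operators generated by Clifford generators, coordinates and partial derivatives -/

section Operators

variable {P ι : Type*} [AddCommGroup P] [Module ℂ P] [DecidableEq ι]

/-- Operators `g a`, `m a`, `d a` satisfying the relations of Clifford generators, multiplications
by coordinates and partial derivatives, for indices in `I`. -/
structure CliffordWeyl (I : Finset ι) (g m d : ι → Module.End ℂ P) : Prop where
  sq : ∀ a ∈ I, g a * g a = -1
  anti : ∀ a ∈ I, ∀ b ∈ I, a ≠ b → g a * g b = -(g b * g a)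
  mm : ∀ a b, m a * m b = m b * m a
  dd : ∀ a b, d a * d b = d b * d a
  dm : ∀ a b, d a * m b = m b * d a + if a = b then 1 else 0
  gm : ∀ a ∈ I, ∀ b, g a * m b = m b * g a
  gd : ∀ a ∈ I, ∀ b, g a * d b = d b * g a

/-- The Dirac operator `∑ gₐ dₐ`. -/
def diracOp (I : Finset ι) (g d : ι → Module.End ℂ P) : Module.End ℂ P := ∑ a ∈ I, g a * d a

/-- Multiplication by the vector variable, `∑ gₐ mₐ`. -/
def vecOp (I : Finset ι) (g m : ι → Module.End ℂ P) : Module.End ℂ P := ∑ a ∈ I, g a * m a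

/-- The Euler operator `∑ mₐ dₐ`. -/
def eulerOp (I : Finset ι) (m d : ι → Module.End ℂ P) : Module.End ℂ P := ∑ a ∈ I, m a * d a

/-- The infinitesimal rotation in the plane spanned by the directions `a` and `b`. -/
def rotOp (g m d : ι → Module.End ℂ P) (a b : ι) : Module.End ℂ P :=
  (1 / 2 : ℂ) • (g a * g b) + m b * d a - m a * d b

/-- The Casimir operator, summed over all ordered pairs of indices. -/
def casimirOp (I : Finset ι) (g m d : ι → Module.End ℂ P) : Module.End ℂ P :=
  ∑ a ∈ I, ∑ b ∈ I, rotOp g m d a b * rotOp g m d a b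

namespace CliffordWeyl

variable {I : Finset ι} {g m d : ι → Module.End ℂ P} (h : CliffordWeyl I g m d)

include h

theorem gg {a b : ι} (ha : a ∈ I) (hb : b ∈ I) :
    g a * g b = -(g b * g a) - if a = b then 2 else 0 := by
  split_ifs with hab
  · subst hab
    rw [h.sq a ha]; norm_num
  · rw [h.anti a ha b hb hab, sub_zero]

theorem dirac_m {a : ι} (ha : a ∈ I) :
    diracOp I g d * m a = m a * diracOp I g d + g a := by
  have : ∀ i ∈ I, g i * d i * m a = m a * (g i * d i) + if i = a then g a else 0 := by
    intro i hi
    rw [mul_assoc, h.dm, mul_add, ← mul_assoc, h.gm i hi, mul_assoc]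
    split_ifs with hia <;> simp [hia]
  rw [diracOp, Finset.sum_mul, Finset.sum_congr rfl this, Finset.sum_add_distrib, Finset.mul_sum,
    Finset.sum_ite_eq' I a, if_pos ha]

theorem d_vec {a : ι} (ha : a ∈ I) : d a * vecOp I g m = vecOp I g m * d a + g a := by
  have : ∀ i ∈ I, d a * (g i * m i) = g i * m i * d a + if a = i then g i else 0 := by
    intro i hi
    rw [← mul_assoc, ← h.gd i hi, mul_assoc, h.dm, mul_add, mul_assoc]
    split_ifs with hia <;> simp
  rw [vecOp, Finset.mul_sum, Finset.sum_congr rfl this, Finset.sum_add_distrib, Finset.sum_mul,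
    Finset.sum_ite_eq I a, if_pos ha]

theorem g_vec {a : ι} (ha : a ∈ I) :
    g a * vecOp I g m = -(vecOp I g m * g a) - 2 * m a := by
  have : ∀ i ∈ I, g a * (g i * m i) = -(g i * m i * g a) - if a = i then 2 * m i else 0 := by
    intro i hi
    rw [← mul_assoc, h.gg ha hi, sub_mul, neg_mul, mul_assoc (g i), h.gm a ha, mul_assoc]
    split_ifs with hia <;> simp
  rw [vecOp, Finset.mul_sum, Finset.sum_congr rfl this, Finset.sum_sub_distrib,
    Finset.sum_neg_distrib, Finset.sum_mul, Finset.sum_ite_eq I a, if_pos ha]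

theorem g_dirac {a : ι} (ha : a ∈ I) :
    g a * diracOp I g d = -(diracOp I g d * g a) - 2 * d a := by
  have : ∀ i ∈ I, g a * (g i * d i) = -(g i * d i * g a) - if a = i then 2 * d i else 0 := by
    intro i hi
    rw [← mul_assoc, h.gg ha hi, sub_mul, neg_mul, mul_assoc (g i), h.gd a ha, mul_assoc]
    split_ifs with hia <;> simp
  rw [diracOp, Finset.mul_sum, Finset.sum_congr rfl this, Finset.sum_sub_distrib,
    Finset.sum_neg_distrib, Finset.sum_mul, Finset.sum_ite_eq I a, if_pos ha]

theorem d_dirac (a : ι) : d a * diracOp I g d = diracOp I g d * d a := by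
  rw [diracOp, Finset.mul_sum, Finset.sum_mul]
  refine Finset.sum_congr rfl fun i hi => ?_
  rw [← mul_assoc, ← h.gd i hi, mul_assoc, h.dd, mul_assoc]

theorem m_vec (a : ι) : m a * vecOp I g m = vecOp I g m * m a := by
  rw [vecOp, Finset.mul_sum, Finset.sum_mul]
  refine Finset.sum_congr rfl fun i hi => ?_
  rw [← mul_assoc, ← h.gm i hi, mul_assoc, h.mm, mul_assoc]

theorem d_euler {a : ι} (ha : a ∈ I) : d a * eulerOp I m d = eulerOp I m d * d a + d a := by
  have : ∀ i ∈ I, d a * (m i * d i) = m i * d i * d a + if a = i then d i else 0 := by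
    intro i _
    rw [← mul_assoc, h.dm, add_mul, mul_assoc, h.dd, mul_assoc]
    split_ifs with hia <;> simp
  rw [eulerOp, Finset.mul_sum, Finset.sum_congr rfl this, Finset.sum_add_distrib, Finset.sum_mul,
    Finset.sum_ite_eq I a, if_pos ha]

theorem sum_g_mul_vec_mul_d :
    ∑ a ∈ I, g a * vecOp I g m * d a = -(vecOp I g m * diracOp I g d) - 2 * eulerOp I m d := by
  have : ∀ a ∈ I, g a * vecOp I g m * d a
      = -(vecOp I g m * (g a * d a)) - 2 * (m a * d a) := by
    intro a ha
    rw [h.g_vec ha]; noncomm_ring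
  rw [Finset.sum_congr rfl this, Finset.sum_sub_distrib, Finset.sum_neg_distrib, ← Finset.mul_sum,
    ← Finset.mul_sum, diracOp, eulerOp]

/-- With `vec_sq` and `dirac_sq` this is the osp(1|2) relation behind the Fischer decomposition: it
makes D x^j p a multiple of x^{j-1} p for monogenic p. -/
theorem dirac_vec :
    diracOp I g d * vecOp I g m
      = -(vecOp I g m * diracOp I g d) - 2 * eulerOp I m d - (I.card : Module.End ℂ P) := by
  have : ∀ a ∈ I, g a * d a * vecOp I g m = g a * vecOp I g m * d a - 1 := by
    intro a ha
    rw [mul_assoc, h.d_vec ha, mul_add, h.sq a ha, mul_assoc, sub_eq_add_neg]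
  rw [diracOp, Finset.sum_mul, Finset.sum_congr rfl this, Finset.sum_sub_distrib,
    h.sum_g_mul_vec_mul_d]
  simp [diracOp]

theorem vec_sq : vecOp I g m * vecOp I g m = -∑ a ∈ I, m a * m a := by
  have h1 : vecOp I g m * vecOp I g m
      = -(vecOp I g m * vecOp I g m) - (2 : ℂ) • ∑ a ∈ I, m a * m a := by
    have : ∀ a ∈ I, g a * m a * vecOp I g m
        = -(vecOp I g m * (g a * m a)) - (2 : ℂ) • (m a * m a) := by
      intro a ha
      rw [mul_assoc, h.m_vec, ← mul_assoc, h.g_vec ha, two_smul]; noncomm_ring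
    calc _ = ∑ a ∈ I, g a * m a * vecOp I g m := by rw [← Finset.sum_mul]; rfl
      _ = _ := by
        rw [Finset.sum_congr rfl this, Finset.sum_sub_distrib, Finset.sum_neg_distrib,
          ← Finset.mul_sum, ← Finset.smul_sum]
        rfl
  have h2 : (2 : ℂ) • (vecOp I g m * vecOp I g m) = (2 : ℂ) • -∑ a ∈ I, m a * m a := by
    rw [smul_neg, two_smul ℂ (vecOp I g m * _)]
    nth_rewrite 1 [h1]
    abel
  exact smul_right_injective _ two_ne_zero h2

theorem dirac_sq : diracOp I g d * diracOp I g d = -∑ a ∈ I, d a * d a := by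
  have h1 : diracOp I g d * diracOp I g d
      = -(diracOp I g d * diracOp I g d) - (2 : ℂ) • ∑ a ∈ I, d a * d a := by
    have : ∀ a ∈ I, g a * d a * diracOp I g d
        = -(diracOp I g d * (g a * d a)) - (2 : ℂ) • (d a * d a) := by
      intro a ha
      rw [mul_assoc, h.d_dirac, ← mul_assoc, h.g_dirac ha, two_smul]; noncomm_ring
    calc _ = ∑ a ∈ I, g a * d a * diracOp I g d := by rw [← Finset.sum_mul]; rfl
      _ = _ := by
        rw [Finset.sum_congr rfl this, Finset.sum_sub_distrib, Finset.sum_neg_distrib,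
          ← Finset.mul_sum, ← Finset.smul_sum]
        rfl
  have h2 : (2 : ℂ) • (diracOp I g d * diracOp I g d) = (2 : ℂ) • -∑ a ∈ I, d a * d a := by
    rw [smul_neg, two_smul ℂ (diracOp I g d * _)]
    nth_rewrite 1 [h1]
    abel
  exact smul_right_injective _ two_ne_zero h2

theorem g_vec_sq {a : ι} (ha : a ∈ I) :
    g a * (vecOp I g m * vecOp I g m) = vecOp I g m * vecOp I g m * g a := by
  rw [← mul_assoc, h.g_vec ha]
  have := h.m_vec a
  calc _ = -(vecOp I g m * (g a * vecOp I g m)) - 2 * (m a * vecOp I g m) := by noncomm_ring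
    _ = _ := by rw [h.g_vec ha, this]; noncomm_ring

/-- Neither the spin part ½ g_a g_b nor the orbital part commutes with x; the two commutators
cancel. The same happens for D in `rot_dirac`. -/
theorem rot_vec {a b : ι} (ha : a ∈ I) (hb : b ∈ I) :
    Commute (rotOp g m d a b) (vecOp I g m) := by
  have h1 : g a * g b * vecOp I g m
      = vecOp I g m * (g a * g b) + 2 * (m a * g b - m b * g a) := by
    rw [mul_assoc, h.g_vec hb]
    calc _ = -(g a * vecOp I g m * g b) - 2 * (g a * m b) := by noncomm_ring
      _ = _ := by rw [h.g_vec ha, h.gm a ha]; noncomm_ring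
  have h2 : m b * d a * vecOp I g m = vecOp I g m * (m b * d a) + m b * g a := by
    rw [mul_assoc, h.d_vec ha, mul_add, ← mul_assoc, h.m_vec, mul_assoc]
  have h3 : m a * d b * vecOp I g m = vecOp I g m * (m a * d b) + m a * g b := by
    rw [mul_assoc, h.d_vec hb, mul_add, ← mul_assoc, h.m_vec, mul_assoc]
  have h4 : (1 / 2 : ℂ) • (2 * (m a * g b - m b * g a)) = m a * g b - m b * g a := by
    rw [two_mul, ← two_smul ℂ, smul_smul]; norm_num
  rw [Commute, SemiconjBy, rotOp, sub_mul, add_mul, smul_mul_assoc, h1, smul_add, h4, h2, h3,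
    mul_sub, mul_add, mul_smul_comm]
  abel

theorem rot_dirac {a b : ι} (ha : a ∈ I) (hb : b ∈ I) :
    Commute (rotOp g m d a b) (diracOp I g d) := by
  have h1 : g a * g b * diracOp I g d
      = diracOp I g d * (g a * g b) + 2 * (g b * d a - g a * d b) := by
    rw [mul_assoc, h.g_dirac hb]
    calc _ = -(g a * diracOp I g d * g b) - 2 * (g a * d b) := by noncomm_ring
      _ = _ := by rw [h.g_dirac ha, h.gd b hb]; noncomm_ring
  have h2 : m b * d a * diracOp I g d = diracOp I g d * (m b * d a) - g b * d a := by
    rw [mul_assoc, h.d_dirac, ← mul_assoc, ← mul_assoc, h.dirac_m hb]; noncomm_ring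
  have h3 : m a * d b * diracOp I g d = diracOp I g d * (m a * d b) - g a * d b := by
    rw [mul_assoc, h.d_dirac, ← mul_assoc, ← mul_assoc, h.dirac_m ha]; noncomm_ring
  have h4 : (1 / 2 : ℂ) • (2 * (g b * d a - g a * d b)) = g b * d a - g a * d b := by
    rw [two_mul, ← two_smul ℂ, smul_smul]; norm_num
  rw [Commute, SemiconjBy, rotOp, sub_mul, add_mul, smul_mul_assoc, h1, smul_add, h4, h2, h3,
    mul_sub, mul_add, mul_smul_comm]
  abel

theorem rot_swap {a b : ι} (ha : a ∈ I) (hb : b ∈ I) (hab : a ≠ b) :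
    rotOp g m d b a = -rotOp g m d a b := by
  rw [rotOp, rotOp, h.anti a ha b hb hab, smul_neg]
  abel

/-- The diagonal terms of `casimirOp` are therefore constants 1/4, which only shift its eigenvalues.
-/
theorem rot_self {a : ι} (ha : a ∈ I) : rotOp g m d a a = -(1 / 2 : ℂ) • 1 := by
  rw [rotOp, h.sq a ha]; simp

/-- Each square splits into spin², spin times orbital, and orbital². Summed, these give a constant,
a combination of xD and E, and a combination of x²D², E² and E. On monogenics the terms containing D
drop out and a polynomial in the degree is left. -/
theorem casimir_eq :
    casimirOp I g m d = (2 : ℂ) • (vecOp I g m * vecOp I g m * (diracOp I g d * diracOp I g d))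
      - (2 : ℂ) • (vecOp I g m * diracOp I g d)
      - (2 : ℂ) • (eulerOp I m d * eulerOp I m d)
      - (2 * ((I.card : ℂ) - 1)) • eulerOp I m d
      - ((I.card : ℂ) * (I.card - 2) / 4) • 1 := by
  have hrot : ∀ a ∈ I, ∀ b ∈ I, rotOp g m d a b * rotOp g m d a b
      = (1 / 4 : ℂ) • (g a * (g b * g a * g b))
        + (g a * (g b * m b) * d a - g a * m a * (g b * d b))
        + (m b * d a * (m b * d a) - m b * (d a * m a) * d b
          + (m a * d b * (m a * d b) - m a * (d b * m b) * d a)) := by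
    intro a ha b hb
    set L := m b * d a - m a * d b with hL
    have hgL : L * (g a * g b) = g a * g b * L := by
      simp only [hL, sub_mul, mul_sub]
      congr 1
      · calc _ = m b * (d a * g a) * g b := by noncomm_ring
          _ = (m b * g a) * (d a * g b) := by rw [← h.gd a ha]; noncomm_ring
          _ = g a * (m b * g b) * d a := by rw [← h.gm a ha, ← h.gd b hb]; noncomm_ring
          _ = _ := by rw [← h.gm b hb]; noncomm_ring
      · calc _ = m a * (d b * g a) * g b := by noncomm_ring
          _ = (m a * g a) * (d b * g b) := by rw [← h.gd a ha]; noncomm_ring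
          _ = g a * (m a * g b) * d b := by rw [← h.gm a ha, ← h.gd b hb]; noncomm_ring
          _ = _ := by rw [← h.gm b hb]; noncomm_ring
    have e1 : rotOp g m d a b = (1 / 2 : ℂ) • (g a * g b) + L := by rw [rotOp, hL]; abel
    have e2 : g a * g b * L = g a * (g b * m b) * d a - g a * m a * (g b * d b) := by
      have : g b * (m a * d b) = m a * (g b * d b) := by
        rw [← mul_assoc, h.gm b hb, mul_assoc]
      rw [hL, mul_sub, mul_assoc, mul_assoc, this]
      simp only [mul_assoc]
    rw [e1, add_mul, mul_add, mul_add, smul_mul_smul_comm, smul_mul_assoc, mul_smul_comm, hgL, e2,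
      hL]
    have e3 : ∀ A B C : Module.End ℂ P, ((1 / 2 : ℂ) * (1 / 2)) • A + (1 / 2 : ℂ) • B
        + ((1 / 2 : ℂ) • B + C) = (1 / 4 : ℂ) • A + B + C := by
      intro A B C; module
    rw [e3]
    congr 1
    noncomm_ring
  have hS1 : ∑ a ∈ I, ∑ b ∈ I, g a * (g b * g a * g b)
      = (-((I.card : ℂ) * (I.card - 2))) • (1 : Module.End ℂ P) := by
    have h1 : ∀ a ∈ I, ∑ b ∈ I, g a * (g b * g a * g b)
        = (-((I.card : ℂ) - 2)) • (1 : Module.End ℂ P) := by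
      intro a ha
      have h2 : ∀ b ∈ I, g a * (g b * g a * g b) = -1 + if b = a then 2 else 0 := by
        intro b hb
        rw [h.gg hb ha, sub_mul, mul_sub, neg_mul, mul_assoc, h.sq b hb]
        split_ifs with hba
        · subst hba
          have := h.sq b ha
          simp only [two_mul, mul_add, this, mul_neg, mul_one, neg_neg]
          norm_num
        · simp [h.sq a ha]
      rw [Finset.sum_congr rfl h2, Finset.sum_add_distrib, Finset.sum_ite_eq' I a, if_pos ha,
        Finset.sum_const, ← Nat.cast_smul_eq_nsmul ℂ]
      have : (2 : Module.End ℂ P) = (2 : ℂ) • 1 := by rw [two_smul]; norm_num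
      rw [this]; module
    rw [Finset.sum_congr rfl h1, Finset.sum_const, ← Nat.cast_smul_eq_nsmul ℂ]; module
  have hS2 : ∑ a ∈ I, ∑ b ∈ I, (g a * (g b * m b) * d a - g a * m a * (g b * d b))
      = -(2 : ℂ) • (vecOp I g m * diracOp I g d) - (2 : ℂ) • eulerOp I m d := by
    simp only [Finset.sum_sub_distrib, ← Finset.mul_sum, ← Finset.sum_mul]
    change ∑ a ∈ I, g a * vecOp I g m * d a - vecOp I g m * diracOp I g d = _
    rw [h.sum_g_mul_vec_mul_d, two_mul]; module
  have hS3 : ∑ a ∈ I, ∑ b ∈ I, (m b * d a * (m b * d a) - m b * (d a * m a) * d b)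
      = vecOp I g m * vecOp I g m * (diracOp I g d * diracOp I g d)
        - eulerOp I m d * eulerOp I m d - ((I.card : ℂ) - 2) • eulerOp I m d := by
    rw [h.vec_sq, h.dirac_sq, neg_mul_neg]
    have h1 : ∀ a ∈ I, ∑ b ∈ I, m b * d a * (m b * d a)
        = (∑ b ∈ I, m b * m b) * (d a * d a) + m a * d a := by
      intro a ha
      have h2 : ∀ b ∈ I, m b * d a * (m b * d a)
          = m b * m b * (d a * d a) + if a = b then m b * d b else 0 := by
        intro b _
        calc _ = m b * (d a * m b) * d a := by noncomm_ring
          _ = _ := by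
            rw [h.dm]
            split_ifs with hab
            · subst hab; noncomm_ring
            · noncomm_ring
      rw [Finset.sum_congr rfl h2, Finset.sum_add_distrib, Finset.sum_ite_eq I a, if_pos ha,
        Finset.sum_mul]
    have h3 : ∑ a ∈ I, ∑ b ∈ I, m b * (d a * m a) * d b
        = eulerOp I m d * eulerOp I m d + ((I.card : ℂ) - 1) • eulerOp I m d := by
      have h4 : ∑ a ∈ I, d a * m a = eulerOp I m d + (I.card : ℂ) • 1 := by
        simp only [h.dm, if_true, Finset.sum_add_distrib, Finset.sum_const, eulerOp]
        rw [Nat.cast_smul_eq_nsmul]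
      have h5 : ∀ b ∈ I, m b * (eulerOp I m d + (I.card : ℂ) • 1) * d b
          = m b * d b * eulerOp I m d + ((I.card : ℂ) - 1) • (m b * d b) := by
        intro b hb
        have h6 : eulerOp I m d * d b = d b * eulerOp I m d - d b := by
          rw [h.d_euler hb]; abel
        rw [mul_assoc, add_mul, h6, smul_mul_assoc, one_mul, mul_add, mul_sub, mul_smul_comm,
          mul_assoc]
        module
      rw [Finset.sum_comm]
      simp only [← Finset.mul_sum, ← Finset.sum_mul]
      rw [h4, Finset.sum_congr rfl h5, Finset.sum_add_distrib, ← Finset.sum_mul,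
        ← Finset.smul_sum, ← eulerOp]
    simp only [Finset.sum_sub_distrib]
    have hE : ∑ a ∈ I, m a * d a = eulerOp I m d := rfl
    rw [h3, Finset.sum_congr rfl h1, Finset.sum_add_distrib, ← Finset.mul_sum, hE]
    module
  have hS4 : ∑ a ∈ I, ∑ b ∈ I, (m a * d b * (m a * d b) - m a * (d b * m b) * d a)
      = vecOp I g m * vecOp I g m * (diracOp I g d * diracOp I g d)
        - eulerOp I m d * eulerOp I m d - ((I.card : ℂ) - 2) • eulerOp I m d := by
    rw [← hS3, Finset.sum_comm]
  rw [casimirOp, Finset.sum_congr rfl fun a ha => Finset.sum_congr rfl (hrot a ha)]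
  simp only [Finset.sum_add_distrib, ← Finset.smul_sum, hS1, hS2, hS3, hS4]
  module

end CliffordWeyl

end Operators

/-! ### Separation of eigenvectors; Fischer constants and Casimir eigenvalues -/

/-- If a subspace stable under `f` contains a sum of eigenvectors of `f` with pairwise distinct
eigenvalues, then it contains each of them. -/
theorem mem_of_sum_mem_of_eigen {P κ : Type*} [AddCommGroup P] [Module ℂ P]
    (f : Module.End ℂ P) (W : Submodule ℂ P) (hW : ∀ w ∈ W, f w ∈ W) (c : κ → ℂ) (s : Finset κ)
    (hc : Set.InjOn c s) (v : κ → P) (hv : ∀ i ∈ s, f (v i) = c i • v i)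
    (hsum : ∑ i ∈ s, v i ∈ W) : ∀ i ∈ s, v i ∈ W := by
  classical
  induction s using Finset.induction_on generalizing v with
  | empty => simp
  | insert a s ha ih =>
    -- The operator f - c_a kills v_a and multiplies every other v_i by the nonzero number c_i -
    -- c_a, so the induction hypothesis applies to the remaining sum.
    have h1 : ∀ i ∈ s, (c i - c a) • v i ∈ W := by
      refine ih (hc.mono (by simp)) (fun i => (c i - c a) • v i) ?_ ?_
      · intro i hi
        rw [map_smul, hv i (Finset.mem_insert_of_mem hi), smul_comm]
      · have h2 := W.sub_mem (hW _ hsum) (W.smul_mem (c a) hsum)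
        convert h2 using 1
        rw [map_sum, Finset.smul_sum, ← Finset.sum_sub_distrib, Finset.sum_insert ha,
          hv a (Finset.mem_insert_self a s), sub_self, zero_add]
        refine Finset.sum_congr rfl fun i hi => ?_
        rw [hv i (Finset.mem_insert_of_mem hi), sub_smul]
    have h3 : ∀ i ∈ s, v i ∈ W := by
      intro i hi
      have hne : c i - c a ≠ 0 := by
        rw [sub_ne_zero]
        intro h
        exact ha (hc (by simp [hi]) (by simp) h ▸ hi)
      exact (W.smul_mem_iff hne).1 (h1 i hi)
    intro i hi
    rcases Finset.mem_insert.1 hi with rfl | hi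
    · rw [Finset.sum_insert ha] at hsum
      exact (W.add_mem_iff_left (W.sum_mem h3)).1 hsum
    · exact h3 i hi

/-- The constants in `D x^{j+1} p = c_{j+1} x^j p`, for `p` monogenic of degree `s` in dimension
`q`. -/
def fischerConst (q s : ℕ) : ℕ → ℂ
  | 0 => 0
  | j + 1 => -(fischerConst q s j + 2 * s + 2 * j + q)

theorem fischerConst_even (q s i : ℕ) : fischerConst q s (2 * i) = -(2 * i) := by
  induction i with
  | zero => simp [fischerConst]
  | succ i ih =>
    rw [show 2 * (i + 1) = 2 * i + 1 + 1 by ring, fischerConst, fischerConst, ih]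
    push_cast; ring

theorem fischerConst_odd (q s i : ℕ) :
    fischerConst q s (2 * i + 1) = -(2 * i + 2 * s + q) := by
  rw [fischerConst, fischerConst_even]; push_cast; ring

theorem fischerConst_succ_ne_zero {q : ℕ} (hq : 0 < q) (s j : ℕ) :
    fischerConst q s (j + 1) ≠ 0 := by
  rcases Nat.even_or_odd' j with ⟨i, rfl | rfl⟩
  · rw [fischerConst_odd, neg_ne_zero]
    norm_cast; omega
  · rw [show 2 * i + 1 + 1 = 2 * (i + 1) by ring, fischerConst_even, neg_ne_zero]
    norm_cast

/-- The value of the Casimir operator on monogenics of degree `s` in dimension `q`. -/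
def casimirValue (q s : ℕ) : ℂ := -(2 * s * s + 2 * ((q : ℂ) - 1) * s + q * (q - 2) / 4)

/-- The values at a and b differ by -2(a-b)(a+b+q-1), and for q ≥ 1 the second factor vanishes only
when a = b = 0. -/
theorem casimirValue_injective {q : ℕ} (hq : 0 < q) : Function.Injective (casimirValue q) := by
  intro a b hab
  obtain ⟨q, rfl⟩ := Nat.exists_eq_add_of_lt hq
  have h : ((a : ℂ) - b) * ((a + b + q : ℕ) : ℂ) = 0 := by
    unfold casimirValue at hab
    push_cast at hab ⊢
    linear_combination -hab / 2
  rcases mul_eq_zero.1 h with h | h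
  · exact_mod_cast sub_eq_zero.1 h
  · have := Nat.cast_eq_zero.1 h
    omega

/-- Reality is needed because an invariant inner product is conjugate-linear in its first argument.
-/
theorem conj_casimirValue (q s : ℕ) : (starRingEnd ℂ) (casimirValue q s) = casimirValue q s := by
  have : casimirValue q s
      = ((-(2 * s * s + 2 * ((q : ℝ) - 1) * s + q * (q - 2) / 4) : ℝ) : ℂ) := by
    rw [casimirValue]; push_cast; rfl
  rw [this, Complex.conj_ofReal]

/-! ### Fischer decomposition and the action of boosts -/

section Graded

variable {P ι : Type*} [AddCommGroup P] [Module ℂ P]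

/-- A family of subspaces that behaves like homogeneous polynomials of degree `0, 1, 2, …`. -/
structure CliffordGraded (I : Finset ι) (g m d : ι → Module.End ℂ P)
    (H : ℕ → Submodule ℂ P) : Prop where
  g_mem : ∀ a ∈ I, ∀ k, ∀ p ∈ H k, g a p ∈ H k
  m_mem : ∀ a ∈ I, ∀ k, ∀ p ∈ H k, m a p ∈ H (k + 1)
  d_mem : ∀ a ∈ I, ∀ k, ∀ p ∈ H (k + 1), d a p ∈ H k
  d_zero : ∀ a ∈ I, ∀ p ∈ H 0, d a p = 0
  euler : ∀ k, ∀ p ∈ H k, eulerOp I m d p = (k : ℂ) • p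

/-- The homogeneous monogenics of degree `k`. -/
def monPart (I : Finset ι) (g d : ι → Module.End ℂ P) (H : ℕ → Submodule ℂ P) (k : ℕ) :
    Submodule ℂ P := H k ⊓ LinearMap.ker (diracOp I g d)

/-- Stability under all rotations. -/
def RotStable (I : Finset ι) (g m d : ι → Module.End ℂ P) (W : Submodule ℂ P) : Prop :=
  ∀ a ∈ I, ∀ b ∈ I, ∀ p ∈ W, rotOp g m d a b p ∈ W

variable {I : Finset ι} {g m d : ι → Module.End ℂ P}

theorem RotStable.casimir_mem {W : Submodule ℂ P} (hW : RotStable I g m d W) {p : P}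
    (hp : p ∈ W) : casimirOp I g m d p ∈ W := by
  simp only [casimirOp, LinearMap.sum_apply, Module.End.mul_apply]
  exact W.sum_mem fun a ha => W.sum_mem fun b hb => hW a ha b hb _ (hW a ha b hb _ hp)

namespace CliffordGraded

variable {H : ℕ → Submodule ℂ P} (hH : CliffordGraded I g m d H)

include hH

theorem vec_mem {k : ℕ} {p : P} (hp : p ∈ H k) : vecOp I g m p ∈ H (k + 1) := by
  simp only [vecOp, LinearMap.sum_apply, Module.End.mul_apply]
  exact (H _).sum_mem fun a ha => hH.g_mem a ha _ _ (hH.m_mem a ha _ _ hp)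

theorem vec_pow_mem {k : ℕ} {p : P} (hp : p ∈ H k) (j : ℕ) :
    (vecOp I g m ^ j) p ∈ H (k + j) := by
  induction j with
  | zero => simpa using hp
  | succ j ih => rw [pow_succ', Module.End.mul_apply]; exact hH.vec_mem ih

theorem dirac_mem {k : ℕ} {p : P} (hp : p ∈ H (k + 1)) : diracOp I g d p ∈ H k := by
  simp only [diracOp, LinearMap.sum_apply, Module.End.mul_apply]
  exact (H _).sum_mem fun a ha => hH.g_mem a ha _ _ (hH.d_mem a ha _ _ hp)

theorem dirac_zero {p : P} (hp : p ∈ H 0) : diracOp I g d p = 0 := by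
  simp only [diracOp, LinearMap.sum_apply, Module.End.mul_apply]
  exact Finset.sum_eq_zero fun a ha => by rw [hH.d_zero a ha p hp, map_zero]

variable [DecidableEq ι] (h : CliffordWeyl I g m d)

include h

theorem dirac_vec_apply {k : ℕ} {p : P} (hp : p ∈ H k) :
    diracOp I g d (vecOp I g m p)
      = -(vecOp I g m (diracOp I g d p)) - (2 * k + I.card : ℂ) • p := by
  have := congrArg (fun T : Module.End ℂ P => T p) h.dirac_vec
  simp only [Module.End.mul_apply, LinearMap.sub_apply, LinearMap.neg_apply,
    Module.End.natCast_apply, Module.End.ofNat_apply, hH.euler k p hp] at this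
  rw [this, add_smul, mul_smul]
  simp only [Nat.cast_smul_eq_nsmul, ofNat_smul_eq_nsmul]
  abel

theorem dirac_vec_pow {s : ℕ} {p : P} (hp : p ∈ monPart I g d H s) (j : ℕ) :
    diracOp I g d ((vecOp I g m ^ (j + 1)) p)
      = fischerConst I.card s (j + 1) • (vecOp I g m ^ j) p := by
  induction j with
  | zero =>
    rw [pow_succ', Module.End.mul_apply, hH.dirac_vec_apply h (hH.vec_pow_mem hp.1 0)]
    have : diracOp I g d p = 0 := hp.2
    simp only [pow_zero, Module.End.one_apply, this, map_zero, fischerConst]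
    module
  | succ j ih =>
    have hc : fischerConst I.card s (j + 1 + 1)
      = -(fischerConst I.card s (j + 1) + 2 * s + 2 * (j + 1 : ℕ) + I.card) := rfl
    rw [pow_succ', Module.End.mul_apply, hH.dirac_vec_apply h (hH.vec_pow_mem hp.1 _), ih,
      map_smul, ← Module.End.mul_apply, ← pow_succ', hc]
    push_cast; module

/-- Applying D to x^{j+1} p = 0 leaves a nonzero multiple of x^j p, and the exponent goes down. -/
theorem vec_pow_injective (hI : 0 < I.card) {s : ℕ} {p : P} (hp : p ∈ monPart I g d H s) (j : ℕ)
    (h0 : (vecOp I g m ^ j) p = 0) : p = 0 := by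
  induction j with
  | zero => simpa using h0
  | succ j ih =>
    have := hH.dirac_vec_pow h hp j
    rw [h0, map_zero, eq_comm, smul_eq_zero] at this
    exact ih (this.resolve_left (fischerConst_succ_ne_zero hI s j))

theorem casimir_monogenic {s : ℕ} {p : P} (hp : p ∈ monPart I g d H s) :
    casimirOp I g m d p = casimirValue I.card s • p := by
  have hD : diracOp I g d p = 0 := hp.2
  have hE := hH.euler s p hp.1
  rw [h.casimir_eq]
  simp only [LinearMap.sub_apply, LinearMap.smul_apply, Module.End.mul_apply, hD, hE, map_zero,
    map_smul, Module.End.one_apply, casimirValue]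
  module

theorem casimir_vec_pow {s : ℕ} {p : P} (hp : p ∈ monPart I g d H s) (j : ℕ) :
    casimirOp I g m d ((vecOp I g m ^ j) p)
      = casimirValue I.card s • (vecOp I g m ^ j) p := by
  have hc : Commute (casimirOp I g m d) (vecOp I g m ^ j) := by
    refine Commute.pow_right ?_ j
    exact Commute.sum_left _ _ _ fun a ha => Commute.sum_left _ _ _ fun b hb =>
      (h.rot_vec ha hb).mul_left (h.rot_vec ha hb)
  rw [← Module.End.mul_apply, hc.eq, Module.End.mul_apply, hH.casimir_monogenic h hp, map_smul]

/-- The Fischer decomposition. -/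
theorem fischer (hI : 0 < I.card) (k : ℕ) {p : P} (hp : p ∈ H k) :
    ∃ f : ℕ → P, (∀ j ≤ k, f j ∈ monPart I g d H (k - j)) ∧
      p = ∑ j ∈ Finset.range (k + 1), (vecOp I g m ^ j) (f j) := by
  induction k generalizing p with
  | zero =>
    refine ⟨fun _ => p, fun j hj => ?_, by simp⟩
    obtain rfl : j = 0 := by omega
    exact ⟨hp, hH.dirac_zero hp⟩
  | succ k ih =>
    obtain ⟨f, hf, hsum⟩ := ih (hH.dirac_mem hp)
    -- Dividing the components of Dp by the constants in D x^{j+1} f = c_{j+1} x^j f produces Q with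
    -- DQ = Dp; then p - Q is the monogenic component of p.
    set g' : ℕ → P := fun j => (fischerConst I.card (k - j) (j + 1))⁻¹ • f j with hg'
    set Q := ∑ j ∈ Finset.range (k + 1), (vecOp I g m ^ (j + 1)) (g' j) with hQ
    have hg'm : ∀ j ≤ k, g' j ∈ monPart I g d H (k - j) := fun j hj =>
      Submodule.smul_mem _ _ (hf j hj)
    have hQH : Q ∈ H (k + 1) := by
      refine Submodule.sum_mem _ fun j hj => ?_
      have hj' : j ≤ k := by have := Finset.mem_range.1 hj; omega
      have := hH.vec_pow_mem (hg'm j hj').1 (j + 1)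
      rwa [show k - j + (j + 1) = k + 1 by omega] at this
    have hDQ : diracOp I g d Q = diracOp I g d p := by
      rw [hsum, hQ, map_sum]
      refine Finset.sum_congr rfl fun j hj => ?_
      have hj' : j ≤ k := by have := Finset.mem_range.1 hj; omega
      rw [hH.dirac_vec_pow h (hg'm j hj'), hg', map_smul, smul_smul,
        mul_inv_cancel₀ (fischerConst_succ_ne_zero hI _ _), one_smul]
    refine ⟨fun j => if j = 0 then p - Q else g' (j - 1), fun j hj => ?_, ?_⟩
    · rcases Nat.eq_zero_or_pos j with rfl | hj0
      · refine ⟨Submodule.sub_mem _ hp hQH, ?_⟩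
        simp [hDQ]
      · have := hg'm (j - 1) (by omega)
        simp only [if_neg hj0.ne']
        rwa [show k + 1 - j = k - (j - 1) by omega]
    · rw [Finset.sum_range_succ']
      simp [hQ]

/-- Decomposition of `g_a p` and `m_a p` for a homogeneous monogenic `p`. -/
theorem exists_decomp (hI : Odd I.card) {a : ι} (ha : a ∈ I) {s : ℕ} {p : P}
    (hp : p ∈ monPart I g d H s) :
    ∃ u v w : P, u ∈ monPart I g d H (s + 1) ∧ v ∈ monPart I g d H s ∧
      w ∈ monPart I g d H (s - 1) ∧ (s = 0 → w = 0) ∧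
      d a p = -(2 * s + I.card - 2 : ℂ) • w ∧
      g a p = -(2 * s + I.card : ℂ) • v - (2 : ℂ) • vecOp I g m w ∧
      m a p = u + vecOp I g m v + vecOp I g m (vecOp I g m w) := by
  have hD : diracOp I g d p = 0 := hp.2
  -- Oddness of the dimension enters here: 2s + q - 2 could otherwise vanish, at q = 2 and s = 0.
  have hk1 : (2 * s + I.card - 2 : ℂ) ≠ 0 := by
    rw [sub_ne_zero]
    norm_cast
    intro h
    obtain ⟨r, hr⟩ := hI
    omega
  have hk2 : (2 * s + I.card : ℂ) ≠ 0 := by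
    norm_cast
    have := hI.pos
    omega
  have hs0 : s = 0 → d a p = 0 := by rintro rfl; exact hH.d_zero a ha p hp.1
  -- The components are forced: applying D to m_a p = u + xv + x²w gives g_a p = -(2s+q)v - 2xw, and
  -- applying D again gives -2 d_a p = 2(2s+q-2)w. For s = 0 the truncated degree s - 1 is harmless
  -- because w = 0.
  set w := -((2 * s + I.card - 2 : ℂ)⁻¹ • d a p) with hw
  have hwd : d a p = -(2 * s + I.card - 2 : ℂ) • w := by
    rw [hw, smul_neg, neg_smul, neg_neg, smul_smul, mul_inv_cancel₀ hk1, one_smul]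
  have hw0 : s = 0 → w = 0 := fun h0 => by rw [hw, hs0 h0]; simp
  have hDd : diracOp I g d (d a p) = 0 := by
    rw [← Module.End.mul_apply, ← h.d_dirac, Module.End.mul_apply, hD, map_zero]
  have hwm : w ∈ monPart I g d H (s - 1) := by
    refine Submodule.neg_mem _ (Submodule.smul_mem _ _ ⟨?_, hDd⟩)
    rcases s with _ | s
    · rw [hs0 rfl]; exact Submodule.zero_mem _
    · exact hH.d_mem a ha s p hp.1
  have hDxw : diracOp I g d (vecOp I g m w) = d a p := by
    rcases s with _ | s
    · rw [hw0 rfl, hs0 rfl, map_zero, map_zero]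
    · rw [hwd]
      have := hH.dirac_vec_pow h hwm 0
      simp only [zero_add, pow_one, pow_zero, Module.End.one_apply, fischerConst] at this
      rw [this]
      push_cast; module
  have hxw : vecOp I g m w ∈ H s := by
    rcases s with _ | s
    · rw [hw0 rfl, map_zero]; exact Submodule.zero_mem _
    · exact hH.vec_mem hwm.1
  set v := -((2 * s + I.card : ℂ)⁻¹ • (g a p + (2 : ℂ) • vecOp I g m w)) with hv
  have hgv : g a p = -(2 * s + I.card : ℂ) • v - (2 : ℂ) • vecOp I g m w := by
    rw [hv, smul_neg, neg_smul, neg_neg, smul_smul, mul_inv_cancel₀ hk2, one_smul,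
      add_sub_cancel_right]
  have hvm : v ∈ monPart I g d H s := by
    refine Submodule.neg_mem _ (Submodule.smul_mem _ _ ⟨?_, ?_⟩)
    · exact Submodule.add_mem _ (hH.g_mem a ha s p hp.1) (Submodule.smul_mem _ _ hxw)
    · have h1 : diracOp I g d (g a p) = -(2 : ℂ) • d a p := by
        have := congrArg (fun T : Module.End ℂ P => T p) (h.g_dirac ha)
        simp only [Module.End.mul_apply, LinearMap.sub_apply, LinearMap.neg_apply, hD, map_zero,
          Module.End.ofNat_apply] at this
        rw [eq_comm, sub_eq_zero, neg_eq_iff_eq_neg] at this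
        rw [this, neg_smul, ofNat_smul_eq_nsmul ℂ]
      change diracOp I g d _ = 0
      rw [map_add, map_smul, h1, hDxw]
      module
  refine ⟨m a p - vecOp I g m v - vecOp I g m (vecOp I g m w), v, w, ⟨?_, ?_⟩, hvm, hwm, hw0, hwd,
    hgv, by abel⟩
  · exact Submodule.sub_mem _ (Submodule.sub_mem _ (hH.m_mem a ha s p hp.1) (hH.vec_mem hvm.1))
      (hH.vec_mem hxw)
  · have h1 : diracOp I g d (m a p) = g a p := by
      rw [← Module.End.mul_apply, h.dirac_m ha, LinearMap.add_apply, Module.End.mul_apply, hD,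
        map_zero, zero_add]
    have h2 := hH.dirac_vec_pow h hvm 0
    have h3 := hH.dirac_vec_pow h hwm 1
    simp only [zero_add, pow_zero, Module.End.one_apply, fischerConst, pow_succ,
      Module.End.mul_apply, one_mul, Nat.reduceAdd] at h2 h3
    change diracOp I g d _ = 0
    rw [map_sub, map_sub, h1, h2, h3, hgv]
    push_cast; module

/-- The operator `½ g_a + m_a D` in terms of the Fischer decomposition. -/
theorem boost_vec_pow (hI : 0 < I.card) {a : ι} (ha : a ∈ I) {s : ℕ} {p u v w : P}
    (hp : p ∈ monPart I g d H s)
    (hg : g a p = -(2 * s + I.card : ℂ) • v - (2 : ℂ) • vecOp I g m w)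
    (hm : m a p = u + vecOp I g m v + vecOp I g m (vecOp I g m w)) (j : ℕ) :
    ∃ α β δ : ℂ, (j = 0 → α = 0) ∧ (j ≠ 0 → α ≠ 0) ∧ β ≠ 0 ∧ δ ≠ 0 ∧
      ((1 / 2 : ℂ) • g a + m a * diracOp I g d) ((vecOp I g m ^ j) p)
        = α • (vecOp I g m ^ (j - 1)) u + β • (vecOp I g m ^ j) v
          + δ • (vecOp I g m ^ (j + 1)) w := by
  have hmx : ∀ j, m a * vecOp I g m ^ j = vecOp I g m ^ j * m a := fun j =>
    ((show Commute (m a) (vecOp I g m) from h.m_vec a).pow_right j).eq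
  have hgx : ∀ i, g a * vecOp I g m ^ (2 * i) = vecOp I g m ^ (2 * i) * g a := fun i => by
    rw [pow_mul, pow_two]
    exact ((show Commute (g a) (vecOp I g m * vecOp I g m) from h.g_vec_sq ha).pow_right i).eq
  have key : ∀ j, ((1 / 2 : ℂ) • g a + m a * diracOp I g d) ((vecOp I g m ^ (j + 1)) p)
      = (1 / 2 : ℂ) • g a ((vecOp I g m ^ (j + 1)) p)
        + fischerConst I.card s (j + 1) • (vecOp I g m ^ j) (m a p) := by
    intro j
    rw [LinearMap.add_apply, LinearMap.smul_apply, Module.End.mul_apply,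
      hH.dirac_vec_pow h hp, map_smul, ← Module.End.mul_apply (m a), hmx, Module.End.mul_apply]
  have hD : diracOp I g d p = 0 := hp.2
  -- Even powers of x commute with g_a; an odd power leaves one x to be crossed, by g_a x = -x g_a -
  -- 2 m_a, which adds a further multiple of m_a p.
  rcases Nat.even_or_odd' j with ⟨i, rfl | rfl⟩
  · have hgi : g a ((vecOp I g m ^ (2 * i)) p) = (vecOp I g m ^ (2 * i)) (g a p) := by
      rw [← Module.End.mul_apply, hgx, Module.End.mul_apply]
    rcases i with _ | i
    · refine ⟨0, -(s + I.card / 2), -1, fun _ => rfl, by simp, ?_, by simp, ?_⟩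
      · rw [neg_ne_zero]
        intro h0
        have : (2 * s + I.card : ℂ) = 0 := by linear_combination 2 * h0
        norm_cast at this
        omega
      · simp only [mul_zero, pow_zero, Module.End.one_apply, LinearMap.add_apply,
          LinearMap.smul_apply, Module.End.mul_apply, hD, map_zero, hg, zero_add, pow_one]
        module
    -- Here α is the Fischer constant c_j; β and δ are c_j plus the contributions -(s + q/2) and -1
    -- of ½ g_a p.
    · refine ⟨-(2 * i + 2), -(s + I.card / 2 + (2 * i + 2)), -(2 * i + 3), by simp, fun _ => ?_,
        ?_, ?_, ?_⟩
      · rw [neg_ne_zero]; norm_cast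
      · rw [neg_ne_zero]
        intro h0
        have : (2 * s + I.card + 2 * (2 * i + 2) : ℂ) = 0 := by linear_combination 2 * h0
        norm_cast at this
      · rw [neg_ne_zero]; norm_cast
      · have e1 : 2 * (i + 1) = 2 * i + 1 + 1 := by ring
        have e2 : fischerConst I.card s (2 * i + 1 + 1) = -(2 * i + 2) := by
          rw [← e1, fischerConst_even]; push_cast; ring
        rw [e1] at hgi ⊢
        rw [key, hgi, e2, hg, hm]
        simp only [Nat.add_sub_cancel, map_add, map_sub, map_smul]
        simp only [← Module.End.mul_apply, ← mul_assoc, ← pow_succ]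
        module
  -- Crossing one x replaces ½ g_a p by -½ x g_a p - m_a p, so α = c_j - 1, and β, δ are c_j - 1
  -- plus s + q/2 and 1.
  · refine ⟨-(2 * i + 1 + 2 * s + I.card), -(2 * i + 1 + s + I.card / 2),
      -(2 * i + 2 * s + I.card), by simp, fun _ => ?_, ?_, ?_, ?_⟩
    · rw [neg_ne_zero]; norm_cast; omega
    · rw [neg_ne_zero]
      intro h0
      have : (2 * (2 * i + 1) + 2 * s + I.card : ℂ) = 0 := by linear_combination 2 * h0
      norm_cast at this
      omega
    · rw [neg_ne_zero]; norm_cast; omega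
    · have hgi : g a ((vecOp I g m ^ (2 * i + 1)) p)
          = (vecOp I g m ^ (2 * i)) (-(vecOp I g m (g a p)) - (2 : ℂ) • m a p) := by
        rw [pow_succ, ← Module.End.mul_apply, ← mul_assoc, hgx, mul_assoc, h.g_vec ha,
          Module.End.mul_apply]
        simp [ofNat_smul_eq_nsmul ℂ]
      rw [key, hgi, fischerConst_odd, hg, hm]
      simp only [Nat.add_sub_cancel, map_add, map_sub, map_smul, map_neg]
      simp only [← Module.End.mul_apply, ← mul_assoc, ← pow_succ]
      module

/-! ### Subspaces stable under rotations and boosts -/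

section Stable

variable {W : Submodule ℂ P} {l : ℕ} (hI : Odd I.card) (hrot : RotStable I g m d W)
  (hboost : ∀ a ∈ I, ∀ p ∈ W, ((1 / 2 : ℂ) • g a + m a * diracOp I g d) p ∈ W)

include hI hrot hboost

/-- The boost of x^j p is a combination of x^{j-1}u, x^j v and x^{j+1}w, which are Casimir
eigenvectors for the degrees s+1, s, s-1. A stable space therefore contains each term whose
coefficient is nonzero. -/
theorem components_mem {a : ι} (ha : a ∈ I) {s : ℕ} {p u v w : P}
    (hp : p ∈ monPart I g d H s) (hu : u ∈ monPart I g d H (s + 1)) (hv : v ∈ monPart I g d H s)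
    (hw : w ∈ monPart I g d H (s - 1)) (hw0 : s = 0 → w = 0)
    (hg : g a p = -(2 * s + I.card : ℂ) • v - (2 : ℂ) • vecOp I g m w)
    (hm : m a p = u + vecOp I g m v + vecOp I g m (vecOp I g m w)) {j : ℕ}
    (hpW : (vecOp I g m ^ j) p ∈ W) :
    (j ≠ 0 → (vecOp I g m ^ (j - 1)) u ∈ W) ∧ (vecOp I g m ^ j) v ∈ W ∧
      (vecOp I g m ^ (j + 1)) w ∈ W := by
  obtain ⟨α, β, δ, -, hα, hβ, hδ, heq⟩ := hH.boost_vec_pow h hI.pos ha hp hg hm j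
  have hmem := hboost a ha _ hpW
  rw [heq] at hmem
  have hinj := casimirValue_injective hI.pos
  have hCu := hH.casimir_vec_pow h hu (j - 1)
  have hCv := hH.casimir_vec_pow h hv j
  have hCw := hH.casimir_vec_pow h hw (j + 1)
  -- For s = 0 truncation gives s - 1 = s and the eigenvalues would not be distinct; in this case w
  -- = 0 and two terms remain.
  rcases s with _ | s
  · rw [hw0 rfl, map_zero, smul_zero, add_zero] at hmem
    have hall := mem_of_sum_mem_of_eigen (casimirOp I g m d) W (fun w hw => hrot.casimir_mem hw)
      (fun i : Fin 2 => casimirValue I.card i) Finset.univ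
      (fun x _ y _ hxy => Fin.val_injective (hinj hxy))
      ![β • (vecOp I g m ^ j) v, α • (vecOp I g m ^ (j - 1)) u]
      (by
        intro i _
        fin_cases i
        · simp only [Fin.zero_eta, Matrix.cons_val_zero, map_smul, hCv]
          rw [smul_comm]
        · simp only [Fin.mk_one, Matrix.cons_val_one, map_smul, Matrix.cons_val_zero, hCu]
          rw [smul_comm])
      (by rw [Fin.sum_univ_two]; simpa [add_comm] using hmem)
    have h0 := hall 0 (Finset.mem_univ _)
    have h1 := hall 1 (Finset.mem_univ _)
    simp only [Matrix.cons_val_zero, Matrix.cons_val_one] at h0 h1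
    refine ⟨fun hj => (W.smul_mem_iff (hα hj)).1 h1, (W.smul_mem_iff hβ).1 h0, ?_⟩
    rw [hw0 rfl, map_zero]
    exact W.zero_mem
  · have hall := mem_of_sum_mem_of_eigen (casimirOp I g m d) W (fun w hw => hrot.casimir_mem hw)
      (fun i : Fin 3 => casimirValue I.card (s + i)) Finset.univ
      (fun x _ y _ hxy => Fin.val_injective (Nat.add_left_cancel (hinj hxy)))
      ![δ • (vecOp I g m ^ (j + 1)) w, β • (vecOp I g m ^ j) v, α • (vecOp I g m ^ (j - 1)) u]
      (by
        intro i _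
        fin_cases i
        · change casimirOp I g m d (δ • (vecOp I g m ^ (j + 1)) w)
            = casimirValue I.card s • (δ • (vecOp I g m ^ (j + 1)) w)
          rw [map_smul, hCw, smul_comm]; rfl
        · change casimirOp I g m d (β • (vecOp I g m ^ j) v)
            = casimirValue I.card (s + 1) • (β • (vecOp I g m ^ j) v)
          rw [map_smul, hCv, smul_comm]
        · change casimirOp I g m d (α • (vecOp I g m ^ (j - 1)) u)
            = casimirValue I.card (s + 2) • (α • (vecOp I g m ^ (j - 1)) u)
          rw [map_smul, hCu, smul_comm])
      (by
        rw [Fin.sum_univ_three]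
        change δ • (vecOp I g m ^ (j + 1)) w + β • (vecOp I g m ^ j) v
          + α • (vecOp I g m ^ (j - 1)) u ∈ W
        convert hmem using 1
        abel)
    have h0 : δ • (vecOp I g m ^ (j + 1)) w ∈ W := hall 0 (Finset.mem_univ _)
    have h1 : β • (vecOp I g m ^ j) v ∈ W := hall 1 (Finset.mem_univ _)
    have h2 : α • (vecOp I g m ^ (j - 1)) u ∈ W := hall 2 (Finset.mem_univ _)
    exact ⟨fun hj => (W.smul_mem_iff (hα hj)).1 h2, (W.smul_mem_iff hβ).1 h1,
      (W.smul_mem_iff hδ).1 h0⟩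

/-- Descent on the degree s with s + j fixed. By Euler's identity some derivative d_a p is nonzero,
and the component w of m_a p is proportional to it, so x^{j+1}w is a nonzero element of W built on a
monogenic of lower degree. -/
theorem exists_constant_of_monogenic {s j : ℕ} {p : P}
    (hp : p ∈ monPart I g d H s) (hp0 : p ≠ 0) (hpW : (vecOp I g m ^ j) p ∈ W)
    (hsj : s + j = l) : ∃ c ∈ H 0, c ≠ 0 ∧ (vecOp I g m ^ l) c ∈ W := by
  induction s generalizing j p with
  | zero =>
    obtain rfl : j = l := by omega
    exact ⟨p, hp.1, hp0, hpW⟩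
  | succ s ih =>
    have hE := hH.euler (s + 1) p hp.1
    obtain ⟨a, ha, hda⟩ : ∃ a ∈ I, d a p ≠ 0 := by
      by_contra! hcon
      rw [eulerOp, LinearMap.sum_apply, Finset.sum_eq_zero fun a ha => by
        rw [Module.End.mul_apply, hcon a ha, map_zero], eq_comm, smul_eq_zero] at hE
      exact hE.elim (fun h0 => Nat.cast_ne_zero.2 s.succ_ne_zero h0) hp0
    obtain ⟨u, v, w, hu, hv, hw, hw0, hdw, hgw, hmw⟩ := hH.exists_decomp h hI ha hp
    refine ih (j := j + 1) (p := w) hw ?_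
      (hH.components_mem h hI hrot hboost ha hp hu hv hw hw0 hgw hmw hpW).2.2 (by omega)
    rintro rfl
    exact hda (by rw [hdw, smul_zero])

/-- A nonzero stable subspace contains some `x^l c` with `c` constant. -/
theorem exists_constant (hWH : W ≤ H l) (hW : W ≠ ⊥) :
    ∃ c ∈ H 0, c ≠ 0 ∧ (vecOp I g m ^ l) c ∈ W := by
  obtain ⟨p, hpW, hp0⟩ := W.ne_bot_iff.1 hW
  obtain ⟨f, hf, hsum⟩ := hH.fischer h hI.pos l (hWH hpW)
  -- The Fischer components of an element of W have distinct Casimir eigenvalues, so they all lie in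
  -- W; any nonzero one starts the descent.
  have hall := mem_of_sum_mem_of_eigen (casimirOp I g m d) W (fun w hw => hrot.casimir_mem hw)
    (fun j => casimirValue I.card (l - j)) (Finset.range (l + 1))
    (fun x hx y hy hxy => by
      have := casimirValue_injective hI.pos hxy
      have := Finset.mem_range.1 hx
      have := Finset.mem_range.1 hy
      omega)
    (fun j => (vecOp I g m ^ j) (f j))
    (fun j hj => hH.casimir_vec_pow h (hf j (by have := Finset.mem_range.1 hj; omega)) j)
    (hsum ▸ hpW)
  obtain ⟨j, hj, hj0⟩ : ∃ j ∈ Finset.range (l + 1), (vecOp I g m ^ j) (f j) ≠ 0 := by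
    by_contra! hcon
    exact hp0 (hsum.trans (Finset.sum_eq_zero hcon))
  have hjl : j ≤ l := by have := Finset.mem_range.1 hj; omega
  refine hH.exists_constant_of_monogenic h hI hrot hboost (hf j hjl) ?_ (hall j hj) (by omega)
  intro h0
  exact hj0 (by rw [h0, map_zero])

/-- For a constant c the component w vanishes and g_a c is a multiple of v. Thus the constants c
with x^l c in W are stable under the Clifford generators. -/
theorem g_constant_mem {a : ι} (ha : a ∈ I) {c : P} (hc : c ∈ H 0)
    (hcW : (vecOp I g m ^ l) c ∈ W) : (vecOp I g m ^ l) (g a c) ∈ W := by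
  have hp : c ∈ monPart I g d H 0 := ⟨hc, hH.dirac_zero hc⟩
  obtain ⟨u, v, w, hu, hv, hw, hw0, hdw, hgw, hmw⟩ := hH.exists_decomp h hI ha hp
  have := (hH.components_mem h hI hrot hboost ha hp hu hv hw hw0 hgw hmw hcW).2.1
  rw [hgw, hw0 rfl, map_zero, smul_zero, sub_zero, map_smul]
  exact W.smul_mem _ this

/-- The reverse climb. For p monogenic of degree s+1, the decompositions of m_a(d_a p) add up over a
to (s+1)p. Harmonicity of p cancels the sum of the w-components and Dp = 0 that of the v-components,
so (s+1)p is the sum of the u-components, which `components_mem` places in W after multiplication by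
x^j. The smaller family H' accommodates values in a subspace of S. -/
theorem le_of_constants {H' : ℕ → Submodule ℂ P} (hH' : CliffordGraded I g m d H')
    (hle : ∀ k, H' k ≤ H k) (hc : ∀ c ∈ H' 0, (vecOp I g m ^ l) c ∈ W) : H' l ≤ W := by
  have key : ∀ s j, s + j = l → ∀ p ∈ monPart I g d H' s, (vecOp I g m ^ j) p ∈ W := by
    intro s
    induction s with
    | zero =>
      intro j hj p hp
      obtain rfl : j = l := by omega
      exact hc p hp.1
    | succ s ih =>
      intro j hj p hp
      have hD : diracOp I g d p = 0 := hp.2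
      have hpa : ∀ a ∈ I, d a p ∈ monPart I g d H' s := fun a ha =>
        ⟨hH'.d_mem a ha s p hp.1, by
          change diracOp I g d _ = 0
          rw [← Module.End.mul_apply, ← h.d_dirac, Module.End.mul_apply, hD,
            map_zero]⟩
      have hdec : ∀ a : ι, ∃ u v w : P, a ∈ I → (u ∈ monPart I g d H (s + 1) ∧
          v ∈ monPart I g d H s ∧ w ∈ monPart I g d H (s - 1) ∧ (s = 0 → w = 0) ∧
          d a (d a p) = -(2 * s + I.card - 2 : ℂ) • w ∧
          g a (d a p) = -(2 * s + I.card : ℂ) • v - (2 : ℂ) • vecOp I g m w ∧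
          m a (d a p) = u + vecOp I g m v + vecOp I g m (vecOp I g m w)) := by
        intro a
        by_cases ha : a ∈ I
        · obtain ⟨u, v, w, hx⟩ := hH.exists_decomp h hI ha
            (p := d a p) (s := s) ⟨hle _ (hpa a ha).1, (hpa a ha).2⟩
          exact ⟨u, v, w, fun _ => hx⟩
        · exact ⟨0, 0, 0, fun h => absurd h ha⟩
      choose u v w hx using hdec
      have hw : ∑ a ∈ I, w a = 0 := by
        have h1 : ∑ a ∈ I, d a (d a p) = 0 := by
          have := congrArg (fun T : Module.End ℂ P => T p) h.dirac_sq
          simp only [Module.End.mul_apply, hD, map_zero, LinearMap.neg_apply,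
            LinearMap.sum_apply] at this
          exact neg_eq_zero.1 this.symm
        rw [Finset.sum_congr rfl fun a ha => (hx a ha).2.2.2.2.1, ← Finset.smul_sum,
          smul_eq_zero, neg_eq_zero, sub_eq_zero] at h1
        refine h1.resolve_left ?_
        norm_cast
        obtain ⟨r, hr⟩ := hI
        omega
      have hv : ∑ a ∈ I, v a = 0 := by
        have h1 : ∑ a ∈ I, g a (d a p) = 0 := by
          have := hD
          simpa only [diracOp, LinearMap.sum_apply, Module.End.mul_apply] using this
        rw [Finset.sum_congr rfl fun a ha => (hx a ha).2.2.2.2.2.1, Finset.sum_sub_distrib,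
          ← Finset.smul_sum, ← Finset.smul_sum, ← map_sum, hw, map_zero, smul_zero, sub_zero,
          smul_eq_zero, neg_eq_zero] at h1
        refine h1.resolve_left ?_
        norm_cast
        have := hI.pos
        omega
      have hu : ((s + 1 : ℕ) : ℂ) • p = ∑ a ∈ I, u a := by
        rw [← hH'.euler (s + 1) p hp.1]
        simp only [eulerOp, LinearMap.sum_apply, Module.End.mul_apply]
        rw [Finset.sum_congr rfl fun a ha => (hx a ha).2.2.2.2.2.2]
        simp only [Finset.sum_add_distrib, ← map_sum, hv, hw, map_zero, add_zero]
      have hmem : (vecOp I g m ^ j) (((s + 1 : ℕ) : ℂ) • p) ∈ W := by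
        rw [hu, map_sum]
        refine W.sum_mem fun a ha => ?_
        obtain ⟨x1, x2, x3, x4, x5, x6, x7⟩ := hx a ha
        have := (hH.components_mem h hI hrot hboost ha (p := d a p) (s := s)
          ⟨hle _ (hpa a ha).1, (hpa a ha).2⟩ x1 x2 x3 x4 x6 x7
          (ih (j + 1) (by omega) _ (hpa a ha))).1 j.succ_ne_zero
        simpa using this
      rw [map_smul] at hmem
      exact (W.smul_mem_iff (Nat.cast_ne_zero.2 s.succ_ne_zero)).1 hmem
  intro p hp
  obtain ⟨f, hf, hsum⟩ := hH'.fischer h hI.pos l hp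
  rw [hsum]
  refine W.sum_mem fun j hj => ?_
  have hjl : j ≤ l := by have := Finset.mem_range.1 hj; omega
  exact key (l - j) j (by omega) _ (hf j hjl)

end Stable

end CliffordGraded

end Graded

/-! ### Calculus of Clifford algebra valued polynomials -/

theorem e_anti {N : ℕ} {i j : Fin N} (hij : i ≠ j) : (e i : Cl N) * e j = -(e j * e i) := by
  rw [eq_neg_iff_add_eq_zero, e, e, CliffordAlgebra.ι_mul_ι_add_swap_of_isOrtho, ]
  rw [QuadraticMap.isOrtho_def]
  simp only [QuadraticMap.weightedSumSquares_apply, Pi.add_apply, ← Finset.sum_add_distrib]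
  refine Finset.sum_congr rfl fun l _ => ?_
  by_cases hi : l = i <;> by_cases hj : l = j <;> simp [hi, hj]
  · exact absurd (hi.symm.trans hj) hij
  · subst hi; simp [hj]
  · subst hj; simp [hi]

variable {N : ℕ}

theorem const_mul (u v : Cl N) : const (u * v) = const u * const v := by simp [const]

theorem const_one : const (1 : Cl N) = 1 := rfl

theorem const_add (u v : Cl N) : const (u + v) = const u + const v := TensorProduct.add_tmul _ _ _

theorem const_smul (c : ℂ) (u : Cl N) : const (c • u) = c • const u := rfl

theorem const_neg_mul (u : Cl N) (P : Pol N) : const (-u) * P = -(const u * P) := by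
  rw [eq_neg_iff_add_eq_zero, ← add_mul, ← const_add, neg_add_cancel, const,
    TensorProduct.zero_tmul, zero_mul]

/-- A scalar polynomial, as an element of `Pol N`. -/
def scal : MvPolynomial (Fin N) ℂ →ₐ[ℂ] Pol N := Algebra.TensorProduct.includeRight

theorem scal_apply (p : MvPolynomial (Fin N) ℂ) : scal p = 1 ⊗ₜ[ℂ] p := rfl

theorem var_eq (i : Fin N) : var i = scal (MvPolynomial.X i) := rfl

theorem scal_comm (p : MvPolynomial (Fin N) ℂ) (P : Pol N) : scal p * P = P * scal p := by
  induction P using TensorProduct.induction_on with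
  | zero => simp
  | tmul u f => simp [scal_apply, mul_comm]
  | add x y hx hy => rw [mul_add, add_mul, hx, hy]

theorem pd_tmul (i : Fin N) (u : Cl N) (p : MvPolynomial (Fin N) ℂ) :
    pd i (u ⊗ₜ[ℂ] p) = u ⊗ₜ[ℂ] MvPolynomial.pderiv i p := rfl

theorem pd_const_mul (i : Fin N) (u : Cl N) (P : Pol N) :
    pd i (const u * P) = const u * pd i P := by
  induction P using TensorProduct.induction_on with
  | zero => simp
  | tmul v f => simp [const, pd_tmul]
  | add x y hx hy => rw [mul_add, map_add, map_add, mul_add, hx, hy]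

theorem pd_scal_mul (i : Fin N) (p : MvPolynomial (Fin N) ℂ) (P : Pol N) :
    pd i (scal p * P) = scal (MvPolynomial.pderiv i p) * P + scal p * pd i P := by
  induction P using TensorProduct.induction_on with
  | zero => simp
  | tmul v f =>
    simp only [scal_apply, Algebra.TensorProduct.tmul_mul_tmul, one_mul, pd_tmul,
      MvPolynomial.pderiv_mul, TensorProduct.tmul_add]
  | add x y hx hy => simp only [mul_add, map_add, hx, hy]; abel

theorem pd_var_mul (i j : Fin N) (P : Pol N) :
    pd i (var j * P) = var j * pd i P + if i = j then P else 0 := by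
  rw [var_eq, pd_scal_mul, MvPolynomial.pderiv_X, add_comm]
  by_cases h : i = j
  · subst h; simp
  · simp [h, Ne.symm h]

theorem pd_comm (i j : Fin N) (P : Pol N) : pd i (pd j P) = pd j (pd i P) := by
  induction P using TensorProduct.induction_on with
  | zero => simp
  | tmul v f =>
    have : MvPolynomial.pderiv i (MvPolynomial.pderiv j f)
        = MvPolynomial.pderiv j (MvPolynomial.pderiv i f) := by
      have h : ⁅(MvPolynomial.pderiv i : Derivation ℂ (MvPolynomial (Fin N) ℂ) _),
          (MvPolynomial.pderiv j : Derivation ℂ (MvPolynomial (Fin N) ℂ) _)⁆ = 0 := by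
        refine MvPolynomial.derivation_ext (R := ℂ) fun l => ?_
        rw [Derivation.commutator_apply]
        simp only [MvPolynomial.pderiv_X, Derivation.coe_zero, Pi.zero_apply]
        by_cases h1 : l = j <;> by_cases h2 : l = i <;> simp [h1, h2, Pi.single_apply] <;>
          split_ifs <;> simp
      have h2 := congrArg (fun D : Derivation ℂ (MvPolynomial (Fin N) ℂ) (MvPolynomial (Fin N) ℂ) =>
        D f) h
      simp only [Derivation.commutator_apply, Derivation.coe_zero, Pi.zero_apply] at h2
      exact sub_eq_zero.1 h2
    rw [pd_tmul, pd_tmul, pd_tmul, pd_tmul, this]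
  | add x y hx hy => simp only [map_add, hx, hy]

/-! ### The generators of the even subalgebra relative to a last direction `z` -/

/-- Left multiplication by `e_a e_z`. -/
def gam (z a : Fin N) : Module.End ℂ (Pol N) := LinearMap.mulLeft ℂ (const (e a * e z))

/-- Multiplication by a coordinate. -/
def mv (a : Fin N) : Module.End ℂ (Pol N) := LinearMap.mulLeft ℂ (var a)

theorem gam_apply (z a : Fin N) (P : Pol N) : gam z a P = const (e a * e z) * P := rfl

theorem mv_apply (a : Fin N) (P : Pol N) : mv a P = var a * P := rfl

theorem ee_mul_ee {z a b : Fin N} (hb : b ≠ z) :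
    (e a * e z * (e b * e z) : Cl N) = e a * e b := by
  rw [mul_assoc, ← mul_assoc (e z), e_anti hb.symm, neg_mul, mul_assoc, e_mul_self]
  simp

theorem gam_mul_gam {z a b : Fin N} (hb : b ≠ z) :
    gam z a * gam z b = LinearMap.mulLeft ℂ (const (e a * e b)) := by
  refine LinearMap.ext fun P => ?_
  rw [Module.End.mul_apply, gam_apply, gam_apply, ← mul_assoc, ← const_mul, ee_mul_ee hb]
  rfl

/-- The reason for using e_a e_z: for a < z these even elements satisfy the relations of the
generators and also preserve a spinor space, which a single e_a need not do. Moreover (e_a e_z)(e_b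
e_z) = e_a e_b, so rotations keep their form. -/
theorem cliffordWeyl (z : Fin N) : CliffordWeyl (Finset.Iio z) (gam z) mv pd where
  sq a ha := by
    rw [gam_mul_gam (Finset.mem_Iio.1 ha).ne, e_mul_self]
    refine LinearMap.ext fun P => ?_
    rw [LinearMap.mulLeft_apply, const_neg_mul, const_one, one_mul]
    rfl
  anti a ha b hb hab := by
    rw [gam_mul_gam (Finset.mem_Iio.1 ha).ne, gam_mul_gam (Finset.mem_Iio.1 hb).ne, e_anti hab]
    refine LinearMap.ext fun P => ?_
    rw [LinearMap.mulLeft_apply, const_neg_mul]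
    rfl
  mm a b := by
    refine LinearMap.ext fun P => ?_
    simp only [Module.End.mul_apply, mv_apply]
    rw [← mul_assoc, ← mul_assoc, var_eq, scal_comm]
  dd a b := LinearMap.ext fun P => pd_comm a b P
  dm a b := by
    refine LinearMap.ext fun P => ?_
    simp only [Module.End.mul_apply, mv_apply, pd_var_mul, LinearMap.add_apply]
    split_ifs <;> rfl
  gm a _ b := by
    refine LinearMap.ext fun P => ?_
    simp only [Module.End.mul_apply, mv_apply, gam_apply]
    rw [← mul_assoc, ← mul_assoc, var_eq, scal_comm]
  gd a _ b := by
    refine LinearMap.ext fun P => ?_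
    simp only [Module.End.mul_apply, gam_apply, pd_const_mul]

theorem rot_eq_rotOp {z a b : Fin N} (hb : b ≠ z) : rot a b = rotOp (gam z) mv pd a b := by
  rw [rotOp, gam_mul_gam hb]
  rfl

theorem rot_eq_boost (z a : Fin N) :
    rot a z = (1 / 2 : ℂ) • gam z a + mv z * pd a - mv a * pd z := rfl

/-! ### Homogeneous polynomials -/

theorem tmul_mem_homPoly {d k : ℕ} {S : Submodule ℂ (Cl N)} {s : Cl N} (hs : s ∈ S)
    {p : MvPolynomial (Fin N) ℂ} (hp : p.IsHomogeneous k)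
    (hpd : p ∈ MvPolynomial.supported ℂ {i : Fin N | i.val < d}) :
    s ⊗ₜ[ℂ] p ∈ homPoly d k S :=
  Submodule.subset_span ⟨s, hs, p, hp, hpd, rfl⟩

theorem map_mem_of_homPoly {d k : ℕ} {S : Submodule ℂ (Cl N)} {M : Type*} [AddCommGroup M]
    [Module ℂ M] {W : Submodule ℂ M} (f : Pol N →ₗ[ℂ] M)
    (hf : ∀ s ∈ S, ∀ p : MvPolynomial (Fin N) ℂ, p.IsHomogeneous k →
      p ∈ MvPolynomial.supported ℂ {i : Fin N | i.val < d} → f (s ⊗ₜ[ℂ] p) ∈ W)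
    {P : Pol N} (hP : P ∈ homPoly d k S) : f P ∈ W := by
  have : homPoly d k S ≤ W.comap f := by
    refine Submodule.span_le.2 ?_
    rintro _ ⟨s, hs, p, hp, hpd, rfl⟩
    exact hf s hs p hp hpd
  exact this hP

theorem homPoly_mono {d k : ℕ} {S T : Submodule ℂ (Cl N)} (h : S ≤ T) :
    homPoly d k S ≤ homPoly d k T := fun _ hP =>
  map_mem_of_homPoly LinearMap.id (fun _ hs _ hp hpd => tmul_mem_homPoly (h hs) hp hpd) hP

theorem homPoly_mono_dim {d d' k : ℕ} (hd : d ≤ d') (S : Submodule ℂ (Cl N)) :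
    homPoly d k S ≤ homPoly d' k S := fun _ hP =>
  map_mem_of_homPoly LinearMap.id (fun _ hs _ hp hpd => tmul_mem_homPoly hs hp
    (MvPolynomial.supported_mono (fun _ hi => lt_of_lt_of_le hi hd) hpd)) hP

theorem const_mul_mem_homPoly {d k : ℕ} {S T : Submodule ℂ (Cl N)} {u : Cl N}
    (hu : ∀ s ∈ S, u * s ∈ T) {P : Pol N} (hP : P ∈ homPoly d k S) :
    const u * P ∈ homPoly d k T := by
  refine map_mem_of_homPoly (LinearMap.mulLeft ℂ (const u)) (fun s hs p hp hpd => ?_) hP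
  simpa [const] using tmul_mem_homPoly (hu s hs) hp hpd

theorem scal_mul_mem_homPoly {d k l : ℕ} {S : Submodule ℂ (Cl N)} {f : MvPolynomial (Fin N) ℂ}
    (hf : f.IsHomogeneous l) (hfd : f ∈ MvPolynomial.supported ℂ {i : Fin N | i.val < d})
    {P : Pol N} (hP : P ∈ homPoly d k S) : scal f * P ∈ homPoly d (k + l) S := by
  refine map_mem_of_homPoly (LinearMap.mulLeft ℂ (scal f)) (fun s hs p hp hpd => ?_) hP
  have := tmul_mem_homPoly hs (add_comm k l ▸ hf.mul hp) (mul_mem hfd hpd)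
  simpa [scal_apply] using this

theorem var_mul_mem_homPoly {d k : ℕ} {S : Submodule ℂ (Cl N)} {a : Fin N} (ha : a.val < d)
    {P : Pol N} (hP : P ∈ homPoly d k S) : var a * P ∈ homPoly d (k + 1) S :=
  scal_mul_mem_homPoly (MvPolynomial.isHomogeneous_X ℂ a) (MvPolynomial.X_mem_supported.2 ha) hP

theorem pderiv_mem_supported {s : Set (Fin N)} {p : MvPolynomial (Fin N) ℂ}
    (hp : p ∈ MvPolynomial.supported ℂ s) (i : Fin N) :
    MvPolynomial.pderiv i p ∈ MvPolynomial.supported ℂ s := by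
  induction hp using Algebra.adjoin_induction with
  | mem x hx =>
    obtain ⟨j, -, rfl⟩ := hx
    rw [MvPolynomial.pderiv_X, Pi.single_apply]
    split_ifs
    · exact one_mem _
    · exact zero_mem _
  | algebraMap r => rw [Derivation.map_algebraMap]; exact zero_mem _
  | add x y _ _ hx hy => rw [map_add]; exact add_mem hx hy
  | mul x y hx' hy' hx hy =>
    rw [MvPolynomial.pderiv_mul]
    exact add_mem (mul_mem hx hy') (mul_mem hx' hy)

theorem pderiv_eq_zero_of_supported {s : Set (Fin N)} {p : MvPolynomial (Fin N) ℂ}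
    (hp : p ∈ MvPolynomial.supported ℂ s) {i : Fin N} (hi : i ∉ s) :
    MvPolynomial.pderiv i p = 0 :=
  MvPolynomial.pderiv_eq_zero_of_notMem_vars fun h => hi (MvPolynomial.mem_supported.1 hp h)

theorem pd_mem_homPoly {d k : ℕ} {S : Submodule ℂ (Cl N)} (a : Fin N) {P : Pol N}
    (hP : P ∈ homPoly d (k + 1) S) : pd a P ∈ homPoly d k S :=
  map_mem_of_homPoly (pd a) (fun _ hs _ hp hpd =>
    tmul_mem_homPoly hs (by simpa using hp.pderiv (i := a)) (pderiv_mem_supported hpd a)) hP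

theorem pd_homPoly_zero {d : ℕ} {S : Submodule ℂ (Cl N)} (a : Fin N) {P : Pol N}
    (hP : P ∈ homPoly d 0 S) : pd a P = 0 := by
  rw [← Submodule.mem_bot ℂ]
  refine map_mem_of_homPoly (pd a) (fun s _ p hp _ => ?_) hP
  have : p ∈ MvPolynomial.homogeneousSubmodule (Fin N) ℂ 0 := hp
  rw [MvPolynomial.homogeneousSubmodule_zero, Submodule.mem_one] at this
  obtain ⟨c, rfl⟩ := this
  rw [pd_tmul, Derivation.map_algebraMap, TensorProduct.tmul_zero]
  exact Submodule.zero_mem _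

theorem exists_const_of_homPoly_zero {d : ℕ} {S : Submodule ℂ (Cl N)} {P : Pol N}
    (hP : P ∈ homPoly d 0 S) : ∃ s ∈ S, P = const s := by
  have : homPoly d 0 S ≤ S.map ((TensorProduct.mk ℂ (Cl N) (MvPolynomial (Fin N) ℂ)).flip 1) := by
    refine Submodule.span_le.2 ?_
    rintro _ ⟨s, hs, p, hp, -, rfl⟩
    have : p ∈ MvPolynomial.homogeneousSubmodule (Fin N) ℂ 0 := hp
    rw [MvPolynomial.homogeneousSubmodule_zero, Submodule.mem_one] at this
    obtain ⟨c, rfl⟩ := this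
    refine ⟨c • s, S.smul_mem c hs, ?_⟩
    rw [LinearMap.flip_apply, TensorProduct.mk_apply, Algebra.algebraMap_eq_smul_one,
      TensorProduct.tmul_smul, TensorProduct.smul_tmul']
  obtain ⟨s, hs, rfl⟩ := this hP
  exact ⟨s, hs, rfl⟩

theorem const_mem_homPoly_zero {d : ℕ} {S : Submodule ℂ (Cl N)} {s : Cl N} (hs : s ∈ S) :
    const s ∈ homPoly d 0 S :=
  tmul_mem_homPoly hs (MvPolynomial.isHomogeneous_one _ _) (one_mem _)

theorem euler_homPoly {z : Fin N} {k : ℕ} {S : Submodule ℂ (Cl N)} {P : Pol N}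
    (hP : P ∈ homPoly z.val k S) : eulerOp (Finset.Iio z) mv pd P = (k : ℂ) • P := by
  rw [← sub_eq_zero, ← Submodule.mem_bot ℂ]
  refine map_mem_of_homPoly (eulerOp (Finset.Iio z) mv pd - (k : ℂ) • LinearMap.id)
    (fun s _ p hp hpd => ?_) hP
  rw [Submodule.mem_bot, LinearMap.sub_apply, sub_eq_zero, eulerOp, LinearMap.sum_apply]
  have h1 : ∀ a : Fin N, (mv a * pd a) (s ⊗ₜ[ℂ] p)
      = s ⊗ₜ[ℂ] (MvPolynomial.X a * MvPolynomial.pderiv a p) := by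
    intro a
    simp [mv_apply, pd_tmul, var]
  have h2 : ∑ a ∈ Finset.Iio z, MvPolynomial.X a * MvPolynomial.pderiv a p = k • p := by
    rw [← hp.sum_X_mul_pderiv]
    refine Finset.sum_subset (Finset.subset_univ _) fun a _ ha => ?_
    rw [pderiv_eq_zero_of_supported hpd (by simpa using ha), mul_zero]
  rw [Finset.sum_congr rfl fun a _ => h1 a, ← TensorProduct.tmul_sum, h2, TensorProduct.tmul_smul,
    LinearMap.smul_apply, LinearMap.id_apply, Nat.cast_smul_eq_nsmul]

theorem cliffordGraded {z : Fin N} {S : Submodule ℂ (Cl N)}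
    (hS : ∀ a < z, ∀ u ∈ S, e a * e z * u ∈ S) :
    CliffordGraded (Finset.Iio z) (gam z) mv pd (fun k => homPoly z.val k S) where
  g_mem a ha _ _ hp := const_mul_mem_homPoly (hS a (Finset.mem_Iio.1 ha)) hp
  m_mem _ ha _ _ hp := var_mul_mem_homPoly (Fin.lt_def.1 (Finset.mem_Iio.1 ha)) hp
  d_mem a _ _ _ hp := pd_mem_homPoly a hp
  d_zero a _ _ hp := pd_homPoly_zero a hp
  euler _ _ hp := euler_homPoly hp

/-! ### The Dirac operator in terms of the even generators -/

theorem dirac_apply (d : ℕ) (P : Pol N) :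
    dirac d P = ∑ i : Fin N with i.val < d, const (e i) * pd i P := by
  simp [dirac, LinearMap.sum_apply]

theorem const_e_mul_dirac (z : Fin N) (P : Pol N) :
    const (e z) * dirac z.val P = -diracOp (Finset.Iio z) (gam z) pd P := by
  rw [dirac_apply, diracOp, LinearMap.sum_apply, Finset.mul_sum, ← Finset.sum_neg_distrib]
  refine Finset.sum_congr (by ext; simp) fun i hi => ?_
  rw [← mul_assoc, ← const_mul, e_anti (Finset.mem_Iio.1 hi).ne', const_neg_mul]
  rfl

theorem const_e_mul_cancel (z : Fin N) (P : Pol N) : const (e z) * (const (e z) * P) = -P := by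
  rw [← mul_assoc, ← const_mul, e_mul_self, const_neg_mul, const_one, one_mul]

theorem dirac_eq_zero_iff (z : Fin N) (P : Pol N) :
    dirac z.val P = 0 ↔ diracOp (Finset.Iio z) (gam z) pd P = 0 := by
  constructor
  · intro h
    rw [← neg_eq_zero, ← const_e_mul_dirac, h, mul_zero]
  · intro h
    rw [← neg_eq_zero, ← const_e_mul_cancel z, const_e_mul_dirac, h, neg_zero, mul_zero]

theorem monogenics_eq_monPart (z : Fin N) (k : ℕ) (S : Submodule ℂ (Cl N)) :
    monogenics z.val k S
      = monPart (Finset.Iio z) (gam z) pd (fun k => homPoly z.val k S) k := by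
  ext P
  exact and_congr_right fun _ => dirac_eq_zero_iff z P

/-- Multiplying the Dirac equation by the invertible element e_z solves it for the x_z-derivative.
This Cauchy-Kovalevskaya form underlies uniqueness of extension and the boost formula. -/
theorem dirac_succ_eq_zero_iff (z : Fin N) (P : Pol N) :
    dirac (z.val + 1) P = 0 ↔ pd z P = -diracOp (Finset.Iio z) (gam z) pd P := by
  have h1 : dirac (z.val + 1) P = dirac z.val P + const (e z) * pd z P := by
    rw [dirac_apply, dirac_apply, add_comm (Finset.sum _ _),
      ← Finset.sum_insert (f := fun i => const (e i) * pd i P) (by simp)]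
    refine Finset.sum_congr ?_ fun _ _ => rfl
    ext i
    simp only [Finset.mem_filter, Finset.mem_univ, true_and, Finset.mem_insert, Fin.ext_iff]
    omega
  have h2 : const (e z) * dirac (z.val + 1) P
      = -diracOp (Finset.Iio z) (gam z) pd P - pd z P := by
    rw [h1, mul_add, const_e_mul_dirac, const_e_mul_cancel, sub_eq_add_neg]
  constructor
  · intro h
    rw [h, mul_zero, eq_comm, sub_eq_zero] at h2
    exact h2.symm
  · intro h
    rw [h, sub_self] at h2
    rw [← neg_eq_zero, ← const_e_mul_cancel z, h2, mul_zero]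

theorem pd_dirac (d : ℕ) (i : Fin N) (P : Pol N) : pd i (dirac d P) = dirac d (pd i P) := by
  rw [dirac_apply, dirac_apply, map_sum]
  exact Finset.sum_congr rfl fun j _ => by rw [pd_const_mul, pd_comm]

/-! ### Restriction to a coordinate hyperplane -/

/-- The substitution `x_z = 0` for scalar polynomials. -/
def restrScal (z : Fin N) : MvPolynomial (Fin N) ℂ →ₐ[ℂ] MvPolynomial (Fin N) ℂ :=
  MvPolynomial.aeval fun i => if i = z then 0 else MvPolynomial.X i

/-- The substitution `x_z = 0`. -/
def restr (z : Fin N) : Pol N →ₐ[ℂ] Pol N :=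
  Algebra.TensorProduct.map (AlgHom.id ℂ (Cl N)) (restrScal z)

theorem restr_tmul (z : Fin N) (u : Cl N) (p : MvPolynomial (Fin N) ℂ) :
    restr z (u ⊗ₜ[ℂ] p) = u ⊗ₜ[ℂ] restrScal z p := rfl

theorem restr_const (z : Fin N) (u : Cl N) : restr z (const u) = const u := by
  rw [const, restr_tmul, map_one]

theorem restr_scal (z : Fin N) (p : MvPolynomial (Fin N) ℂ) :
    restr z (scal p) = scal (restrScal z p) := rfl

theorem restr_var_self (z : Fin N) : restr z (var z) = 0 := by
  rw [var_eq, restr_scal, restrScal, MvPolynomial.aeval_X, if_pos rfl, map_zero]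

theorem restr_var {z i : Fin N} (hi : i ≠ z) : restr z (var i) = var i := by
  rw [var_eq, restr_scal, restrScal, MvPolynomial.aeval_X, if_neg hi]

/-- Formal integration with respect to `x_z`. -/
def integ (z : Fin N) : MvPolynomial (Fin N) ℂ →ₗ[ℂ] MvPolynomial (Fin N) ℂ :=
  (MvPolynomial.basisMonomials (Fin N) ℂ).constr ℂ fun α =>
    MvPolynomial.monomial (α + Finsupp.single z 1) ((α z + 1 : ℂ)⁻¹)

theorem integ_monomial (z : Fin N) (α : Fin N →₀ ℕ) (c : ℂ) :
    integ z (MvPolynomial.monomial α c)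
      = MvPolynomial.monomial (α + Finsupp.single z 1) (c * (α z + 1 : ℂ)⁻¹) := by
  have h1 : MvPolynomial.monomial α c = c • MvPolynomial.basisMonomials (Fin N) ℂ α := by
    rw [MvPolynomial.coe_basisMonomials, MvPolynomial.smul_monomial, smul_eq_mul, mul_one]
  rw [h1, map_smul, integ, Module.Basis.constr_basis, MvPolynomial.smul_monomial, smul_eq_mul]

/-- The fundamental theorem of calculus in the variable x_z, checked on monomials with and without
x_z. -/
theorem sub_restrScal (z : Fin N) (p : MvPolynomial (Fin N) ℂ) :
    p - restrScal z p = integ z (MvPolynomial.pderiv z p) := by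
  induction p using MvPolynomial.induction_on' with
  | monomial α c =>
    rw [MvPolynomial.pderiv_monomial, integ_monomial, restrScal, MvPolynomial.aeval_monomial]
    by_cases hα : α z = 0
    · have : (α.prod fun i k => (if i = z then 0 else MvPolynomial.X i : MvPolynomial (Fin N) ℂ) ^ k)
          = α.prod fun i k => MvPolynomial.X i ^ k := by
        refine Finsupp.prod_congr fun i hi => ?_
        have : i ≠ z := by
          rintro rfl
          exact (Finsupp.mem_support_iff.1 hi) hα
        rw [if_neg this]
      rw [this, hα, MvPolynomial.monomial_eq]
      simp [MvPolynomial.algebraMap_eq]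
    · have h0 : (α.prod fun i k =>
          (if i = z then 0 else MvPolynomial.X i : MvPolynomial (Fin N) ℂ) ^ k) = 0 :=
        Finset.prod_eq_zero (Finsupp.mem_support_iff.2 hα) (by simp [hα])
      have h1 : α - Finsupp.single z 1 + Finsupp.single z 1 = α :=
        tsub_add_cancel_of_le (Finsupp.single_le_iff.2 (Nat.one_le_iff_ne_zero.2 hα))
      have h2 : (((α - Finsupp.single z 1 : Fin N →₀ ℕ) z : ℕ) : ℂ) + 1 = α z := by
        rw [Finsupp.tsub_apply, Finsupp.single_eq_same]
        exact_mod_cast Nat.sub_add_cancel (Nat.one_le_iff_ne_zero.2 hα)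
      rw [h0, mul_zero, sub_zero, h1, h2, mul_assoc, mul_inv_cancel₀ (by exact_mod_cast hα),
        mul_one]
  | add p q hp hq => rw [map_add, map_add, map_add, ← hp, ← hq]; abel

theorem eq_zero_of_pd_of_restr {z : Fin N} {P : Pol N} (h1 : pd z P = 0) (h2 : restr z P = 0) :
    P = 0 := by
  have : ∀ P : Pol N, P - restr z P = LinearMap.lTensor (Cl N) (integ z) (pd z P) := by
    intro P
    induction P using TensorProduct.induction_on with
    | zero => simp
    | tmul v f =>
      rw [restr_tmul, ← TensorProduct.tmul_sub, sub_restrScal, pd_tmul, LinearMap.lTensor_tmul]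
    | add x y hx hy => rw [map_add, map_add, map_add, ← hx, ← hy]; abel
  have h3 := this P
  rwa [h1, h2, map_zero, sub_zero] at h3

theorem restr_pd {z i : Fin N} (hi : i ≠ z) (P : Pol N) : restr z (pd i P) = pd i (restr z P) := by
  have : ∀ f : MvPolynomial (Fin N) ℂ, restrScal z (MvPolynomial.pderiv i f)
      = MvPolynomial.pderiv i (restrScal z f) := by
    intro f
    induction f using MvPolynomial.induction_on with
    | C a => simp [restrScal]
    | add p q hp hq => simp only [map_add, hp, hq]
    | mul_X p j hp =>
      rw [map_mul (restrScal z), MvPolynomial.pderiv_mul, MvPolynomial.pderiv_mul, map_add,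
        map_mul (restrScal z), map_mul (restrScal z), hp, MvPolynomial.pderiv_X]
      congr 2
      rw [restrScal, MvPolynomial.aeval_X]
      by_cases hj : j = z
      · subst hj
        simp [hi.symm]
      · rw [if_neg hj, MvPolynomial.pderiv_X, Pi.single_apply]
        split_ifs <;> simp
  induction P using TensorProduct.induction_on with
  | zero => simp
  | tmul v f => rw [pd_tmul, restr_tmul, restr_tmul, pd_tmul, this]
  | add x y hx hy => simp only [map_add, hx, hy]

theorem restrScal_mem_supported {z : Fin N} {p : MvPolynomial (Fin N) ℂ}
    (hp : p ∈ MvPolynomial.supported ℂ {i : Fin N | i.val < z.val + 1}) :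
    restrScal z p ∈ MvPolynomial.supported ℂ {i : Fin N | i.val < z.val} := by
  induction hp using Algebra.adjoin_induction with
  | mem x hx =>
    obtain ⟨j, hj, rfl⟩ := hx
    rw [restrScal, MvPolynomial.aeval_X]
    split_ifs with h
    · exact zero_mem _
    · refine MvPolynomial.X_mem_supported.2 ?_
      have h1 : j.val < z.val + 1 := hj
      have h2 : j.val ≠ z.val := fun h' => h (Fin.ext h')
      change j.val < z.val
      omega
  | algebraMap r => rw [AlgHom.commutes]; exact algebraMap_mem _ r
  | add x y _ _ hx hy => rw [map_add]; exact add_mem hx hy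
  | mul x y _ _ hx hy => rw [map_mul]; exact mul_mem hx hy

theorem restr_mem_homPoly {z : Fin N} {k : ℕ} {S : Submodule ℂ (Cl N)} {P : Pol N}
    (hP : P ∈ homPoly (z.val + 1) k S) : restr z P ∈ homPoly z.val k S := by
  refine map_mem_of_homPoly (restr z).toLinearMap (fun s hs p hp hpd => ?_) hP
  refine tmul_mem_homPoly hs ?_ ?_
  · have := hp.aeval (fun i => if i = z then (0 : MvPolynomial (Fin N) ℂ) else MvPolynomial.X i)
      (n := 1) fun i => by
        split_ifs
        · exact MvPolynomial.isHomogeneous_zero _ _ _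
        · exact MvPolynomial.isHomogeneous_X _ _
    rwa [one_mul] at this
  · exact restrScal_mem_supported hpd

theorem restr_diracOp (z : Fin N) (P : Pol N) :
    restr z (diracOp (Finset.Iio z) (gam z) pd P)
      = diracOp (Finset.Iio z) (gam z) pd (restr z P) := by
  simp only [diracOp, LinearMap.sum_apply, map_sum, Module.End.mul_apply, gam_apply, map_mul,
    restr_const]
  exact Finset.sum_congr rfl fun i hi => by rw [restr_pd (Finset.mem_Iio.1 hi).ne]

theorem restr_rot {z a b : Fin N} (ha : a ≠ z) (hb : b ≠ z) (P : Pol N) :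
    restr z (rot a b P) = rot a b (restr z P) := by
  simp only [rot, LinearMap.sub_apply, LinearMap.add_apply, LinearMap.smul_apply,
    LinearMap.mulLeft_apply, LinearMap.comp_apply, map_sub, map_add, map_smul, map_mul,
    restr_const, restr_var ha, restr_var hb, restr_pd ha, restr_pd hb]

/-- A monogenic polynomial is determined by its restriction to a coordinate hyperplane. -/
theorem eq_zero_of_restr_eq_zero {z : Fin N} {k : ℕ} {S : Submodule ℂ (Cl N)} {P : Pol N}
    (hP : P ∈ monogenics (z.val + 1) k S) (h0 : restr z P = 0) : P = 0 := by
  induction k generalizing P with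
  | zero => exact eq_zero_of_pd_of_restr (pd_homPoly_zero z hP.1) h0
  | succ k ih =>
    have hD : dirac (z.val + 1) P = 0 := hP.2
    -- The derivative ∂P/∂x_z is monogenic of lower degree and restricts to -D(restr P) = 0, so it
    -- vanishes by induction and P does not depend on x_z.
    refine eq_zero_of_pd_of_restr (ih ⟨pd_mem_homPoly z hP.1, ?_⟩ ?_) h0
    · change dirac (z.val + 1) _ = 0
      rw [← pd_dirac, hD, map_zero]
    · rw [(dirac_succ_eq_zero_iff z P).1 hD, map_neg, restr_diracOp, h0, map_zero, neg_zero]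

/-- On the hyperplane the term with the factor x_z disappears, and the monogenic equation turns -x_a
∂/∂x_z into x_a D. -/
theorem restr_boost {z a : Fin N} (ha : a < z) {P : Pol N} (hP : dirac (z.val + 1) P = 0) :
    restr z (rot a z P)
      = ((1 / 2 : ℂ) • gam z a + mv a * diracOp (Finset.Iio z) (gam z) pd) (restr z P) := by
  rw [rot_eq_boost]
  simp only [LinearMap.sub_apply, LinearMap.add_apply, LinearMap.smul_apply, Module.End.mul_apply,
    mv_apply, gam_apply, map_sub, map_add, map_smul, map_mul, restr_const, restr_var_self,
    restr_var ha.ne, (dirac_succ_eq_zero_iff z P).1 hP, map_neg, restr_diracOp]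
  simp

/-! ### Stable subspaces of spherical monogenics -/

theorem rotStable_of_soStable {z : Fin N} {d : ℕ} (hd : z.val ≤ d) {W : Submodule ℂ (Pol N)}
    (hW : SoStable d W) : RotStable (Finset.Iio z) (gam z) mv pd W := by
  intro a ha b hb p hp
  have ha' := Finset.mem_Iio.1 ha
  have hb' := Finset.mem_Iio.1 hb
  rcases lt_trichotomy a b with h | rfl | h
  · rw [← rot_eq_rotOp hb'.ne]
    exact hW a b h (lt_of_lt_of_le hb' hd) p hp
  · rw [(cliffordWeyl z).rot_self ha, LinearMap.smul_apply]
    exact W.smul_mem _ hp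
  · rw [(cliffordWeyl z).rot_swap hb ha h.ne, ← rot_eq_rotOp ha'.ne]
    exact W.neg_mem (hW b a h (lt_of_lt_of_le ha' hd) p hp)

/-- A nonzero `so(z+1)`-stable space `T` of `S`-valued monogenics in an even dimension `z + 1`
contains all monogenics with values in some nonzero subspace of `S`. -/
theorem exists_values_of_soStable {z : Fin N} (hz : Odd z.val) {S : Submodule ℂ (Cl N)}
    (hS : ∀ a < z, ∀ u ∈ S, e a * e z * u ∈ S) {l : ℕ} {T : Submodule ℂ (Pol N)}
    (hT : T ≤ monogenics (z.val + 1) l S) (hst : SoStable (z.val + 1) T) (hT0 : T ≠ ⊥) :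
    ∃ S' ≤ S, S' ≠ ⊥ ∧ (∀ a < z, ∀ u ∈ S', e a * e z * u ∈ S') ∧
      monogenics (z.val + 1) l S' ≤ T ∧
      ∀ s ∈ S', ∃ F ∈ T, restr z F = (vecOp (Finset.Iio z) (gam z) mv ^ l) (const s) := by
  have hI : Odd (Finset.Iio z).card := by rwa [Fin.card_Iio]
  have hH := cliffordGraded hS
  have hW := cliffordWeyl z
  -- Restriction is injective on monogenics, so T may be studied through W, a space of polynomials
  -- in odd dimension stable under rotations and boosts.
  set W := T.map (restr z).toLinearMap with hWdef
  have hWH : W ≤ homPoly z.val l S := by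
    rintro _ ⟨F, hF, rfl⟩
    exact restr_mem_homPoly (hT hF).1
  have hW0 : W ≠ ⊥ := by
    obtain ⟨F, hF, hF0⟩ := T.ne_bot_iff.1 hT0
    refine W.ne_bot_iff.2 ⟨restr z F, ⟨F, hF, rfl⟩, fun h0 => hF0 ?_⟩
    exact eq_zero_of_restr_eq_zero (hT hF) h0
  have hrot : RotStable (Finset.Iio z) (gam z) mv pd W := by
    rintro a ha b hb _ ⟨F, hF, rfl⟩
    refine ⟨rotOp (gam z) mv pd a b F, rotStable_of_soStable (Nat.le_succ _) hst a ha b hb F hF, ?_⟩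
    rw [← rot_eq_rotOp (Finset.mem_Iio.1 hb).ne]
    exact restr_rot (Finset.mem_Iio.1 ha).ne (Finset.mem_Iio.1 hb).ne F
  have hboost : ∀ a ∈ Finset.Iio z, ∀ p ∈ W,
      ((1 / 2 : ℂ) • gam z a + mv a * diracOp (Finset.Iio z) (gam z) pd) p ∈ W := by
    rintro a ha _ ⟨F, hF, rfl⟩
    have ha' := Finset.mem_Iio.1 ha
    exact ⟨rot a z F, hst a z ha' (Nat.lt_succ_self _) F hF, restr_boost ha' (hT hF).2⟩
  -- S' collects the s in S with x^l s in W.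
  set S' : Submodule ℂ (Cl N) := S ⊓ W.comap ((vecOp (Finset.Iio z) (gam z) mv ^ l) ∘ₗ
    (TensorProduct.mk ℂ (Cl N) (MvPolynomial (Fin N) ℂ)).flip 1) with hS'
  have hmem : ∀ s, s ∈ S' ↔ s ∈ S ∧ (vecOp (Finset.Iio z) (gam z) mv ^ l) (const s) ∈ W :=
    fun s => Iff.rfl
  have hS'g : ∀ a < z, ∀ u ∈ S', e a * e z * u ∈ S' := by
    intro a ha u hu
    refine ⟨hS a ha u hu.1, ?_⟩
    have := hH.g_constant_mem hW hI hrot hboost (Finset.mem_Iio.2 ha)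
      (const_mem_homPoly_zero (d := z.val) hu.1) ((hmem u).1 hu).2
    rw [gam_apply, ← const_mul] at this
    exact this
  refine ⟨S', inf_le_left, ?_, hS'g, ?_, ?_⟩
  · obtain ⟨c, hc, hc0, hcW⟩ := hH.exists_constant hW hI hrot hboost hWH hW0
    obtain ⟨s, hs, rfl⟩ := exists_const_of_homPoly_zero hc
    refine S'.ne_bot_iff.2 ⟨s, (hmem s).2 ⟨hs, hcW⟩, ?_⟩
    rintro rfl
    exact hc0 (TensorProduct.zero_tmul _ _)
  · intro F hF
    have hFW : restr z F ∈ W := by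
      refine hH.le_of_constants hW hI hrot hboost (cliffordGraded hS'g)
        (fun k => homPoly_mono inf_le_left) ?_ (restr_mem_homPoly hF.1)
      intro c hc
      obtain ⟨s, hs, rfl⟩ := exists_const_of_homPoly_zero hc
      exact ((hmem s).1 hs).2
    obtain ⟨F', hF', hFF'⟩ := hFW
    have : F - F' = 0 := by
      refine eq_zero_of_restr_eq_zero (z := z) (k := l) (S := S)
        (Submodule.sub_mem _ ⟨homPoly_mono inf_le_left hF.1, hF.2⟩ (hT hF')) ?_
      rw [map_sub, sub_eq_zero]
      exact hFF'.symm
    rw [sub_eq_zero.1 this]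
    exact hF'
  · intro s hs
    exact ((hmem s).1 hs).2

/-! ### Basic spinor spaces -/

theorem vec_single {N : ℕ} (a : Fin N) : vec (EuclideanSpace.single a (1 : ℝ)) = e a := by
  rw [vec, Finset.sum_eq_single a]
  · simp
  · intro b _ hb
    simp [hb]
  · simp

theorem SpinStable.ee_mem {N : ℕ} {S : Submodule ℂ (Cl N)} (hS : SpinStable S) (a b : Fin N)
    {u : Cl N} (hu : u ∈ S) : e a * e b * u ∈ S := by
  refine hS _ ⟨[EuclideanSpace.single a 1, EuclideanSpace.single b 1], by simp, by simp, ?_⟩ u hu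
  simp [vec_single]

/-- Grouping the factors of an even product in pairs reduces to a product of two vectors, which is a
linear combination of the e_a e_b. -/
theorem spinStable_of_ee_mem {N : ℕ} {S : Submodule ℂ (Cl N)}
    (hS : ∀ a b : Fin N, ∀ u ∈ S, e a * e b * u ∈ S) : SpinStable S := by
  have hv : ∀ x y : EuclideanSpace ℝ (Fin N), ∀ u ∈ S, vec x * vec y * u ∈ S := by
    intro x y u hu
    rw [vec, vec, Finset.sum_mul_sum, Finset.sum_mul]
    refine S.sum_mem fun a _ => ?_
    rw [Finset.sum_mul]
    refine S.sum_mem fun b _ => ?_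
    rw [smul_mul_smul_comm, smul_mul_assoc]
    exact S.smul_mem _ (hS a b u hu)
  have hl : ∀ k : ℕ, ∀ l : List (EuclideanSpace ℝ (Fin N)), l.length = 2 * k →
      ∀ u ∈ S, (l.map vec).prod * u ∈ S := by
    intro k
    induction k with
    | zero =>
      intro l hl u hu
      obtain rfl := List.length_eq_zero_iff.1 hl
      simpa using hu
    | succ k ih =>
      intro l hl u hu
      match l, hl with
      | x :: y :: l, hl =>
        simp only [List.length_cons] at hl
        rw [List.map_cons, List.map_cons, List.prod_cons, List.prod_cons, ← mul_assoc, mul_assoc]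
        exact hv x y _ (ih l (by omega) u hu)
  rintro _ ⟨l, ⟨k, hk⟩, -, rfl⟩ u hu
  exact hl k l (by omega) u hu

/-- The generator `e_{i+1}` for a natural number index, and `1` if the index is out of range. -/
def eNat (N i : ℕ) : Cl N := if h : i < N then e ⟨i, h⟩ else 1

theorem eNat_of_lt {N i : ℕ} (h : i < N) : eNat N i = e ⟨i, h⟩ := dif_pos h

/-- The product `e₁ e₂ ⋯ e_p`. -/
def eProd (N p : ℕ) : Cl N := ((List.range p).map (eNat N)).prod

theorem eProd_succ (N p : ℕ) : eProd N (p + 1) = eProd N p * eNat N p := by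
  simp [eProd, List.range_succ]

theorem eProd_mul_e_of_le {N p : ℕ} {a : Fin N} (h : p ≤ a.val) :
    eProd N p * e a = (-1 : ℂ) ^ p • (e a * eProd N p) := by
  induction p with
  | zero => simp [eProd]
  | succ p ih =>
    have hp : p < N := by omega
    have hne : (⟨p, hp⟩ : Fin N) ≠ a := by
      rintro rfl
      simp at h
    rw [eProd_succ, eNat_of_lt hp, mul_assoc, e_anti hne, mul_neg, ← mul_assoc, ih (by omega),
      smul_mul_assoc, mul_assoc, pow_succ, mul_neg_one, neg_smul]

/-- One of the p factors is e_a itself and commutes with e_a; the other p - 1 each contribute a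
sign. -/
theorem eProd_mul_e_of_lt {N p : ℕ} (hpN : p ≤ N) {a : Fin N} (h : a.val < p) :
    eProd N p * e a = -((-1 : ℂ) ^ p • (e a * eProd N p)) := by
  induction p with
  | zero => omega
  | succ p ih =>
    have hp : p < N := by omega
    rw [eProd_succ, eNat_of_lt hp]
    by_cases hap : a.val = p
    · obtain rfl : a = ⟨p, hp⟩ := Fin.ext hap
      rw [← mul_assoc (e _), mul_assoc (eProd N p), e_mul_self]
      have h1 := eProd_mul_e_of_le (N := N) (a := ⟨p, hp⟩) (p := p) le_rfl
      have h2 : e ⟨p, hp⟩ * eProd N p = (-1 : ℂ) ^ p • (eProd N p * e ⟨p, hp⟩) := by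
        rw [h1, smul_smul, ← mul_pow]; simp
      rw [h2, smul_mul_assoc, smul_smul, mul_assoc, e_mul_self, pow_succ, mul_right_comm,
        ← mul_pow]
      simp
    · have hne : (⟨p, hp⟩ : Fin N) ≠ a := by
        rintro rfl
        exact hap rfl
      rw [mul_assoc, e_anti hne, mul_neg, ← mul_assoc, ih (by omega) (by omega), neg_mul,
        smul_mul_assoc, mul_assoc, pow_succ, mul_neg_one, neg_smul]

/-- Each consecutive pair uv commutes with the preceding even product and satisfies (uv)² = -1. The
resulting sign is what (-i)^n in θ compensates. -/
theorem eProd_sq {N i : ℕ} (h : 2 * i ≤ N) :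
    eProd N (2 * i) * eProd N (2 * i) = (-1 : ℂ) ^ i • 1 := by
  induction i with
  | zero => simp [eProd]
  | succ i ih =>
    have h1 : 2 * i < N := by omega
    have h2 : 2 * i + 1 < N := by omega
    set u : Cl N := e ⟨2 * i, h1⟩
    set v : Cl N := e ⟨2 * i + 1, h2⟩
    set w := eProd N (2 * i)
    have hwu : w * u = u * w := by
      have := eProd_mul_e_of_le (N := N) (a := ⟨2 * i, h1⟩) (p := 2 * i) le_rfl
      rwa [pow_mul, neg_one_sq, one_pow, one_smul] at this
    have hwv : w * v = v * w := by
      have := eProd_mul_e_of_le (N := N) (a := ⟨2 * i + 1, h2⟩) (p := 2 * i) (by simp)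
      rwa [pow_mul, neg_one_sq, one_pow, one_smul] at this
    have huv : u * v = -(v * u) := e_anti (by simp)
    have hu : u * u = -1 := e_mul_self _
    have hv : v * v = -1 := e_mul_self _
    have hw := ih (by omega)
    have e1 : eProd N (2 * (i + 1)) = w * u * v := by
      rw [show 2 * (i + 1) = 2 * i + 1 + 1 by ring, eProd_succ, eProd_succ, eNat_of_lt h1,
        eNat_of_lt h2]
    rw [e1]
    calc w * u * v * (w * u * v) = w * u * (v * w) * u * v := by noncomm_ring
      _ = w * (u * w) * (v * u) * v := by rw [← hwv]; noncomm_ring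
      _ = w * w * (u * (v * u) * v) := by rw [← hwu]; noncomm_ring
      _ = -(w * w) * ((u * u) * (v * v)) := by
        rw [show v * u = -(u * v) by rw [huv, neg_neg]]; noncomm_ring
      _ = _ := by rw [hu, hv, hw, pow_succ]; simp

theorem eProd_mul_mem {N i : ℕ} (h : 2 * i ≤ N) {T : Submodule ℂ (Cl N)}
    (hT : ∀ a b : Fin N, a.val < 2 * i → b.val < 2 * i → ∀ u ∈ T, e a * e b * u ∈ T) {u : Cl N}
    (hu : u ∈ T) : eProd N (2 * i) * u ∈ T := by
  induction i generalizing u with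
  | zero => simpa [eProd] using hu
  | succ i ih =>
    have h1 : 2 * i < N := by omega
    have h2 : 2 * i + 1 < N := by omega
    rw [show 2 * (i + 1) = 2 * i + 1 + 1 by ring, eProd_succ, eProd_succ, eNat_of_lt h1,
      eNat_of_lt h2, mul_assoc, mul_assoc, ← mul_assoc (e _)]
    refine ih (by omega) (fun a b ha hb => hT a b (by omega) (by omega)) ?_
    exact hT _ _ (by simp) (by simp only; omega) u hu

theorem theta_eq (n : ℕ) : theta n = (-Complex.I) ^ n • eProd (2 * n + 1) (2 * n) := by
  rw [theta, eProd]
  congr 2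
  refine List.ext_getElem (by simp) fun i h1 h2 => ?_
  simp only [List.getElem_ofFn, List.getElem_map, List.getElem_range]
  simp only [List.length_ofFn] at h1
  rw [eNat_of_lt (by omega)]
  rfl

theorem theta_sq (n : ℕ) : theta n * theta n = 1 := by
  rw [theta_eq, smul_mul_smul_comm, eProd_sq (by omega), smul_smul, ← mul_pow, ← mul_pow]
  simp

theorem theta_mul_e {n : ℕ} {a : Fin (2 * n + 1)} (ha : a.val < 2 * n) :
    theta n * e a = -(e a * theta n) := by
  rw [theta_eq, smul_mul_assoc, eProd_mul_e_of_lt (by omega) ha, pow_mul, neg_one_sq, one_pow,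
    one_smul, smul_neg, mul_smul_comm]

theorem theta_mul_e_last (n : ℕ) :
    theta n * e (Fin.last (2 * n)) = e (Fin.last (2 * n)) * theta n := by
  rw [theta_eq, smul_mul_assoc, eProd_mul_e_of_le (by simp), pow_mul, neg_one_sq, one_pow,
    one_smul, mul_smul_comm]

theorem theta_mul_ee {n : ℕ} {a b : Fin (2 * n + 1)} (ha : a.val < 2 * n) (hb : b.val < 2 * n) :
    theta n * (e a * e b) = e a * e b * theta n := by
  rw [← mul_assoc, theta_mul_e ha, neg_mul, mul_assoc, theta_mul_e hb, mul_neg, neg_neg,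
    mul_assoc]

theorem theta_mul_mem {n : ℕ} {T : Submodule ℂ (Cl (2 * n + 1))}
    (hT : ∀ a b : Fin (2 * n + 1), a.val < 2 * n → b.val < 2 * n → ∀ u ∈ T, e a * e b * u ∈ T)
    {u : Cl (2 * n + 1)} (hu : u ∈ T) : theta n * u ∈ T := by
  rw [theta_eq, smul_mul_assoc]
  exact T.smul_mem _ (eProd_mul_mem (by omega) hT hu)

/-! ### Half-spin spaces and so(2n)-submodules of monogenics -/

section Spinor

variable {n : ℕ} {S : Submodule ℂ (Cl (2 * n + 1))}

theorem mem_thetaPart {ε : ℂ} {u : Cl (2 * n + 1)} :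
    u ∈ thetaPart S ε ↔ u ∈ S ∧ theta n * u = ε • u := by
  rw [thetaPart, Submodule.mem_inf, LinearMap.mem_ker, LinearMap.sub_apply, sub_eq_zero]
  rfl

theorem thetaPart_le (ε : ℂ) : thetaPart S ε ≤ S := inf_le_left

theorem ee_mul_mem_thetaPart (hS : SpinStable S) {ε : ℂ} {a b : Fin (2 * n + 1)}
    (ha : a.val < 2 * n) (hb : b.val < 2 * n) {u : Cl (2 * n + 1)} (hu : u ∈ thetaPart S ε) :
    e a * e b * u ∈ thetaPart S ε := by
  rw [mem_thetaPart] at hu ⊢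
  refine ⟨hS.ee_mem a b hu.1, ?_⟩
  rw [← mul_assoc, theta_mul_ee ha hb, mul_assoc, hu.2, mul_smul_comm]

/-- The half-spin spaces `S^±` are irreducible under the even subalgebra of dimension `2n`. -/
theorem IsBasicSpinor.thetaPart_le_of_stable (hn : 1 ≤ n) (hS : IsBasicSpinor S) {ε : ℂ}
    (hε : ε ≠ 0) {R : Submodule ℂ (Cl (2 * n + 1))} (hR : R ≤ thetaPart S ε) (hR0 : R ≠ ⊥)
    (hst : ∀ a b : Fin (2 * n + 1), a.val < 2 * n → b.val < 2 * n → ∀ u ∈ R, e a * e b * u ∈ R) :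
    thetaPart S ε ≤ R := by
  set o : Fin (2 * n + 1) := 0
  set z : Fin (2 * n + 1) := Fin.last (2 * n)
  have ho : o.val < 2 * n := by change 0 < _; omega
  have hlt : ∀ a : Fin (2 * n + 1), a ≠ z → a.val < 2 * n := fun a ha =>
    Fin.val_lt_last ha
  have hoz : o ≠ z := by
    intro h
    rw [h] at ho
    exact lt_irrefl _ ho
  set c : Cl (2 * n + 1) := e o * e z with hc
  -- With c = e_1 e_{2n+1}, the space T = R + cR is Spin(2n+1)-stable, hence equals S. Since c
  -- anticommutes with θ, cR lies in the eigenspace of -ε, so only R contributes to S^ε.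
  set T := R ⊔ R.map (LinearMap.mulLeft ℂ c) with hT
  have hRT : R ≤ T := le_sup_left
  have hcT : ∀ x ∈ R, c * x ∈ T := fun x hx => (le_sup_right : _ ≤ T) ⟨x, hx, rfl⟩
  have hTi : ∀ f : Cl (2 * n + 1) →ₗ[ℂ] Cl (2 * n + 1), (∀ x ∈ R, f x ∈ T) →
      (∀ x ∈ R, f (c * x) ∈ T) → ∀ u ∈ T, f u ∈ T := by
    intro f h1 h2 u hu
    have : T ≤ T.comap f := by
      refine sup_le h1 ?_
      rintro _ ⟨x, hx, rfl⟩
      exact h2 x hx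
    exact this hu
  have ooz : e o * e o = (-1 : Cl (2 * n + 1)) := e_mul_self _
  have zz : e z * e z = (-1 : Cl (2 * n + 1)) := e_mul_self _
  have oz : (e o * e z : Cl (2 * n + 1)) = -(e z * e o) := e_anti hoz
  have h1 : ∀ a b, a ≠ z → b ≠ z → ∀ u ∈ T, e a * e b * u ∈ T := by
    intro a b ha hb
    refine hTi (LinearMap.mulLeft ℂ (e a * e b)) (fun x hx => hRT (hst a b (hlt a ha) (hlt b hb) x hx))
      (fun x hx => ?_)
    -- Moving c to the left leaves only even products of the first 2n generators acting on x, under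
    -- which R is stable.
    have e1 : e a * e b * (c * x) = -(c * (e o * e a * (e b * e o * x))) := by
      have az := e_anti ha
      have bz := e_anti hb
      calc e a * e b * (c * x) = e a * e b * e o * e z * x := by rw [hc]; noncomm_ring
        _ = -(e a * e b * e z * e o * x) := by rw [mul_assoc _ (e o), oz]; noncomm_ring
        _ = -(e z * e a * e b * e o * x) := by
          rw [mul_assoc (e a), bz, mul_neg, ← mul_assoc, az]; noncomm_ring
        _ = e o * e o * e z * e a * e b * e o * x := by rw [ooz]; noncomm_ring
        _ = -(c * (e o * e a * (e b * e o * x))) := by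
          rw [mul_assoc (e o), oz, hc]; noncomm_ring
    rw [LinearMap.mulLeft_apply, e1]
    exact T.neg_mem (hcT _ (hst _ _ ho (hlt a ha) _ (hst _ _ (hlt b hb) ho x hx)))
  have h2 : ∀ a, a ≠ z → ∀ u ∈ T, e a * e z * u ∈ T := by
    intro a ha
    have az := e_anti ha
    refine hTi (LinearMap.mulLeft ℂ (e a * e z)) (fun x hx => ?_) (fun x hx => ?_)
    · have e1 : e a * e z * x = -(c * (e o * e a * x)) := by
        calc e a * e z * x = e o * e o * e z * e a * x := by rw [az, ooz]; noncomm_ring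
          _ = -(c * (e o * e a * x)) := by rw [mul_assoc (e o), oz, hc]; noncomm_ring
      rw [LinearMap.mulLeft_apply, e1]
      exact T.neg_mem (hcT _ (hst _ _ ho (hlt a ha) x hx))
    · have e1 : e a * e z * (c * x) = e a * e o * x := by
        calc e a * e z * (c * x) = -(e a * (e z * e z) * e o * x) := by
              rw [hc, oz]; noncomm_ring
          _ = e a * e o * x := by rw [zz]; noncomm_ring
      rw [LinearMap.mulLeft_apply, e1]
      exact hRT (hst _ _ (hlt a ha) ho x hx)
  have hTst : SpinStable T := by
    refine spinStable_of_ee_mem fun a b u hu => ?_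
    by_cases ha : a = z
    · by_cases hb : b = z
      · rw [ha, hb, zz, neg_one_mul]
        exact T.neg_mem hu
      · rw [ha, e_anti (Ne.symm hb), neg_mul]
        exact T.neg_mem (h2 b hb u hu)
    · by_cases hb : b = z
      · rw [hb]
        exact h2 a ha u hu
      · exact h1 a b ha hb u hu
  have hTS : T ≤ S := by
    refine sup_le (hR.trans (thetaPart_le ε)) ?_
    rintro _ ⟨x, hx, rfl⟩
    exact hS.stable.ee_mem o z (thetaPart_le ε (hR hx))
  have hTeq : T = S := by
    refine (hS.eq_bot_or_eq T hTS hTst).resolve_left fun h => hR0 ?_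
    rw [eq_bot_iff, ← h]
    exact hRT
  intro u hu
  have huT : u ∈ T := hTeq ▸ thetaPart_le ε hu
  obtain ⟨r, hr, y, ⟨x, hx, rfl⟩, rfl⟩ := Submodule.mem_sup.1 huT
  rw [LinearMap.mulLeft_apply] at hu ⊢
  have h3 := (mem_thetaPart.1 hu).2
  have h4 := (mem_thetaPart.1 (hR hr)).2
  have h5 := (mem_thetaPart.1 (hR hx)).2
  have h6 : theta n * (c * x) = -(ε • (c * x)) := by
    rw [hc, ← mul_assoc, ← mul_assoc, theta_mul_e ho, neg_mul, mul_assoc (e o),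
      theta_mul_e_last, neg_mul, mul_assoc, mul_assoc, h5]
    simp only [mul_smul_comm, mul_assoc]
    rfl
  have h7 : c * x = 0 := by
    rw [mul_add, h4, h6, smul_add] at h3
    have h8 : (2 * ε) • (c * x) = 0 := by
      have := add_left_cancel h3
      rw [two_mul ε, add_smul]
      nth_rewrite 1 [← this]
      exact neg_add_cancel _
    exact (smul_eq_zero.1 h8).resolve_left (mul_ne_zero two_ne_zero hε)
  rw [h7, add_zero]
  exact hr

/-- The projection of `S` onto `thetaPart S ε`. -/
def thetaProj (n : ℕ) (ε : ℂ) : Cl (2 * n + 1) := (1 / 2 : ℂ) • (1 + ε • theta n)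

theorem thetaProj_mul_mem (hS : SpinStable S) {ε : ℂ} (hε : ε * ε = 1) {u : Cl (2 * n + 1)}
    (hu : u ∈ S) : thetaProj n ε * u ∈ thetaPart S ε := by
  have hθ : ∀ u ∈ S, theta n * u ∈ S := fun u hu =>
    theta_mul_mem (fun a b _ _ u hu => hS.ee_mem a b hu) hu
  rw [mem_thetaPart, thetaProj, smul_mul_assoc, add_mul, one_mul, smul_mul_assoc]
  refine ⟨S.smul_mem _ (S.add_mem hu (S.smul_mem _ (hθ u hu))), ?_⟩
  rw [mul_smul_comm, mul_add, mul_smul_comm, ← mul_assoc, theta_sq, one_mul, smul_comm ε]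
  congr 1
  rw [smul_add, smul_smul, hε, one_smul]
  exact add_comm _ _

theorem thetaProj_add (n : ℕ) : thetaProj n 1 + thetaProj n (-1) = 1 := by
  rw [thetaProj, thetaProj]; module

/-- θ anticommutes with e_1, …, e_{2n}; hence it preserves the solutions of the Dirac equation, and
the projections of a monogenic to S^± are monogenic. -/
theorem dirac_const_theta_mul (P : Pol (2 * n + 1)) :
    dirac (2 * n) (const (theta n) * P) = -(const (theta n) * dirac (2 * n) P) := by
  rw [dirac_apply, dirac_apply, Finset.mul_sum, ← Finset.sum_neg_distrib]
  refine Finset.sum_congr rfl fun i hi => ?_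
  have hi' : i.val < 2 * n := (Finset.mem_filter.1 hi).2
  rw [pd_const_mul, ← mul_assoc, ← mul_assoc, ← const_mul, ← const_mul, ← const_neg_mul,
    theta_mul_e hi', neg_neg]

theorem const_thetaProj_mul (ε : ℂ) (P : Pol (2 * n + 1)) :
    const (thetaProj n ε) * P = (1 / 2 : ℂ) • (P + ε • (const (theta n) * P)) := by
  rw [thetaProj, const_smul, const_add, const_smul, const_one, smul_mul_assoc, add_mul, one_mul,
    smul_mul_assoc]

theorem const_thetaProj_mul_mem (hS : SpinStable S) {ε : ℂ} (hε : ε * ε = 1) {l : ℕ}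
    {P : Pol (2 * n + 1)} (hP : P ∈ monogenics (2 * n) l S) :
    const (thetaProj n ε) * P ∈ monogenics (2 * n) l (thetaPart S ε) := by
  refine ⟨const_mul_mem_homPoly (fun u hu => thetaProj_mul_mem hS hε hu) hP.1, ?_⟩
  have hD : dirac (2 * n) P = 0 := hP.2
  change dirac (2 * n) _ = 0
  rw [const_thetaProj_mul, map_smul, map_add, map_smul, dirac_const_theta_mul, hD]
  simp

theorem const_theta_mul_of_mem {d l : ℕ} {ε : ℂ} {P : Pol (2 * n + 1)}
    (hP : P ∈ homPoly d l (thetaPart S ε)) : const (theta n) * P = ε • P := by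
  rw [← sub_eq_zero, ← Submodule.mem_bot ℂ]
  refine map_mem_of_homPoly (LinearMap.mulLeft ℂ (const (theta n)) - ε • LinearMap.id)
    (fun s hs p _ _ => ?_) hP
  have := (mem_thetaPart.1 hs).2
  rw [Submodule.mem_bot, LinearMap.sub_apply, LinearMap.mulLeft_apply, const,
    Algebra.TensorProduct.tmul_mul_tmul, this, one_mul, LinearMap.smul_apply, LinearMap.id_apply,
    TensorProduct.smul_tmul', sub_self]

theorem monogenics_mono {N d k : ℕ} {S T : Submodule ℂ (Cl N)} (h : S ≤ T) :
    monogenics d k S ≤ monogenics d k T := inf_le_inf_right _ (homPoly_mono h)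

/-- A nonzero `so(2n)`-stable space of `S`-valued monogenics contains all the monogenics with
values in one of the half-spin spaces. -/
theorem IsBasicSpinor.exists_thetaPart_le (hn : 1 ≤ n) (hS : IsBasicSpinor S) {l : ℕ}
    {T : Submodule ℂ (Pol (2 * n + 1))} (hT : T ≤ monogenics (2 * n) l S)
    (hst : SoStable (2 * n) T) (hT0 : T ≠ ⊥) :
    ∃ ε : ℂ, (ε = 1 ∨ ε = -1) ∧ monogenics (2 * n) l (thetaPart S ε) ≤ T ∧
      monogenics (2 * n) l (thetaPart S ε) ≠ ⊥ := by
  -- This index stands for e_{2n}. The hyperplane x_{2n} = 0 has the odd dimension 2n - 1, as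
  -- `exists_values_of_soStable` requires.
  set z : Fin (2 * n + 1) := ⟨2 * n - 1, by omega⟩ with hz
  have hz1 : z.val + 1 = 2 * n := by simp only [hz]; omega
  have hzo : Odd z.val := ⟨n - 1, by simp only [hz]; omega⟩
  obtain ⟨S', hS'S, hS'0, hS'st, hS'T, hS'F⟩ := exists_values_of_soStable hzo
    (fun a _ u hu => hS.stable.ee_mem a z hu) (by rwa [hz1]) (by rwa [hz1]) hT0 (l := l)
  rw [hz1] at hS'T
  have hee : ∀ a b : Fin (2 * n + 1), a.val < 2 * n → b.val < 2 * n →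
      ∀ u ∈ S', e a * e b * u ∈ S' := by
    intro a b ha hb u hu
    have hcase : ∀ c : Fin (2 * n + 1), c.val < 2 * n → c = z ∨ c < z := by
      intro c hc
      rw [Fin.ext_iff, Fin.lt_def]
      omega
    rcases hcase a ha with rfl | ha'
    · rcases hcase b hb with rfl | hb'
      · rw [e_mul_self, neg_one_mul]
        exact S'.neg_mem hu
      · rw [e_anti hb'.ne', neg_mul]
        exact S'.neg_mem (hS'st b hb' u hu)
    · rcases hcase b hb with rfl | hb'
      · exact hS'st a ha' u hu
      · rw [← ee_mul_ee hb'.ne, mul_assoc]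
        exact hS'st a ha' _ (hS'st b hb' u hu)
  obtain ⟨s, hs, hs0⟩ := S'.ne_bot_iff.1 hS'0
  -- The two θ-projections add up to the identity, so one of them does not kill s; this fixes the
  -- sign.
  obtain ⟨ε, hε, hsε⟩ : ∃ ε : ℂ, (ε = 1 ∨ ε = -1) ∧ thetaProj n ε * s ≠ 0 := by
    by_contra! hcon
    have h1 := hcon 1 (Or.inl rfl)
    have h2 := hcon (-1) (Or.inr rfl)
    apply hs0
    rw [← one_mul s, ← thetaProj_add, add_mul, h1, h2, add_zero]
  have hεε : ε * ε = 1 := by rcases hε with rfl | rfl <;> norm_num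
  have hε0 : ε ≠ 0 := by rintro rfl; simp at hεε
  have hs' : thetaProj n ε * s ∈ S' := by
    rw [thetaProj, smul_mul_assoc, add_mul, one_mul, smul_mul_assoc]
    exact S'.smul_mem _ (S'.add_mem hs (S'.smul_mem _ (theta_mul_mem hee hs)))
  have hsθ := thetaProj_mul_mem hS.stable hεε (hS'S hs)
  have hle : thetaPart S ε ≤ S' := by
    refine le_trans (hS.thetaPart_le_of_stable hn hε0 (R := S' ⊓ thetaPart S ε) inf_le_right ?_ ?_)
      inf_le_left
    · exact (Submodule.ne_bot_iff _).2 ⟨_, ⟨hs', hsθ⟩, hsε⟩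
    · intro a b ha hb u hu
      exact ⟨hee a b ha hb u hu.1, ee_mul_mem_thetaPart hS.stable ha hb hu.2⟩
  refine ⟨ε, hε, (monogenics_mono hle).trans hS'T, ?_⟩
  -- F extends x^l applied to the projected constant. Its own θ-projection is an S^ε-valued
  -- monogenic with the same nonzero restriction, which shows that the space is nonzero.
  obtain ⟨F, hFT, hF⟩ := hS'F _ hs'
  have hFm := hT hFT
  have hθF : const (thetaProj n ε) * F ∈ monogenics (2 * n) l (thetaPart S ε) :=
    const_thetaProj_mul_mem hS.stable hεε hFm
  refine (Submodule.ne_bot_iff _).2 ⟨_, hθF, fun h0 => ?_⟩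
  have hcomm : ∀ P : Pol (2 * n + 1), const (thetaProj n ε) *
      vecOp (Finset.Iio z) (gam z) mv P
        = vecOp (Finset.Iio z) (gam z) mv (const (thetaProj n ε) * P) := by
    intro P
    simp only [vecOp, LinearMap.sum_apply, Module.End.mul_apply, gam_apply, mv_apply,
      Finset.mul_sum]
    refine Finset.sum_congr rfl fun a ha => ?_
    have ha' : a.val < 2 * n := by
      have := Fin.lt_def.1 (Finset.mem_Iio.1 ha)
      omega
    have h1 : thetaProj n ε * (e a * e z) = e a * e z * thetaProj n ε := by
      rw [thetaProj, smul_mul_assoc, mul_smul_comm, add_mul, mul_add, smul_mul_assoc,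
        theta_mul_ee ha' (by omega), mul_smul_comm, one_mul, mul_one]
    rw [← mul_assoc, ← const_mul, h1, const_mul, mul_assoc, ← mul_assoc (const (thetaProj n ε)),
      ← mul_assoc (var a), var_eq, scal_comm _ (const (thetaProj n ε))]
  have hcomm' : ∀ k, ∀ P : Pol (2 * n + 1), const (thetaProj n ε) *
      (vecOp (Finset.Iio z) (gam z) mv ^ k) P
        = (vecOp (Finset.Iio z) (gam z) mv ^ k) (const (thetaProj n ε) * P) := by
    intro k
    induction k with
    | zero => intro P; simp
    | succ k ih => intro P; rw [pow_succ', Module.End.mul_apply, Module.End.mul_apply, hcomm, ih]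
  have h1 : restr z (const (thetaProj n ε) * F)
      = (vecOp (Finset.Iio z) (gam z) mv ^ l) (const (thetaProj n ε * s)) := by
    have h2 : thetaProj n ε * (thetaProj n ε * s) = thetaProj n ε * s := by
      nth_rewrite 1 [thetaProj]
      rw [smul_mul_assoc, add_mul, one_mul, smul_mul_assoc, (mem_thetaPart.1 hsθ).2, smul_smul,
        hεε, one_smul, ← two_smul ℂ (thetaProj n ε * s), smul_smul]
      norm_num
    rw [map_mul, restr_const, hF, hcomm', ← const_mul, h2]
  rw [h0, map_zero] at h1
  have hc0 : const (thetaProj n ε * s) = 0 := by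
    have hg := cliffordGraded (z := z) (S := S) (fun a _ u hu => hS.stable.ee_mem a z hu)
    have hm : const (thetaProj n ε * s) ∈ homPoly z.val 0 S :=
      const_mem_homPoly_zero (thetaPart_le ε hsθ)
    refine hg.vec_pow_injective (cliffordWeyl z) ?_ (s := 0) ⟨hm, hg.dirac_zero hm⟩ l h1.symm
    rw [Fin.card_Iio]
    exact hzo.pos
  apply hsε
  have hinj : Function.Injective (fun u : Cl (2 * n + 1) => (const u : Pol (2 * n + 1))) :=
    Algebra.TensorProduct.includeLeft_injective (S := ℂ)
      (FaithfulSMul.algebraMap_injective ℂ (MvPolynomial (Fin (2 * n + 1)) ℂ))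
  exact hinj (hc0.trans (TensorProduct.zero_tmul _ _).symm)

end Spinor

/-! ### Homogenized Gegenbauer polynomials -/

section Gegenbauer

variable {A : Type*} [CommRing A]

/-- The sum of the `ψ i l` over all `i, l` with `2 i + l + 2 = j`. -/
def parityShift (ψ : ℕ → ℕ → A) : ℕ → A
  | 0 => 0
  | 1 => 0
  | j + 2 => ∑ i ∈ Finset.range (j / 2 + 1), ψ i (j - 2 * i)

theorem parityShift_congr {ψ χ : ℕ → ℕ → A} {j : ℕ}
    (h : ∀ i l, 2 * i + l = j → ψ i l = χ i l) :
    parityShift ψ (j + 2) = parityShift χ (j + 2) := by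
  refine Finset.sum_congr rfl fun i hi => h _ _ ?_
  have := Finset.mem_range.1 hi
  omega

theorem parityShift_add (ψ χ : ℕ → ℕ → A) (j : ℕ) :
    parityShift (fun i l => ψ i l + χ i l) (j + 2)
      = parityShift ψ (j + 2) + parityShift χ (j + 2) :=
  Finset.sum_add_distrib

theorem parityShift_mul (c : A) (ψ : ℕ → ℕ → A) (j : ℕ) :
    parityShift (fun i l => c * ψ i l) j = c * parityShift ψ j := by
  match j with
  | 0 => simp [parityShift]
  | 1 => simp [parityShift]
  | j + 2 => exact (Finset.mul_sum _ _ _).symm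

/-- Substituting l + 1 for l loses only a possible boundary term with l = 0, which vanishes by
hypothesis. `parityShift_succ_left` does the same for i. -/
theorem parityShift_succ_right {χ : ℕ → ℕ → A} (h : ∀ i, χ i 0 = 0) (j : ℕ) :
    parityShift χ (j + 2) = parityShift (fun i l => χ i (l + 1)) (j + 1) := by
  rcases j with _ | j
  · simp [parityShift, h]
  · change ∑ i ∈ Finset.range ((j + 1) / 2 + 1), χ i (j + 1 - 2 * i)
      = ∑ i ∈ Finset.range (j / 2 + 1), χ i (j - 2 * i + 1)
    have hterm : ∀ i ∈ Finset.range (j / 2 + 1), χ i (j + 1 - 2 * i) = χ i (j - 2 * i + 1) := by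
      intro i hi
      have := Finset.mem_range.1 hi
      rw [show j + 1 - 2 * i = j - 2 * i + 1 by omega]
    rcases Nat.even_or_odd' j with ⟨r, rfl | rfl⟩
    · rw [show (2 * r + 1) / 2 = 2 * r / 2 by omega]
      exact Finset.sum_congr rfl hterm
    · rw [show (2 * r + 1 + 1) / 2 = (2 * r + 1) / 2 + 1 by omega, Finset.sum_range_succ,
        show 2 * r + 1 + 1 - 2 * ((2 * r + 1) / 2 + 1) = 0 by omega, h, add_zero]
      exact Finset.sum_congr rfl hterm

theorem parityShift_succ_left {χ : ℕ → ℕ → A} (h : ∀ l, χ 0 l = 0) (j : ℕ) :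
    parityShift χ (j + 2) = parityShift (fun i l => χ (i + 1) l) j := by
  match j with
  | 0 => simp [parityShift, h]
  | 1 => simp [parityShift, h]
  | j + 2 =>
    change ∑ i ∈ Finset.range ((j + 2) / 2 + 1), χ i (j + 2 - 2 * i)
      = ∑ i ∈ Finset.range (j / 2 + 1), χ (i + 1) (j - 2 * i)
    rw [show (j + 2) / 2 = j / 2 + 1 by omega, Finset.sum_range_succ', h, add_zero]
    refine Finset.sum_congr rfl fun i _ => ?_
    rw [show j + 2 - 2 * (i + 1) = j - 2 * i by omega]

variable [Algebra ℂ A]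

/-- The term of the homogenized Gegenbauer polynomial that involves `t^l q^i`. -/
def gegTerm (ν : ℂ) (t q : A) (i l : ℕ) : A :=
  algebraMap ℂ A (gegCoeff ν (2 * i + l) i) * ((2 * t) ^ l * q ^ i)

/-- The homogenized Gegenbauer polynomials with the index shifted by `2`, and continued by `0`. -/
def gegShift (ν : ℂ) (t q : A) (j : ℕ) : A := parityShift (gegTerm ν t q) j

theorem gegenbauerHom_eq_gegShift (ν : ℂ) (t q : A) (j : ℕ) :
    gegenbauerHom ν j t q = gegShift ν t q (j + 2) := by
  refine Finset.sum_congr rfl fun i hi => ?_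
  have := Finset.mem_range.1 hi
  rw [gegTerm, Algebra.smul_def, show 2 * i + (j - 2 * i) = j by omega]

theorem ascPochhammer_eval_add_one (ν : ℂ) (r : ℕ) :
    ν * (ascPochhammer ℂ r).eval (ν + 1) = (ascPochhammer ℂ (r + 1)).eval ν := by
  rw [ascPochhammer_succ_left, Polynomial.eval_mul, Polynomial.eval_X, Polynomial.eval_comp]
  simp

theorem gegCoeff_add (ν : ℂ) (i l : ℕ) : gegCoeff ν (2 * i + l) i
    = (-1) ^ i * (ascPochhammer ℂ (i + l)).eval ν / ((i ! : ℂ) * (l ! : ℂ)) := by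
  rw [gegCoeff, show 2 * i + l - i = i + l by omega, show 2 * i + l - 2 * i = l by omega]

/-- This identity and the two that follow rest on ν (ν+1)_r = (ν)_{r+1}. They correspond to
differentiation in t, differentiation in q, and raising of ν. -/
theorem gegCoeff_succ_right (ν : ℂ) (i l : ℕ) :
    ((l : ℂ) + 1) * gegCoeff ν (2 * i + (l + 1)) i = ν * gegCoeff (ν + 1) (2 * i + l) i := by
  have h1 : (l ! : ℂ) ≠ 0 := by exact_mod_cast l.factorial_ne_zero
  have h2 : (i ! : ℂ) ≠ 0 := by exact_mod_cast i.factorial_ne_zero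
  have h3 : (l : ℂ) + 1 ≠ 0 := by exact_mod_cast l.succ_ne_zero
  rw [gegCoeff_add, gegCoeff_add, ← add_assoc, ← ascPochhammer_eval_add_one, Nat.factorial_succ]
  push_cast
  field_simp

theorem gegCoeff_succ_left (ν : ℂ) (i l : ℕ) :
    ((i : ℂ) + 1) * gegCoeff ν (2 * (i + 1) + l) (i + 1)
      = -(ν * gegCoeff (ν + 1) (2 * i + l) i) := by
  have h1 : (l ! : ℂ) ≠ 0 := by exact_mod_cast l.factorial_ne_zero
  have h2 : (i ! : ℂ) ≠ 0 := by exact_mod_cast i.factorial_ne_zero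
  have h3 : (i : ℂ) + 1 ≠ 0 := by exact_mod_cast i.succ_ne_zero
  rw [gegCoeff_add, gegCoeff_add, add_right_comm, ← ascPochhammer_eval_add_one,
    Nat.factorial_succ, pow_succ]
  push_cast
  field_simp

theorem gegCoeff_raise (ν : ℂ) (i l : ℕ) :
    ν * gegCoeff (ν + 1) (2 * i + l) i = (ν + i + l) * gegCoeff ν (2 * i + l) i := by
  rw [gegCoeff_add, gegCoeff_add, mul_div_assoc', mul_left_comm, ascPochhammer_eval_add_one,
    ascPochhammer_succ_eval]
  push_cast
  ring

theorem gegTerm_succ_right (ν : ℂ) (t q : A) (i l : ℕ) :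
    ((l : A) + 1) * gegTerm ν t q i (l + 1)
      = 2 * algebraMap ℂ A ν * t * gegTerm (ν + 1) t q i l := by
  have := congrArg (algebraMap ℂ A) (gegCoeff_succ_right ν i l)
  simp only [map_mul, map_add, map_natCast, map_one] at this
  rw [gegTerm, gegTerm, pow_succ]
  linear_combination (2 * t) ^ l * (2 * t) * q ^ i * this

theorem gegTerm_succ_left (ν : ℂ) (t q : A) (i l : ℕ) :
    ((i : A) + 1) * gegTerm ν t q (i + 1) l
      = -(algebraMap ℂ A ν * q * gegTerm (ν + 1) t q i l) := by
  have := congrArg (algebraMap ℂ A) (gegCoeff_succ_left ν i l)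
  simp only [map_mul, map_add, map_natCast, map_one, map_neg] at this
  rw [gegTerm, gegTerm, pow_succ]
  linear_combination (2 * t) ^ l * q ^ i * q * this

theorem gegTerm_raise (ν : ℂ) (t q : A) (i l : ℕ) :
    algebraMap ℂ A ν * gegTerm (ν + 1) t q i l
      = (algebraMap ℂ A ν + i + l) * gegTerm ν t q i l := by
  have := congrArg (algebraMap ℂ A) (gegCoeff_raise ν i l)
  simp only [map_mul, map_add, map_natCast] at this
  rw [gegTerm, gegTerm]
  linear_combination (2 * t) ^ l * q ^ i * this

theorem parityShift_gegTerm_right (ν : ℂ) (t q : A) (j : ℕ) :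
    parityShift (fun i l => (l : A) * gegTerm ν t q i l) (j + 2)
      = 2 * algebraMap ℂ A ν * t * gegShift (ν + 1) t q (j + 1) := by
  rw [parityShift_succ_right (by simp), gegShift, ← parityShift_mul]
  congr 1
  funext i l
  rw [← gegTerm_succ_right]
  push_cast; rfl

theorem parityShift_gegTerm_left (ν : ℂ) (t q : A) (j : ℕ) :
    parityShift (fun i l => (i : A) * gegTerm ν t q i l) (j + 2)
      = -(algebraMap ℂ A ν * q) * gegShift (ν + 1) t q j := by
  rw [parityShift_succ_left (by simp), gegShift, ← parityShift_mul]
  congr 1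
  funext i l
  rw [neg_mul, ← gegTerm_succ_left]
  push_cast; rfl

/-- Euler's identity for the weights 1 of t and 2 of q: the term t^l q^i has weight l + 2i = j.
Index j + 2 stands for C_j, so the indices 0 and 1 mean C_{-2} = C_{-1} = 0 and no case distinction
is needed. -/
theorem gegShift_euler (ν : ℂ) (t q : A) (j : ℕ) :
    (j : A) * gegShift ν t q (j + 2)
      = 2 * algebraMap ℂ A ν *
        (t * gegShift (ν + 1) t q (j + 1) - q * gegShift (ν + 1) t q j) := by
  have h1 : (j : A) * gegShift ν t q (j + 2)
      = parityShift (fun i l => (l : A) * gegTerm ν t q i l) (j + 2)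
        + 2 * parityShift (fun i l => (i : A) * gegTerm ν t q i l) (j + 2) := by
    rw [gegShift, ← parityShift_mul, ← parityShift_mul, ← parityShift_add]
    refine parityShift_congr fun i l hil => ?_
    rw [← hil]
    push_cast
    ring
  rw [h1, parityShift_gegTerm_right, parityShift_gegTerm_left]
  ring

theorem gegShift_raise (ν : ℂ) (t q : A) (j : ℕ) :
    (2 * algebraMap ℂ A ν + j - 1) * gegShift ν t q (j + 1)
      = 2 * algebraMap ℂ A ν * (gegShift (ν + 1) t q (j + 1) - t * gegShift (ν + 1) t q j) := by
  rcases j with _ | j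
  · simp [gegShift, parityShift]
  -- Raising ν multiplies a term by (ν + i + l)/ν, and 2(ν + i + l) = 2ν + j + l when 2i + l = j.
  · have h1 : (2 * algebraMap ℂ A ν) * gegShift (ν + 1) t q (j + 2)
        = (2 * algebraMap ℂ A ν + j) * gegShift ν t q (j + 2)
          + parityShift (fun i l => (l : A) * gegTerm ν t q i l) (j + 2) := by
      rw [gegShift, gegShift, ← parityShift_mul, ← parityShift_mul, ← parityShift_add]
      refine parityShift_congr fun i l hil => ?_
      rw [mul_assoc, gegTerm_raise, ← hil]
      push_cast
      ring
    rw [parityShift_gegTerm_right] at h1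
    push_cast
    linear_combination -h1

theorem derivation_gegShift (δ : Derivation ℂ A A) (ν : ℂ) (t q : A) (j : ℕ) :
    δ (gegShift ν t q (j + 2))
      = 2 * algebraMap ℂ A ν * gegShift (ν + 1) t q (j + 1) * δ t
        - algebraMap ℂ A ν * gegShift (ν + 1) t q j * δ q := by
  have hterm : ∀ i l, δ (gegTerm ν t q i l)
      = algebraMap ℂ A (gegCoeff ν (2 * i + l) i) *
          (l * (2 * t) ^ (l - 1) * (2 * δ t) * q ^ i)
        + algebraMap ℂ A (gegCoeff ν (2 * i + l) i) *
          (i * (2 * t) ^ l * q ^ (i - 1) * δ q) := by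
    intro i l
    have h2 : δ (2 * t) = 2 * δ t := by rw [two_mul, map_add, two_mul]
    rw [gegTerm, ← Algebra.smul_def, Derivation.map_smul, Derivation.leibniz, Derivation.leibniz_pow,
      Derivation.leibniz_pow, h2, Algebra.smul_def]
    simp only [smul_eq_mul, nsmul_eq_mul]
    ring
  have h1 : δ (gegShift ν t q (j + 2))
      = parityShift (fun i l => algebraMap ℂ A (gegCoeff ν (2 * i + l) i) *
          (l * (2 * t) ^ (l - 1) * (2 * δ t) * q ^ i)) (j + 2)
        + parityShift (fun i l => algebraMap ℂ A (gegCoeff ν (2 * i + l) i) *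
          (i * (2 * t) ^ l * q ^ (i - 1) * δ q)) (j + 2) := by
    rw [← parityShift_add]
    simp only [← hterm]
    exact map_sum δ (fun i => gegTerm ν t q i (j - 2 * i)) (Finset.range (j / 2 + 1))
  rw [h1, parityShift_succ_right (by simp), parityShift_succ_left (by simp), sub_eq_add_neg,
    mul_right_comm, mul_right_comm (algebraMap ℂ A ν), ← neg_mul, gegShift, gegShift,
    ← parityShift_mul, ← parityShift_mul]
  congr 2
  · funext i l
    have := congrArg (algebraMap ℂ A) (gegCoeff_succ_right ν i l)
    simp only [map_mul, map_add, map_natCast, map_one] at this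
    rw [gegTerm, Nat.add_sub_cancel]
    push_cast
    linear_combination (2 * t) ^ l * q ^ i * (2 * δ t) * this
  · funext i l
    have := congrArg (algebraMap ℂ A) (gegCoeff_succ_left ν i l)
    simp only [map_mul, map_add, map_natCast, map_one, map_neg] at this
    rw [gegTerm, Nat.add_sub_cancel]
    push_cast
    linear_combination (2 * t) ^ l * q ^ i * δ q * this

end Gegenbauer

theorem map_gegenbauerHom {A B : Type*} [Ring A] [Algebra ℂ A] [Ring B] [Algebra ℂ B]
    (f : A →ₐ[ℂ] B) (ν : ℂ) (j : ℕ) (t q : A) :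
    f (gegenbauerHom ν j t q) = gegenbauerHom ν j (f t) (f q) := by
  simp [gegenbauerHom, two_mul]

theorem gegenbauerHom_even_zero {A : Type*} [Ring A] [Algebra ℂ A] (ν : ℂ) (l : ℕ) (q : A) :
    gegenbauerHom ν (2 * l) 0 q = gegCoeff ν (2 * l) l • q ^ l := by
  rw [gegenbauerHom, Finset.sum_eq_single l]
  · simp
  · intro i hi hil
    have := Finset.mem_range.1 hi
    rw [mul_zero, zero_pow (by omega), zero_mul, smul_zero]
  · intro h
    exact absurd (Finset.mem_range.2 (by omega)) h

theorem gegenbauerHom_odd_zero {A : Type*} [Ring A] [Algebra ℂ A] (ν : ℂ) (l : ℕ) (q : A) :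
    gegenbauerHom ν (2 * l + 1) 0 q = 0 := by
  refine Finset.sum_eq_zero fun i hi => ?_
  have := Finset.mem_range.1 hi
  rw [mul_zero, zero_pow (by omega), zero_mul, smul_zero]

theorem gegenbauer_even_zero (ν : ℂ) (l : ℕ) :
    gegenbauer ν (2 * l) 0 = gegCoeff ν (2 * l) l := by
  have := gegenbauerHom_even_zero ν l (1 : ℂ)
  rw [one_pow, smul_eq_mul, mul_one] at this
  rw [← this]
  simp [gegenbauer, gegenbauerHom]

theorem gegCoeff_ne_zero {ν : ℂ} (hν : ∀ r : ℕ, ν + r ≠ 0) (l : ℕ) :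
    gegCoeff ν (2 * l) l ≠ 0 := by
  have h1 : ∀ r : ℕ, (ascPochhammer ℂ r).eval ν ≠ 0 := by
    intro r
    induction r with
    | zero => simp
    | succ r ih =>
      rw [ascPochhammer_succ_eval]
      exact mul_ne_zero ih (hν r)
  rw [gegCoeff]
  refine div_ne_zero (mul_ne_zero (pow_ne_zero _ (by norm_num)) (h1 _)) (mul_ne_zero ?_ ?_) <;>
    exact_mod_cast Nat.factorial_ne_zero _

theorem isHomogeneous_gegenbauerHom {N : ℕ} (ν : ℂ) (j : ℕ) {t q : MvPolynomial (Fin N) ℂ}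
    (ht : t.IsHomogeneous 1) (hq : q.IsHomogeneous 2) :
    (gegenbauerHom ν j t q).IsHomogeneous j := by
  refine MvPolynomial.IsHomogeneous.sum _ _ _ fun i hi => ?_
  have := Finset.mem_range.1 hi
  have h2 : (2 * t).IsHomogeneous 1 := by rw [two_mul]; exact ht.add ht
  have h3 := (h2.pow (j - 2 * i)).mul (hq.pow i)
  rw [show 1 * (j - 2 * i) + 2 * i = j by omega] at h3
  rw [MvPolynomial.smul_eq_C_mul]
  exact h3.C_mul _

/-! ### The polynomials `X^{(j)}_k` -/

section Ladder

variable {q : ℕ}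

/-- `x₁² + ⋯ + x_m²` as a scalar polynomial. -/
def rSqScal (N : ℕ) : MvPolynomial (Fin N) ℂ := ∑ i, MvPolynomial.X i ^ 2

theorem rSq_eq (N : ℕ) : rSq N = scal (rSqScal N) := by
  simp [rSq, rSqScal, var_eq]

theorem pderiv_rSqScal {N : ℕ} (i : Fin N) :
    MvPolynomial.pderiv i (rSqScal N) = 2 * MvPolynomial.X i := by
  rw [rSqScal, map_sum, Finset.sum_eq_single i]
  · rw [MvPolynomial.pderiv_pow, MvPolynomial.pderiv_X_self]
    simp
  · intro b _ hb
    rw [MvPolynomial.pderiv_pow, MvPolynomial.pderiv_X_of_ne hb, mul_zero]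
  · simp

theorem isHomogeneous_rSqScal (N : ℕ) : (rSqScal N).IsHomogeneous 2 :=
  MvPolynomial.IsHomogeneous.sum _ _ _ fun i _ => by
    simpa using MvPolynomial.isHomogeneous_X_pow (R := ℂ) i 2

/-- The homogenized Gegenbauer polynomial in `x_m` and `r²` as a scalar polynomial. -/
def gegScal (q : ℕ) (ν : ℂ) (j : ℕ) : MvPolynomial (Fin (q + 1)) ℂ :=
  gegenbauerHom ν j (MvPolynomial.X (Fin.last q)) (rSqScal (q + 1))

theorem gegenbauerHom_var_rSq (ν : ℂ) (j : ℕ) :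
    gegenbauerHom ν j (var (Fin.last q)) (rSq (q + 1)) = scal (gegScal q ν j) := by
  rw [gegScal, map_gegenbauerHom, rSq_eq, var_eq]

/-- The operator `x̲ e_m`. -/
abbrev xop (q : ℕ) : Module.End ℂ (Pol (q + 1)) :=
  vecOp (Finset.Iio (Fin.last q)) (gam (Fin.last q)) mv

/-- The Dirac operator of dimension `q`, multiplied by `-e_{q+1}`. -/
abbrev dop (q : ℕ) : Module.End ℂ (Pol (q + 1)) :=
  diracOp (Finset.Iio (Fin.last q)) (gam (Fin.last q)) pd

theorem sum_Iio_last {M : Type*} [AddCommMonoid M] (f : Fin (q + 1) → M) :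
    ∑ a ∈ Finset.Iio (Fin.last q), f a = ∑ i : Fin q, f i.castSucc := by
  rw [Fin.Iio_last_eq_map, Finset.sum_map]
  rfl

theorem xe_mul (P : Pol (q + 1)) : xe q * P = xop q P := by
  rw [xop, vecOp, LinearMap.sum_apply, sum_Iio_last, xe, Finset.sum_mul, Finset.sum_mul]
  refine Finset.sum_congr rfl fun i _ => ?_
  rw [Module.End.mul_apply, gam_apply, mv_apply, const_mul, mul_assoc (const _) (var _),
    var_eq, scal_comm]
  simp only [mul_assoc, scal_comm]

/-- The factor in front of the second summand of `X^{(j)}_k`. -/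
def ladderRatio (q j k : ℕ) : ℂ :=
  (((q + 1 : ℕ) : ℂ) + 2 * k - 2) / (((q + 1 : ℕ) : ℂ) + 2 * k + j - 2)

theorem X_succ_mul (j k : ℕ) (P : Pol (q + 1)) :
    X q (j + 1) k * P = muConst (q + 1) (j + 1) k •
      (scal (gegScal q (((q + 1 : ℕ) : ℂ) / 2 + k - 1) (j + 1)) * P
        + ladderRatio q (j + 1) k •
          (scal (gegScal q (((q + 1 : ℕ) : ℂ) / 2 + k) j) * xop q P)) := by
  rw [X, if_neg j.succ_ne_zero, Nat.add_sub_cancel, gegenbauerHom_var_rSq,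
    gegenbauerHom_var_rSq, smul_mul_assoc, add_mul, smul_mul_assoc, mul_assoc, xe_mul]
  rfl

theorem X_zero_mul (k : ℕ) (P : Pol (q + 1)) : X q 0 k * P = P := by
  rw [X, if_pos rfl, one_mul]

theorem pd_eq_zero_of_homPoly {N d k : ℕ} {S : Submodule ℂ (Cl N)} {i : Fin N} (hi : d ≤ i.val)
    {P : Pol N} (hP : P ∈ homPoly d k S) : pd i P = 0 := by
  rw [← Submodule.mem_bot ℂ]
  refine map_mem_of_homPoly (pd i) (fun s _ p _ hpd => ?_) hP
  rw [pd_tmul, pderiv_eq_zero_of_supported hpd (by simpa using hi), TensorProduct.tmul_zero]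
  exact Submodule.zero_mem _

theorem const_mul_scal_mul {N : ℕ} (u : Cl N) (f : MvPolynomial (Fin N) ℂ) (P : Pol N) :
    const u * (scal f * P) = scal f * (const u * P) := by
  rw [← mul_assoc, ← scal_comm, mul_assoc]

/-- The hypothesis says that the gradient of f in the first q variables is radial, as for functions
of r² and x_m; hence D applied to f itself gives f' x. For the same reason f commutes with rotations
in `rot_scal_mul`. -/
theorem dop_scal_mul {f f' : MvPolynomial (Fin (q + 1)) ℂ}
    (hf : ∀ a < Fin.last q, MvPolynomial.pderiv a f = f' * MvPolynomial.X a) (P : Pol (q + 1)) :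
    dop q (scal f * P) = scal f' * xop q P + scal f * dop q P := by
  simp only [dop, xop, diracOp, vecOp, LinearMap.sum_apply, Module.End.mul_apply, gam_apply,
    mv_apply, Finset.mul_sum, ← Finset.sum_add_distrib]
  refine Finset.sum_congr rfl fun a ha => ?_
  rw [pd_scal_mul, hf a (Finset.mem_Iio.1 ha), mul_add, const_mul_scal_mul, const_mul_scal_mul,
    var_eq, const_mul_scal_mul, ← mul_assoc (scal f'), ← map_mul]

theorem rot_scal_mul {f f' : MvPolynomial (Fin (q + 1)) ℂ} {a b : Fin (q + 1)}
    (ha : MvPolynomial.pderiv a f = f' * MvPolynomial.X a)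
    (hb : MvPolynomial.pderiv b f = f' * MvPolynomial.X b) (P : Pol (q + 1)) :
    rot a b (scal f * P) = scal f * rot a b P := by
  have h2 : ∀ c i : Fin (q + 1), MvPolynomial.pderiv i f = f' * MvPolynomial.X i →
      var c * pd i (scal f * P)
        = scal (f' * MvPolynomial.X i * MvPolynomial.X c) * P + scal f * (var c * pd i P) := by
    intro c i hi
    rw [pd_scal_mul, hi, mul_add, var_eq, ← mul_assoc, ← map_mul, mul_comm (MvPolynomial.X c),
      ← mul_assoc, ← mul_assoc (scal f), scal_comm f]
  simp only [rot, LinearMap.sub_apply, LinearMap.add_apply, LinearMap.smul_apply,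
    LinearMap.mulLeft_apply, LinearMap.comp_apply, const_mul_scal_mul, h2 b a ha, h2 a b hb, mul_sub, mul_add,
    mul_smul_comm, mul_right_comm f']
  abel

theorem pderiv_gegScal (ν : ℂ) (j : ℕ) (i : Fin (q + 1)) :
    MvPolynomial.pderiv i (gegScal q ν j)
      = 2 * MvPolynomial.C ν *
          gegShift (ν + 1) (MvPolynomial.X (Fin.last q)) (rSqScal (q + 1)) (j + 1) *
          MvPolynomial.pderiv i (MvPolynomial.X (Fin.last q))
        - MvPolynomial.C ν *
          gegShift (ν + 1) (MvPolynomial.X (Fin.last q)) (rSqScal (q + 1)) j *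
          (2 * MvPolynomial.X i) := by
  rw [gegScal, gegenbauerHom_eq_gegShift, derivation_gegShift, pderiv_rSqScal]
  rfl

theorem pderiv_gegScal_of_lt (ν : ℂ) (j : ℕ) {i : Fin (q + 1)} (hi : i < Fin.last q) :
    MvPolynomial.pderiv i (gegScal q ν j)
      = -(2 * MvPolynomial.C ν *
          gegShift (ν + 1) (MvPolynomial.X (Fin.last q)) (rSqScal (q + 1)) j) *
        MvPolynomial.X i := by
  rw [pderiv_gegScal, MvPolynomial.pderiv_X_of_ne hi.ne']
  ring

/-- Multiplication by `X^{(j)}_k` commutes with rotations of the first `q` coordinates. -/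
theorem rot_X_mul (j k : ℕ) {a b : Fin (q + 1)} (ha : a < Fin.last q) (hb : b < Fin.last q)
    (P : Pol (q + 1)) : rot a b (X q j k * P) = X q j k * rot a b P := by
  rcases j with _ | j
  · rw [X_zero_mul, X_zero_mul]
  · have hx : rot a b (xop q P) = xop q (rot a b P) := by
      have := ((cliffordWeyl (Fin.last q)).rot_vec (Finset.mem_Iio.2 ha) (Finset.mem_Iio.2 hb)).eq
      rw [← rot_eq_rotOp hb.ne] at this
      exact congrArg (fun T : Module.End ℂ (Pol (q + 1)) => T P) this
    rw [X_succ_mul, X_succ_mul, map_smul, map_add, map_smul,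
      rot_scal_mul (pderiv_gegScal_of_lt _ _ ha) (pderiv_gegScal_of_lt _ _ hb),
      rot_scal_mul (pderiv_gegScal_of_lt _ _ ha) (pderiv_gegScal_of_lt _ _ hb), hx]

theorem xop_sq (P : Pol (q + 1)) :
    xop q (xop q P)
      = -(scal (rSqScal (q + 1) - MvPolynomial.X (Fin.last q) ^ 2) * P) := by
  have h := congrArg (fun T : Module.End ℂ (Pol (q + 1)) => T P)
    (cliffordWeyl (Fin.last q)).vec_sq
  simp only [Module.End.mul_apply, LinearMap.neg_apply, LinearMap.sum_apply] at h
  rw [h, sum_Iio_last, rSqScal, Fin.sum_univ_castSucc, add_sub_cancel_right, map_sum,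
    Finset.sum_mul]
  simp only [mv_apply, var_eq, ← mul_assoc, ← map_mul, pow_two]

theorem X_mul_mem_homPoly {S : Submodule ℂ (Cl (q + 1))}
    (hS : ∀ a < Fin.last q, ∀ u ∈ S, e a * e (Fin.last q) * u ∈ S) {s : ℕ} {P : Pol (q + 1)}
    (hP : P ∈ homPoly q s S) (j k : ℕ) : X q j k * P ∈ homPoly (q + 1) (s + j) S := by
  rcases j with _ | j
  · rw [X_zero_mul]
    exact homPoly_mono_dim (Nat.le_succ q) S hP
  · have hsupp : ∀ f : MvPolynomial (Fin (q + 1)) ℂ,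
        f ∈ MvPolynomial.supported ℂ {i : Fin (q + 1) | i.val < q + 1} := by
      intro f
      have : {i : Fin (q + 1) | i.val < q + 1} = Set.univ :=
        Set.eq_univ_of_forall fun i => i.isLt
      rw [this, MvPolynomial.supported_univ]
      exact Algebra.mem_top
    have hg : ∀ ν r, (gegScal q ν r).IsHomogeneous r := fun ν r =>
      isHomogeneous_gegenbauerHom ν r (MvPolynomial.isHomogeneous_X ℂ _) (isHomogeneous_rSqScal _)
    have hx : xop q P ∈ homPoly (q + 1) (s + 1) S :=
      homPoly_mono_dim (Nat.le_succ q) S ((cliffordGraded hS).vec_mem hP)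
    have h1 := scal_mul_mem_homPoly (hg (((q + 1 : ℕ) : ℂ) / 2 + k - 1) (j + 1)) (hsupp _)
      (homPoly_mono_dim (Nat.le_succ q) S hP)
    have h2 := scal_mul_mem_homPoly (hg (((q + 1 : ℕ) : ℂ) / 2 + k) j) (hsupp _) hx
    rw [show s + 1 + j = s + (j + 1) by ring] at h2
    rw [X_succ_mul]
    exact Submodule.smul_mem _ _ (Submodule.add_mem _ h1 (Submodule.smul_mem _ _ h2))

theorem ladder_denom_ne_zero (hq : 2 ≤ q) (k j : ℕ) :
    ((q + 1 : ℕ) : ℂ) + 2 * k + j - 2 ≠ 0 := by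
  rw [sub_ne_zero]
  norm_cast
  omega

/-- Collects the coefficients of P and xP when scalar polynomials act through a ring homomorphism
into a noncommutative ring. -/
theorem map_combine {R A : Type*} [CommRing R] [Ring A] (F : R →+* A) (a b c d f g κ w : R)
    (x y : A) :
    F a * x + F κ * (F b * y) + (F c * y + F κ * (F d * -(F w * x) + F f * (F g * x)))
      = F (a + κ * (-d * w + f * g)) * x + F (c + κ * b) * y := by
  simp only [map_add, map_mul, map_neg]
  noncomm_ring

/-- Multiplication by `X^{(j)}_s` maps monogenics of degree `s` in dimension `q` to monogenics in
dimension `q + 1`. -/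
theorem X_mul_mem_monogenics (hq : 2 ≤ q) {S : Submodule ℂ (Cl (q + 1))}
    (hS : ∀ a < Fin.last q, ∀ u ∈ S, e a * e (Fin.last q) * u ∈ S) {s : ℕ} {P : Pol (q + 1)}
    (hP : P ∈ monogenics q s S) (j : ℕ) : X q j s * P ∈ monogenics (q + 1) (s + j) S := by
  refine ⟨X_mul_mem_homPoly hS hP.1 j s, ?_⟩
  have hG := cliffordGraded hS
  have hPm : P ∈ monPart (Finset.Iio (Fin.last q)) (gam (Fin.last q)) pd
      (fun k => homPoly (Fin.last q).val k S) s := by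
    rw [← monogenics_eq_monPart]; exact hP
  have hD : dop q P = 0 := hPm.2
  have hpz : pd (Fin.last q) P = 0 := pd_eq_zero_of_homPoly (by simp) hP.1
  refine (dirac_succ_eq_zero_iff (Fin.last q) _).2 ?_
  rw [eq_neg_iff_add_eq_zero]
  change pd (Fin.last q) _ + dop q _ = 0
  rcases j with _ | j
  · rw [X_zero_mul, hpz, hD, add_zero]
  · have hy : xop q P ∈ homPoly q (s + 1) S := hG.vec_mem hP.1
    have hyz : pd (Fin.last q) (xop q P) = 0 := pd_eq_zero_of_homPoly (by simp) hy
    have hDy : dop q (xop q P) = -(2 * s + q : ℂ) • P := by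
      have := hG.dirac_vec_pow (cliffordWeyl _) hPm 0
      simp only [zero_add, pow_one, pow_zero, Module.End.one_apply, fischerConst, Fin.card_Iio,
        Fin.val_last] at this
      rw [dop, xop, this]
      push_cast; module
    rw [X_succ_mul]
    set ν : ℂ := ((q + 1 : ℕ) : ℂ) / 2 + s - 1 with hν
    have hν1 : ((q + 1 : ℕ) : ℂ) / 2 + s = ν + 1 := by rw [hν]; ring
    have h2ν : (2 * s + q : ℂ) = 2 * ν + 1 := by rw [hν]; push_cast; ring
    set κ := ladderRatio q (j + 1) s with hκ
    -- This is the property of the ratio in X^{(j)} that makes the two coefficient identities `hA`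
    -- and `hB` hold.
    have hκν : κ * (2 * ν + j + 1) = 2 * ν := by
      have h1 := ladder_denom_ne_zero hq s (j + 1)
      have h2 : 2 * ν + j + 1 = ((q + 1 : ℕ) : ℂ) + 2 * s + (j + 1 : ℕ) - 2 := by
        rw [hν]; push_cast; ring
      rw [h2, hκ, ladderRatio, div_mul_cancel₀ _ h1, hν]
      push_cast; ring
    rw [hν1, map_smul, map_smul, ← smul_add, map_add, map_add, map_smul, map_smul, pd_scal_mul,
      pd_scal_mul, hpz, hyz, mul_zero, mul_zero, add_zero, add_zero,
      dop_scal_mul (fun a ha => pderiv_gegScal_of_lt ν (j + 1) ha),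
      dop_scal_mul (fun a ha => pderiv_gegScal_of_lt (ν + 1) j ha), hD, hDy, xop_sq, h2ν,
      mul_zero, add_zero, pderiv_gegScal, pderiv_gegScal, MvPolynomial.pderiv_X_self]
    set t : MvPolynomial (Fin (q + 1)) ℂ := MvPolynomial.X (Fin.last q)
    set r := rSqScal (q + 1)
    have hI1 := gegShift_raise (ν + 1) t r j
    have hI2 := gegShift_euler (ν + 1) t r j
    have hF : gegScal q (ν + 1) j = gegShift (ν + 1) t r (j + 2) := gegenbauerHom_eq_gegShift _ _ _ _
    rw [hF]
    set F := gegShift (ν + 1) t r (j + 2)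
    set H := gegShift (ν + 1) t r (j + 1)
    set U := gegShift (ν + 1 + 1) t r (j + 1)
    set V := gegShift (ν + 1 + 1) t r j
    have hκC : (MvPolynomial.C κ * (2 * MvPolynomial.C ν + (j : MvPolynomial (Fin (q + 1)) ℂ) + 1) :
        MvPolynomial (Fin (q + 1)) ℂ) = 2 * MvPolynomial.C ν := by
      have := congrArg (MvPolynomial.C (σ := Fin (q + 1))) hκν
      simpa only [map_mul, map_add, map_natCast, map_one, map_ofNat] using this
    rw [MvPolynomial.algebraMap_eq, map_add, map_one] at hI1 hI2
    have hCν : (MvPolynomial.C (ν + 1) : MvPolynomial (Fin (q + 1)) ℂ)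
        = MvPolynomial.C ν + 1 := by rw [map_add, map_one]
    rw [hCν]
    -- Applying ∂/∂x_m + D, with D(xP) = -(2ν+1)P and x²P = -(r² - x_m²)P, leaves a combination of P
    -- and xP. `hA` and `hB` say that both coefficients vanish; they follow from the raising
    -- relation, with Euler's identity also used for `hA`.
    have hA : 2 * MvPolynomial.C ν * F * 1 - MvPolynomial.C ν * H * (2 * t)
        + MvPolynomial.C κ * ((2 * (MvPolynomial.C ν + 1) * V) * (r - t ^ 2)
          - (2 * MvPolynomial.C ν + 1) * F) = 0 := by
      linear_combination F * (-hκC) - t * H * (-hκC) - MvPolynomial.C κ * t * hI1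
        + MvPolynomial.C κ * hI2
    have hB : -(2 * MvPolynomial.C ν * H) + MvPolynomial.C κ *
        (2 * (MvPolynomial.C ν + 1) * U * 1 - (MvPolynomial.C ν + 1) * V * (2 * t)) = 0 := by
      linear_combination H * hκC - MvPolynomial.C κ * hI1
    have hsm : ∀ (c : ℂ) (Q : Pol (q + 1)), c • Q = scal (MvPolynomial.C c) * Q := by
      intro c Q
      rw [← MvPolynomial.algebraMap_eq, AlgHom.commutes]
      exact Algebra.smul_def c Q
    have hfin : scal (2 * MvPolynomial.C ν * F * 1 - MvPolynomial.C ν * H * (2 * t)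
        + MvPolynomial.C κ * ((2 * (MvPolynomial.C ν + 1) * V) * (r - t ^ 2)
          - (2 * MvPolynomial.C ν + 1) * F)) * P
        + scal (-(2 * MvPolynomial.C ν * H) + MvPolynomial.C κ *
        (2 * (MvPolynomial.C ν + 1) * U * 1 - (MvPolynomial.C ν + 1) * V * (2 * t))) * xop q P
          = 0 := by
      rw [hA, hB, map_zero, zero_mul, zero_mul, add_zero]
    refine (congrArg (muConst (q + 1) (j + 1) s • ·) (Eq.trans ?_ hfin)).trans (smul_zero _)
    simp only [hsm]
    refine (map_combine (scal (N := q + 1)).toRingHom _ _ _ _ _ _ _ _ P (xop q P)).trans ?_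
    refine congrArg₂ (· + ·) (congrArg (fun f => scal f * P) ?_)
      (congrArg (fun f => scal f * xop q P) rfl)
    simp only [map_neg, map_add, map_mul, map_one, map_ofNat]
    ring

theorem restr_eq_self {N k : ℕ} {S : Submodule ℂ (Cl N)} {z : Fin N} {P : Pol N}
    (hP : P ∈ homPoly z.val k S) : restr z P = P := by
  rw [← sub_eq_zero, ← Submodule.mem_bot ℂ]
  refine map_mem_of_homPoly ((restr z).toLinearMap - LinearMap.id) (fun s _ p _ hpd => ?_) hP
  have h := sub_restrScal z p
  rw [pderiv_eq_zero_of_supported hpd (lt_irrefl z.val), map_zero, sub_eq_zero] at h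
  rw [LinearMap.sub_apply, LinearMap.id_apply, AlgHom.toLinearMap_apply, restr_tmul, ← h, sub_self]
  exact Submodule.zero_mem _

theorem restr_xop (P : Pol (q + 1)) : restr (Fin.last q) (xop q P) = xop q (restr (Fin.last q) P) := by
  simp only [xop, vecOp, LinearMap.sum_apply, map_sum, Module.End.mul_apply, gam_apply, mv_apply,
    map_mul, restr_const]
  exact Finset.sum_congr rfl fun i hi => by rw [restr_var (Finset.mem_Iio.1 hi).ne]

theorem restrScal_rSqScal :
    restrScal (Fin.last q) (rSqScal (q + 1))
      = rSqScal (q + 1) - MvPolynomial.X (Fin.last q) ^ 2 := by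
  rw [rSqScal, Fin.sum_univ_castSucc, add_sub_cancel_right, map_add, map_sum]
  simp only [restrScal, map_pow, MvPolynomial.aeval_X, if_pos]
  rw [zero_pow two_ne_zero, add_zero]
  exact Finset.sum_congr rfl fun i _ => by rw [if_neg (Fin.castSucc_lt_last i).ne]

theorem restrScal_gegScal (ν : ℂ) (j : ℕ) :
    restrScal (Fin.last q) (gegScal q ν j)
      = gegenbauerHom ν j 0 (rSqScal (q + 1) - MvPolynomial.X (Fin.last q) ^ 2) := by
  rw [gegScal, map_gegenbauerHom, restrScal_rSqScal, restrScal, MvPolynomial.aeval_X, if_pos rfl]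

theorem xop_pow_even (l : ℕ) (P : Pol (q + 1)) :
    (xop q ^ (2 * l)) P
      = (-1 : ℂ) ^ l • (scal ((rSqScal (q + 1) - MvPolynomial.X (Fin.last q) ^ 2) ^ l) * P) := by
  induction l with
  | zero => simp
  | succ l ih =>
    rw [show 2 * (l + 1) = 2 + 2 * l by ring, pow_add, Module.End.mul_apply, ih, pow_two, Module.End.mul_apply,
      map_smul, map_smul, xop_sq, pow_succ (-1 : ℂ), pow_succ' (rSqScal (q + 1) - _), map_mul, mul_assoc, mul_neg_one]
    exact (smul_neg _ _).trans (neg_smul _ _).symm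

/-- `X^{(j)}_s P` restricts to `(x̲ e_m)^j P` on the hyperplane `x_m = 0`. -/
theorem restr_X_mul (hq : 2 ≤ q) {s : ℕ} {P : Pol (q + 1)}
    (hP : restr (Fin.last q) P = P) (j : ℕ) :
    restr (Fin.last q) (X q j s * P) = (xop q ^ j) P := by
  have hν : ∀ c r : ℕ, ((q + 1 : ℕ) : ℂ) / 2 + s - 1 + c + r ≠ 0 := by
    intro c r h
    have := ladder_denom_ne_zero hq (s + c + r) 0
    apply this
    push_cast at h ⊢
    linear_combination 2 * h
  have h0 : ∀ l, gegCoeff (((q + 1 : ℕ) : ℂ) / 2 + s - 1) (2 * l) l ≠ 0 :=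
    gegCoeff_ne_zero fun r => by simpa using hν 0 r
  have h1 : ∀ l, gegCoeff (((q + 1 : ℕ) : ℂ) / 2 + s) (2 * l) l ≠ 0 :=
    gegCoeff_ne_zero fun r => by simpa using hν 1 r
  rcases j with _ | j
  · rw [X_zero_mul, pow_zero, hP, Module.End.one_apply]
  · rw [X_succ_mul, map_smul, map_add, map_smul, map_mul, map_mul, restr_scal, restr_scal,
      restr_xop, hP, restrScal_gegScal, restrScal_gegScal]
    -- Gegenbauer polynomials of odd degree vanish at 0, so only one summand of X survives on the
    -- hyperplane: the second for an odd upper index, the first for an even one. The constant μ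
    -- normalizes its value, its sign (-1)^l matching x² = -(r² - x_m²).
    rcases Nat.even_or_odd' j with ⟨l, rfl | rfl⟩
    · have hκ : muConst (q + 1) (2 * l + 1) s * (ladderRatio q (2 * l + 1) s *
          gegCoeff (((q + 1 : ℕ) : ℂ) / 2 + s) (2 * l) l) = (-1) ^ l := by
        have h2 := ladder_denom_ne_zero hq s (2 * l + 1)
        have h3 := ladder_denom_ne_zero hq s 0
        rw [Nat.cast_zero, add_zero] at h3
        rw [muConst, if_neg (by simp), ladderRatio, Nat.add_sub_cancel, gegenbauer_even_zero,
          show (2 * l + 1) / 2 = l by omega]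
        have h4 := h1 l
        set w := gegCoeff (((q + 1 : ℕ) : ℂ) / 2 + s) (2 * l) l
        field_simp
      rw [gegenbauerHom_odd_zero, gegenbauerHom_even_zero, map_zero, zero_mul, zero_add, map_smul,
        smul_mul_assoc, smul_smul, smul_smul, mul_assoc, hκ, pow_succ (xop q), Module.End.mul_apply, xop_pow_even]
    · have hκ : muConst (q + 1) (2 * (l + 1)) s *
          gegCoeff (((q + 1 : ℕ) : ℂ) / 2 + s - 1) (2 * (l + 1)) (l + 1) = (-1) ^ (l + 1) := by
        rw [muConst, if_pos (by simp), gegenbauer_even_zero, Nat.mul_div_cancel_left _ two_pos,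
          inv_mul_cancel_right₀ (h0 _)]
      rw [show 2 * l + 1 + 1 = 2 * (l + 1) by ring, gegenbauerHom_odd_zero,
        gegenbauerHom_even_zero, map_zero, zero_mul, smul_zero, add_zero, map_smul,
        smul_mul_assoc, smul_smul, hκ, xop_pow_even]

end Ladder

/-! ### Transport of Gelfand-Tsetlin components along injective intertwining operators -/

section Transport

variable {N d : ℕ}

theorem SoStable.mono {d' : ℕ} (h : d' ≤ d) {W : Submodule ℂ (Pol N)} (hW : SoStable d W) :
    SoStable d' W := fun a b hab hb => hW a b hab (hb.trans_le h)

theorem SoStable.inf {W W' : Submodule ℂ (Pol N)} (hW : SoStable d W) (hW' : SoStable d W') :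
    SoStable d (W ⊓ W') := fun a b hab hb P hP =>
  ⟨hW a b hab hb P hP.1, hW' a b hab hb P hP.2⟩

/-- The linear map `L` commutes with the action of `so(d)`. -/
def Intertwines (d : ℕ) (L : Pol N →ₗ[ℂ] Pol N) : Prop :=
  ∀ a b : Fin N, a < b → b.val < d → ∀ P, rot a b (L P) = L (rot a b P)

variable {L : Pol N →ₗ[ℂ] Pol N} {V U W : Submodule ℂ (Pol N)}

theorem Intertwines.mono {d' : ℕ} (h : d' ≤ d) (hL : Intertwines d L) : Intertwines d' L :=
  fun a b hab hb => hL a b hab (hb.trans_le h)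

theorem SoStable.map (hL : Intertwines d L) (hW : SoStable d W) : SoStable d (W.map L) := by
  rintro a b hab hb _ ⟨P, hP, rfl⟩
  exact ⟨_, hW a b hab hb P hP, (hL a b hab hb P).symm⟩

theorem SoStable.comap (hL : Intertwines d L) (hW : SoStable d W) : SoStable d (W.comap L) := by
  intro a b hab hb P hP
  rw [Submodule.mem_comap, ← hL a b hab hb]
  exact hW a b hab hb _ hP

theorem map_inf_comap_of_le_map (h : W ≤ V.map L) : (V ⊓ W.comap L).map L = W := by
  refine le_antisymm (Submodule.map_le_iff_le_comap.2 inf_le_right) fun w hw => ?_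
  obtain ⟨v, hv, rfl⟩ := h hw
  exact ⟨v, ⟨hv, hw⟩, rfl⟩

theorem le_of_map_le_map (hinj : ∀ P ∈ V, L P = 0 → P = 0) (hU : U ≤ V) (hW : W ≤ V)
    (h : U.map L ≤ W.map L) : U ≤ W := by
  intro u hu
  obtain ⟨w, hw, hwu⟩ := h (Submodule.mem_map_of_mem hu)
  have := hinj _ (V.sub_mem (hU hu) (hW hw)) (by rw [map_sub, hwu, sub_self])
  rwa [sub_eq_zero.1 this]

theorem eq_of_map_eq_map (hinj : ∀ P ∈ V, L P = 0 → P = 0) (hU : U ≤ V) (hW : W ≤ V)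
    (h : U.map L = W.map L) : U = W :=
  (le_of_map_le_map hinj hU hW h.le).antisymm (le_of_map_le_map hinj hW hU h.ge)

theorem soIrreducible_map_iff (hL : Intertwines d L) (hinj : ∀ P ∈ U, L P = 0 → P = 0)
    (hst : SoStable d U) : SoIrreducible d (U.map L) ↔ SoIrreducible d U := by
  have hbot : ∀ T ≤ U, T.map L = ⊥ → T = ⊥ := fun T hT h =>
    eq_of_map_eq_map hinj hT bot_le (h.trans (Submodule.map_bot L).symm)
  constructor
  · refine fun h => ⟨hst, fun h0 => h.ne_bot (by rw [h0, Submodule.map_bot]), fun T hT hTst => ?_⟩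
    refine (h.eq_bot_or_eq _ (Submodule.map_mono hT) (hTst.map hL)).imp (hbot T hT) fun h' => ?_
    exact eq_of_map_eq_map hinj hT le_rfl h'
  · refine fun h => ⟨hst.map hL, fun h0 => h.ne_bot (hbot U le_rfl h0), fun T hT hTst => ?_⟩
    have hT' := map_inf_comap_of_le_map hT
    rw [← hT']
    refine (h.eq_bot_or_eq _ inf_le_left (hst.inf (hTst.comap hL))).imp (fun h' => ?_) fun h' => ?_
    · rw [h', Submodule.map_bot]
    · rw [h']

theorem GTComponent.le (h : GTComponent d V W) : W ≤ V := by
  induction h with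
  | base => exact le_rfl
  | step hUV _ _ ih => exact ih.trans hUV

/-- The condition d ≠ 1 excludes the base of the chain, which sits at so(2). -/
theorem GTComponent.exists_step (h : GTComponent (d + 1) V W) (hd : d ≠ 1) :
    ∃ U ≤ V, SoIrreducible d U ∧ GTComponent d U W := by
  generalize hd' : d + 1 = d' at h
  cases h with
  | base => omega
  | @step d₁ _ U _ hUV hU hW =>
    obtain rfl : d = d₁ := Nat.succ_injective hd'
    exact ⟨U, hUV, hU, hW⟩

theorem GTComponent.map (h : GTComponent d V W) (hL : Intertwines d L)
    (hinj : ∀ P ∈ V, L P = 0 → P = 0) : GTComponent d (V.map L) (W.map L) := by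
  induction h with
  | base V => exact GTComponent.base _
  | step hUV hU _ ih =>
    have hL' := hL.mono (Nat.le_succ _)
    have hinj' := fun P hP => hinj P (hUV hP)
    exact GTComponent.step (Submodule.map_mono hUV)
      ((soIrreducible_map_iff hL' hinj' hU.stable).2 hU) (ih hL' hinj')

/-- A chain below L(V) lifts step by step: V ⊓ L⁻¹(U₁) is mapped onto U₁, and irreducibility passes
back through the injective intertwiner. -/
theorem GTComponent.exists_of_map (hV : SoStable d V) (h : GTComponent d (V.map L) W)
    (hL : Intertwines d L) (hinj : ∀ P ∈ V, L P = 0 → P = 0) :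
    ∃ W', GTComponent d V W' ∧ W = W'.map L := by
  generalize hV' : V.map L = V' at h
  induction h generalizing V with
  | base => exact ⟨V, GTComponent.base _, hV'.symm⟩
  | @step d V₁ U₁ W₁ hUV hU _ ih =>
    subst hV'
    have hL' := hL.mono (Nat.le_succ _)
    have hU' := map_inf_comap_of_le_map hUV
    have hst : SoStable d (V ⊓ U₁.comap L) :=
      (hV.mono (Nat.le_succ _)).inf (hU.stable.comap hL')
    have hinj' : ∀ P ∈ V ⊓ U₁.comap L, L P = 0 → P = 0 := fun P hP => hinj P hP.1
    obtain ⟨W', hW', rfl⟩ := ih hst hL' hinj' hU'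
    rw [← hU', soIrreducible_map_iff hL' hinj' hst] at hU
    exact ⟨W', GTComponent.step inf_le_left hU hW', rfl⟩

end Transport

/-! ### The rotation action on monogenics -/

section Stability

variable {N : ℕ} {S : Submodule ℂ (Cl N)} {z : Fin N}

theorem rot_mem_homPoly {d k : ℕ} {a b : Fin N} (ha : a.val < d) (hb : b.val < d)
    (hS : ∀ u ∈ S, e a * e b * u ∈ S) {P : Pol N} (hP : P ∈ homPoly d k S) :
    rot a b P ∈ homPoly d k S := by
  have h : ∀ i j : Fin N, i.val < d → var i * pd j P ∈ homPoly d k S := by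
    intro i j hi
    rcases k with _ | k
    · rw [pd_homPoly_zero j hP, mul_zero]
      exact Submodule.zero_mem _
    · exact var_mul_mem_homPoly hi (pd_mem_homPoly j hP)
  exact Submodule.sub_mem _ (Submodule.add_mem _ (Submodule.smul_mem _ _
    (const_mul_mem_homPoly hS hP)) (h b a hb)) (h a b ha)

theorem rot_diracOp {a b : Fin N} (ha : a < z) (hb : b < z) (P : Pol N) :
    rot a b (diracOp (Finset.Iio z) (gam z) pd P)
      = diracOp (Finset.Iio z) (gam z) pd (rot a b P) := by
  have := ((cliffordWeyl z).rot_dirac (Finset.mem_Iio.2 ha) (Finset.mem_Iio.2 hb)).eq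
  rw [← rot_eq_rotOp hb.ne] at this
  exact congrArg (fun T : Module.End ℂ (Pol N) => T P) this

theorem rot_pd {a b : Fin N} (ha : a < z) (hb : b < z) (P : Pol N) :
    rot a b (pd z P) = pd z (rot a b P) := by
  simp only [rot, LinearMap.sub_apply, LinearMap.add_apply, LinearMap.smul_apply,
    LinearMap.mulLeft_apply, LinearMap.comp_apply, map_sub, map_add, map_smul, pd_const_mul,
    pd_var_mul, if_neg ha.ne', if_neg hb.ne', add_zero, pd_comm z]

theorem soStable_monogenics (hS : ∀ a b : Fin N, a < z → b < z → ∀ u ∈ S, e a * e b * u ∈ S)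
    (k : ℕ) : SoStable z.val (monogenics z.val k S) := by
  intro a b hab hb P hP
  have ha : a < z := hab.trans hb
  rw [monogenics_eq_monPart] at hP ⊢
  refine ⟨rot_mem_homPoly ha hb (hS a b ha hb) hP.1, ?_⟩
  have hD : diracOp (Finset.Iio z) (gam z) pd P = 0 := hP.2
  change diracOp (Finset.Iio z) (gam z) pd _ = 0
  rw [← rot_diracOp ha hb, hD, map_zero]

theorem soStable_monogenics_succ
    (hS : ∀ a b : Fin N, a < z → b < z → ∀ u ∈ S, e a * e b * u ∈ S) (k : ℕ) :
    SoStable z.val (monogenics (z.val + 1) k S) := by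
  intro a b hab hb P hP
  have ha : a < z := hab.trans hb
  refine ⟨rot_mem_homPoly (Nat.lt_succ_of_lt ha) (Nat.lt_succ_of_lt hb) (hS a b ha hb) hP.1, ?_⟩
  have hD : dirac (z.val + 1) P = 0 := hP.2
  refine (dirac_succ_eq_zero_iff z _).2 ?_
  rw [← rot_pd ha hb, (dirac_succ_eq_zero_iff z P).1 hD, map_neg, rot_diracOp ha hb]

/-- Needed for the existence of orthogonal projections. -/
theorem finiteDimensional_homPoly (d k : ℕ) (S : Submodule ℂ (Cl N)) :
    FiniteDimensional ℂ (homPoly d k S) := by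
  have hE : Module.Finite ℂ (ExteriorAlgebra ℂ (Fin N → ℂ)) :=
    Module.Finite.of_basis (Module.Basis.ExteriorAlgebra (Pi.basisFun ℂ (Fin N)))
  have hCl : Module.Finite ℂ (Cl N) :=
    Module.Finite.equiv (CliffordAlgebra.equivExterior (negSq N)).symm
  have hfg := Submodule.FG.map₂ (TensorProduct.mk ℂ (Cl N) (MvPolynomial (Fin N) ℂ))
    hCl.fg_top (MvPolynomial.homogeneousSubmodule_fg (σ := Fin N) (R := ℂ) k)
  have := Module.Finite.iff_fg.2 hfg
  refine Submodule.finiteDimensional_of_le (Submodule.span_le.2 ?_) (S₂ := Submodule.map₂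
    (TensorProduct.mk ℂ (Cl N) (MvPolynomial (Fin N) ℂ)) ⊤
      (MvPolynomial.homogeneousSubmodule (Fin N) ℂ k))
  rintro _ ⟨s, -, p, hp, -, rfl⟩
  exact Submodule.apply_mem_map₂ _ Submodule.mem_top hp

end Stability

/-! ### Branching of monogenics from dimension `q + 1` to dimension `q` -/

section Branching

variable {q : ℕ} {S : Submodule ℂ (Cl (q + 1))}

/-- The Casimir operator of the rotations of the first `q` coordinates. -/
abbrev casop (q : ℕ) : Module.End ℂ (Pol (q + 1)) :=
  casimirOp (Finset.Iio (Fin.last q)) (gam (Fin.last q)) mv pd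

/-- Left multiplication by `X^{(j)}_s`. -/
abbrev ladder (q j s : ℕ) : Pol (q + 1) →ₗ[ℂ] Pol (q + 1) := LinearMap.mulLeft ℂ (X q j s)

theorem intertwines_ladder (j s : ℕ) : Intertwines q (ladder q j s) := fun _ _ hab hb P =>
  rot_X_mul j s (hab.trans (show _ < Fin.last q from hb)) hb P

theorem casop_X_mul (j s : ℕ) (P : Pol (q + 1)) :
    casop q (X q j s * P) = X q j s * casop q P := by
  simp only [casop, casimirOp, LinearMap.sum_apply, Module.End.mul_apply, Finset.mul_sum]
  refine Finset.sum_congr rfl fun a ha => Finset.sum_congr rfl fun b hb => ?_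
  have ha' := Finset.mem_Iio.1 ha
  have hb' := Finset.mem_Iio.1 hb
  rw [← rot_eq_rotOp hb'.ne, rot_X_mul j s ha' hb', rot_X_mul j s ha' hb']

variable (hS : ∀ a < Fin.last q, ∀ u ∈ S, e a * e (Fin.last q) * u ∈ S)

include hS

theorem casop_X_mul_monogenic {s : ℕ} {P : Pol (q + 1)} (hP : P ∈ monogenics q s S) (j : ℕ) :
    casop q (X q j s * P) = casimirValue q s • (X q j s * P) := by
  have hPm : P ∈ monPart (Finset.Iio (Fin.last q)) (gam (Fin.last q)) pd
      (fun k => homPoly (Fin.last q).val k S) s := by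
    rw [← monogenics_eq_monPart]; exact hP
  have := (cliffordGraded hS).casimir_monogenic (cliffordWeyl _) hPm
  rw [Fin.card_Iio, Fin.val_last] at this
  rw [casop_X_mul, casop, this, mul_smul_comm]

/-- On x_m = 0 the product restricts to x^j P, and x^j is injective on monogenics. -/
theorem eq_zero_of_X_mul_eq_zero (hq : 2 ≤ q) {s : ℕ} {P : Pol (q + 1)}
    (hP : P ∈ monogenics q s S) {j : ℕ} (h0 : X q j s * P = 0) : P = 0 := by
  have hPm : P ∈ monPart (Finset.Iio (Fin.last q)) (gam (Fin.last q)) pd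
      (fun k => homPoly (Fin.last q).val k S) s := by
    rw [← monogenics_eq_monPart]; exact hP
  refine (cliffordGraded hS).vec_pow_injective (cliffordWeyl _) ?_ hPm j ?_
  · rw [Fin.card_Iio, Fin.val_last]; omega
  · rw [← restr_X_mul (s := s) hq (restr_eq_self (z := Fin.last q) hP.1) j, h0, map_zero]

theorem X_mul_mem_monogenics_sub (hq : 2 ≤ q) {j k : ℕ} (hj : j ≤ k) {P : Pol (q + 1)}
    (hP : P ∈ monogenics q (k - j) S) : X q j (k - j) * P ∈ monogenics (q + 1) k S := by
  have := X_mul_mem_monogenics hq hS hP j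
  rwa [Nat.sub_add_cancel hj] at this

/-- Every monogenic polynomial in dimension `q + 1` is a sum of products `X^{(j)} p`. -/
theorem exists_eq_sum_X_mul (hq : 2 ≤ q) {k : ℕ} {P : Pol (q + 1)}
    (hP : P ∈ monogenics (q + 1) k S) :
    ∃ f : ℕ → Pol (q + 1), (∀ j ≤ k, f j ∈ monogenics q (k - j) S) ∧
      P = ∑ j ∈ Finset.range (k + 1), X q j (k - j) * f j := by
  obtain ⟨f, hf, hsum⟩ := (cliffordGraded hS).fischer (cliffordWeyl _)
    (by rw [Fin.card_Iio, Fin.val_last]; omega) k (restr_mem_homPoly (z := Fin.last q) hP.1)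
  have hf' : ∀ j ≤ k, f j ∈ monogenics q (k - j) S := fun j hj => by
    have := hf j hj
    rwa [← monogenics_eq_monPart] at this
  refine ⟨f, hf', ?_⟩
  rw [← sub_eq_zero]
  -- P and the sum of the X^{(j)} f_j are monogenic with the same restriction, where the f_j are the
  -- Fischer components of that restriction.
  refine eq_zero_of_restr_eq_zero (z := Fin.last q) (k := k) (S := S)
    (Submodule.sub_mem _ hP (Submodule.sum_mem _ fun j hj => ?_)) ?_
  · have hj' : j ≤ k := by have := Finset.mem_range.1 hj; omega
    exact X_mul_mem_monogenics_sub hS hq hj' (hf' j hj')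
  · rw [map_sub, map_sum, sub_eq_zero, hsum]
    refine Finset.sum_congr rfl fun j hj => ?_
    have hj' : j ≤ k := by have := Finset.mem_range.1 hj; omega
    exact (restr_X_mul hq (restr_eq_self (z := Fin.last q) (hf' j hj').1) j).symm

/-- A rotation stable space of monogenics contains the components of its elements. -/
theorem X_mul_mem_of_sum_mem (hq : 0 < q) {k : ℕ} {U : Submodule ℂ (Pol (q + 1))}
    (hU : SoStable q U) {f : ℕ → Pol (q + 1)} (hf : ∀ j ≤ k, f j ∈ monogenics q (k - j) S)
    (hsum : ∑ j ∈ Finset.range (k + 1), X q j (k - j) * f j ∈ U) :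
    ∀ j ≤ k, X q j (k - j) * f j ∈ U := by
  have hrot : RotStable _ (gam (Fin.last q)) mv pd U :=
    rotStable_of_soStable (z := Fin.last q) le_rfl hU
  have := mem_of_sum_mem_of_eigen (casop q) U (fun w hw => hrot.casimir_mem hw)
    (fun j => casimirValue q (k - j)) (Finset.range (k + 1))
    (fun x hx y hy hxy => by
      have := casimirValue_injective hq hxy
      have := Finset.mem_range.1 hx
      have := Finset.mem_range.1 hy
      omega)
    (fun j => X q j (k - j) * f j)
    (fun j hj => casop_X_mul_monogenic hS
      (hf j (by have := Finset.mem_range.1 hj; omega)) j) hsum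
  exact fun j hj => this j (Finset.mem_range.2 (by omega))

end Branching

/-! ### Irreducible submodules of the space of monogenics in dimension `2n + 1` -/

section Irreducible

variable {n : ℕ} {S : Submodule ℂ (Cl (2 * n + 1))}

theorem sign_eq_of_mem {d l : ℕ} {ε ε' : ℂ} {P : Pol (2 * n + 1)} (hP0 : P ≠ 0)
    (h1 : P ∈ monogenics d l (thetaPart S ε)) (h2 : P ∈ monogenics d l (thetaPart S ε')) :
    ε = ε' :=
  smul_left_injective ℂ hP0
    ((const_theta_mul_of_mem h1.1).symm.trans (const_theta_mul_of_mem h2.1))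

theorem SpinStable.soStable (hS : SpinStable S) (l : ℕ) :
    SoStable (2 * n) (monogenics (2 * n) l S) :=
  soStable_monogenics (z := Fin.last (2 * n)) (fun a b _ _ _ hu => hS.ee_mem a b hu) l

theorem SpinStable.soStable_thetaPart (hS : SpinStable S) (l : ℕ) (ε : ℂ) :
    SoStable (2 * n) (monogenics (2 * n) l (thetaPart S ε)) :=
  soStable_monogenics (z := Fin.last (2 * n))
    (fun _ _ ha hb _ hu => ee_mul_mem_thetaPart hS ha hb hu) l

/-- A nonzero submodule contains a nonzero M_l(R^{2n},S^{ε'}), and θ acts on its elements both by ε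
and by ε'. -/
theorem IsBasicSpinor.soIrreducible (hn : 1 ≤ n) (hS : IsBasicSpinor S) {l : ℕ} {ε : ℂ}
    (h0 : monogenics (2 * n) l (thetaPart S ε) ≠ ⊥) :
    SoIrreducible (2 * n) (monogenics (2 * n) l (thetaPart S ε)) := by
  refine ⟨hS.stable.soStable_thetaPart l ε, h0, fun T hT hst => or_iff_not_imp_left.2 fun hT0 => ?_⟩
  obtain ⟨ε', -, hle, hne⟩ := hS.exists_thetaPart_le hn
    (hT.trans (monogenics_mono (thetaPart_le ε))) hst hT0
  obtain ⟨P, hP, hP0⟩ := Submodule.exists_mem_ne_zero_of_ne_bot hne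
  obtain rfl := sign_eq_of_mem hP0 hP (hT (hle hP))
  exact hT.antisymm hle

theorem SpinStable.e_last_mul_mem (hS : SpinStable S) :
    ∀ a < Fin.last (2 * n), ∀ u ∈ S, e a * e (Fin.last (2 * n)) * u ∈ S :=
  fun a _ _ hu => hS.ee_mem a _ hu

theorem SpinStable.ladder_injective (hn : 1 ≤ n) (hS : SpinStable S) (j : ℕ) {s : ℕ} (ε : ℂ) :
    ∀ P ∈ monogenics (2 * n) s (thetaPart S ε), ladder (2 * n) j s P = 0 → P = 0 :=
  fun _ hP h => eq_zero_of_X_mul_eq_zero hS.e_last_mul_mem (by omega)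
    (monogenics_mono (thetaPart_le ε) hP) h

theorem IsBasicSpinor.soIrreducible_ladder (hn : 1 ≤ n) (hS : IsBasicSpinor S) (j : ℕ) {s : ℕ}
    {ε : ℂ} (h0 : monogenics (2 * n) s (thetaPart S ε) ≠ ⊥) :
    SoIrreducible (2 * n) ((monogenics (2 * n) s (thetaPart S ε)).map (ladder (2 * n) j s)) :=
  (soIrreducible_map_iff (intertwines_ladder j s) (hS.stable.ladder_injective hn j ε)
    (hS.stable.soStable_thetaPart s ε)).2 (hS.soIrreducible hn h0)

/-- The branching rule. U contains a nonzero X^{(j)} f_j, so the preimage of U under multiplication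
by X^{(j)} contains a nonzero M_{k-j}(R^{2n},S^ε); its image is a nonzero submodule of the
irreducible U, hence all of U. -/
theorem IsBasicSpinor.exists_eq_map_ladder (hn : 1 ≤ n) (hS : IsBasicSpinor S) {k : ℕ}
    {U : Submodule ℂ (Pol (2 * n + 1))} (hU : U ≤ monogenics (2 * n + 1) k S)
    (hirr : SoIrreducible (2 * n) U) :
    ∃ j ≤ k, ∃ ε : ℂ, (ε = 1 ∨ ε = -1) ∧
      U = (monogenics (2 * n) (k - j) (thetaPart S ε)).map (ladder (2 * n) j (k - j)) := by
  have hSl := hS.stable.e_last_mul_mem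
  obtain ⟨v, hv, hv0⟩ := Submodule.exists_mem_ne_zero_of_ne_bot hirr.ne_bot
  obtain ⟨f, hf, rfl⟩ := exists_eq_sum_X_mul hSl (by omega) (hU hv)
  have hall := X_mul_mem_of_sum_mem hSl (by omega) hirr.stable hf hv
  obtain ⟨j, hj, hj0⟩ := Finset.exists_ne_zero_of_sum_ne_zero hv0
  have hjk : j ≤ k := by have := Finset.mem_range.1 hj; omega
  have hT0 : monogenics (2 * n) (k - j) S ⊓ U.comap (ladder (2 * n) j (k - j)) ≠ ⊥ := by
    intro h
    have : f j ∈ monogenics (2 * n) (k - j) S ⊓ U.comap (ladder (2 * n) j (k - j)) :=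
      ⟨hf j hjk, hall j hjk⟩
    rw [h, Submodule.mem_bot] at this
    exact hj0 (by rw [this, mul_zero])
  obtain ⟨ε, hε, hle, hne⟩ := hS.exists_thetaPart_le hn inf_le_left
    ((hS.stable.soStable _).inf (hirr.stable.comap (intertwines_ladder j (k - j)))) hT0
  have hirr' := hS.soIrreducible_ladder hn j hne
  refine ⟨j, hjk, ε, hε, ?_⟩
  refine ((hirr.eq_bot_or_eq _ ?_ hirr'.stable).resolve_left hirr'.ne_bot).symm
  exact Submodule.map_le_iff_le_comap.2 (hle.trans inf_le_right)

/-- The index `(j, ε)` of a nonzero element of one of the components is unique. -/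
theorem SpinStable.ladder_index_unique (hn : 1 ≤ n) (hS : SpinStable S) {k j j' : ℕ} {ε ε' : ℂ}
    (hj : j ≤ k) (hj' : j' ≤ k) {P P' : Pol (2 * n + 1)} (hP0 : P ≠ 0)
    (hP : P ∈ monogenics (2 * n) (k - j) (thetaPart S ε))
    (hP' : P' ∈ monogenics (2 * n) (k - j') (thetaPart S ε'))
    (h : X (2 * n) j (k - j) * P = X (2 * n) j' (k - j') * P') : j = j' ∧ ε = ε' := by
  have hSl := hS.e_last_mul_mem
  have hPS := monogenics_mono (thetaPart_le ε) hP
  have hPS' := monogenics_mono (thetaPart_le ε') hP'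
  have h0 : X (2 * n) j (k - j) * P ≠ 0 := fun h0 =>
    hP0 (eq_zero_of_X_mul_eq_zero hSl (by omega) hPS h0)
  have h1 := casop_X_mul_monogenic hSl hPS j
  have h2 := casop_X_mul_monogenic hSl hPS' j'
  rw [← h, h1] at h2
  -- The Casimir eigenvalue determines j; injectivity then gives P = P', and the action of θ
  -- determines ε.
  have h3 := casimirValue_injective (by omega) (smul_left_injective ℂ h0 h2)
  obtain rfl : j = j' := by omega
  have h4 := eq_zero_of_X_mul_eq_zero hSl (by omega) (Submodule.sub_mem _ hPS hPS')
    (show X (2 * n) j (k - j) * (P - P') = 0 by rw [mul_sub, h, sub_self])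
  rw [← sub_eq_zero.1 h4] at hP'
  exact ⟨rfl, sign_eq_of_mem hP0 hP hP'⟩

end Irreducible

/-! ### Inner products given by a core -/

section Core

variable {E F κ : Type*} [AddCommGroup E] [Module ℂ E] [AddCommGroup F] [Module ℂ F]
  (c : InnerProductSpace.Core ℂ E)

theorem core_inner_add_right (x y w : E) : c.inner x (y + w) = c.inner x y + c.inner x w := by
  let := c.toNormedAddCommGroup
  let := InnerProductSpace.ofCore c.toCore
  exact inner_add_right x y w

theorem core_inner_smul_right (a : ℂ) (x y : E) : c.inner x (a • y) = a * c.inner x y := by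
  let := c.toNormedAddCommGroup
  let := InnerProductSpace.ofCore c.toCore
  exact inner_smul_right x y a

theorem core_sum_inner (s : Finset κ) (f : κ → E) (x : E) :
    c.inner (∑ i ∈ s, f i) x = ∑ i ∈ s, c.inner (f i) x := by
  let := c.toNormedAddCommGroup
  let := InnerProductSpace.ofCore c.toCore
  exact sum_inner s f x

theorem core_inner_sum (s : Finset κ) (f : κ → E) (x : E) :
    c.inner x (∑ i ∈ s, f i) = ∑ i ∈ s, c.inner x (f i) := by
  let := c.toNormedAddCommGroup
  let := InnerProductSpace.ofCore c.toCore
  exact inner_sum s f x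

theorem core_inner_zero_right (x : E) : c.inner x 0 = 0 := by
  let := c.toNormedAddCommGroup
  let := InnerProductSpace.ofCore c.toCore
  exact inner_zero_right x

/-- The orthogonal complement with respect to the inner product given by a core. -/
def coreOrthogonal (A : Submodule ℂ E) : Submodule ℂ E where
  carrier := {w | ∀ b ∈ A, c.inner b w = 0}
  zero_mem' b _ := core_inner_zero_right c b
  add_mem' hx hy b hb := by rw [core_inner_add_right, hx b hb, hy b hb, add_zero]
  smul_mem' a _ hx b hb := by rw [core_inner_smul_right, hx b hb, mul_zero]

theorem exists_sub_mem_coreOrthogonal [FiniteDimensional ℂ E] (A : Submodule ℂ E) (v : E) :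
    ∃ a ∈ A, v - a ∈ coreOrthogonal c A := by
  let := c.toNormedAddCommGroup
  let := InnerProductSpace.ofCore c.toCore
  obtain ⟨y, hy, w, hw, h⟩ := A.exists_add_mem_mem_orthogonal v
  refine ⟨y, hy, fun b hb => ?_⟩
  rw [h, add_sub_cancel_left]
  exact (A.mem_orthogonal w).1 hw b hb

/-- The inner product pulled back along an injective linear map. -/
abbrev pullbackCore (ψ : F →ₗ[ℂ] E) (hψ : Function.Injective ψ) : InnerProductSpace.Core ℂ F where
  inner x y := c.inner (ψ x) (ψ y)
  conj_inner_symm x y := c.conj_inner_symm (ψ x) (ψ y)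
  re_inner_nonneg x := c.re_inner_nonneg (ψ x)
  add_left x y w := by simp only [map_add, c.add_left]
  smul_left x y r := by simp only [map_smul, c.smul_left]
  definite x hx := hψ (by rw [c.definite (ψ x) hx, map_zero])

/-- Eigenvectors of a symmetric operator with distinct eigenvalues are orthogonal. -/
theorem core_inner_eq_zero_of_eigen {α β : ℂ} (hα : (starRingEnd ℂ) α = α) (hαβ : α ≠ β) {u v : E}
    (h : c.inner (α • u) v = c.inner u (β • v)) : c.inner u v = 0 := by
  rw [c.smul_left, core_inner_smul_right, hα, ← sub_eq_zero, ← sub_mul] at h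
  exact (mul_eq_zero.1 h).resolve_left (sub_ne_zero.2 hαβ)

end Core

/-! ### Invariant inner products -/

section Invariant

variable {N : ℕ} {V : Submodule ℂ (Pol N)} {c : InnerProductSpace.Core ℂ V}

theorem InvariantInner.mono {d d' : ℕ} (h : d' ≤ d) (hc : InvariantInner d V c) :
    InvariantInner d' V c := fun a b hab hb => hc a b hab (hb.trans_le h)

/-- The Casimir operator is symmetric with respect to an invariant inner product. -/
theorem InvariantInner.casimir {z : Fin N} (hc : InvariantInner z.val V c)
    (hV : SoStable z.val V) {u v u' v' : V}
    (hu : (u' : Pol N) = casimirOp (Finset.Iio z) (gam z) mv pd u)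
    (hv : (v' : Pol N) = casimirOp (Finset.Iio z) (gam z) mv pd v) :
    c.inner u' v = c.inner u v' := by
  have hrot := rotStable_of_soStable le_rfl hV
  have hsq : ∀ a b : Fin N, a ∈ Finset.Iio z → b ∈ Finset.Iio z → ∀ w : V,
      ∃ w₁ w₂ : V, (w₁ : Pol N) = rotOp (gam z) mv pd a b w ∧
        (w₂ : Pol N) = rotOp (gam z) mv pd a b w₁ := fun a b ha hb w =>
    ⟨⟨_, hrot a ha b hb _ w.2⟩, ⟨_, hrot a ha b hb _ (hrot a ha b hb _ w.2)⟩, rfl, rfl⟩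
  have hskew : ∀ a b : Fin N, a ∈ Finset.Iio z → b ∈ Finset.Iio z → ∀ x y x' y' : V,
      (x' : Pol N) = rotOp (gam z) mv pd a b (rotOp (gam z) mv pd a b x) →
      (y' : Pol N) = rotOp (gam z) mv pd a b (rotOp (gam z) mv pd a b y) →
      c.inner x' y = c.inner x y' := by
    have hlt : ∀ a b : Fin N, a ∈ Finset.Iio z → b ∈ Finset.Iio z → a < b → ∀ x y x' y' : V,
        (x' : Pol N) = rotOp (gam z) mv pd a b (rotOp (gam z) mv pd a b x) →
        (y' : Pol N) = rotOp (gam z) mv pd a b (rotOp (gam z) mv pd a b y) →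
        c.inner x' y = c.inner x y' := by
      intro a b ha hb hab x y x' y' hx hy
      have hbz := Finset.mem_Iio.1 hb
      obtain ⟨x₁, x₂, hx₁, hx₂⟩ := hsq a b ha hb x
      obtain ⟨y₁, y₂, hy₁, hy₂⟩ := hsq a b ha hb y
      obtain rfl : x' = x₂ := Subtype.ext (by rw [hx, hx₂, hx₁])
      obtain rfl : y' = y₂ := Subtype.ext (by rw [hy, hy₂, hy₁])
      rw [← rot_eq_rotOp hbz.ne] at hx₁ hx₂ hy₁ hy₂
      have h1 := hc a b hab hbz x₁ y x' y₁ hx₂ hy₁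
      have h2 := hc a b hab hbz x y₁ x₁ y' hx₁ hy₂
      exact (eq_neg_of_add_eq_zero_left h1).trans (eq_neg_of_add_eq_zero_right h2).symm
    intro a b ha hb x y x' y' hx hy
    rcases lt_trichotomy a b with h | rfl | h
    · exact hlt a b ha hb h x y x' y' hx hy
    -- The diagonal terms are not skew-adjoint, but their squares are the real scalar 1/4.
    · rw [(cliffordWeyl z).rot_self ha] at hx hy
      have h4 : ∀ w w' : V, (w' : Pol N) = (-(1 / 2 : ℂ) • (1 : Module.End ℂ (Pol N)))
          ((-(1 / 2 : ℂ) • (1 : Module.End ℂ (Pol N))) (w : Pol N)) → w' = (1 / 4 : ℂ) • w := by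
        intro w w' h
        refine Subtype.ext (h.trans ?_)
        rw [LinearMap.smul_apply, LinearMap.smul_apply, Module.End.one_apply, Module.End.one_apply,
          smul_smul, Submodule.coe_smul]
        norm_num
      rw [h4 x x' hx, h4 y y' hy, c.smul_left, core_inner_smul_right c,
        show (1 / 4 : ℂ) = ((1 / 4 : ℝ) : ℂ) by norm_num, Complex.conj_ofReal]
    · rw [(cliffordWeyl z).rot_swap hb ha h.ne] at hx hy
      simp only [LinearMap.neg_apply, map_neg, neg_neg] at hx hy
      exact hlt b a hb ha h x y x' y' hx hy
  have hex : ∀ w : V, ∃ F : Fin N → Fin N → V, ∀ a ∈ Finset.Iio z, ∀ b ∈ Finset.Iio z,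
      (F a b : Pol N) = rotOp (gam z) mv pd a b (rotOp (gam z) mv pd a b w) := by
    intro w
    have : ∀ a b : Fin N, ∃ y : V, a ∈ Finset.Iio z → b ∈ Finset.Iio z →
        (y : Pol N) = rotOp (gam z) mv pd a b (rotOp (gam z) mv pd a b w) := by
      intro a b
      by_cases h : a ∈ Finset.Iio z ∧ b ∈ Finset.Iio z
      · exact ⟨⟨_, hrot a h.1 b h.2 _ (hrot a h.1 b h.2 _ w.2)⟩, fun _ _ => rfl⟩
      · exact ⟨0, fun ha hb => absurd ⟨ha, hb⟩ h⟩
    choose F hF using this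
    exact ⟨F, fun a ha b hb => hF a b ha hb⟩
  have hsum : ∀ (w w' : V) (F : Fin N → Fin N → V),
      (∀ a ∈ Finset.Iio z, ∀ b ∈ Finset.Iio z,
        (F a b : Pol N) = rotOp (gam z) mv pd a b (rotOp (gam z) mv pd a b w)) →
      (w' : Pol N) = casimirOp (Finset.Iio z) (gam z) mv pd w →
      w' = ∑ a ∈ Finset.Iio z, ∑ b ∈ Finset.Iio z, F a b := by
    intro w w' F hF hw
    refine Subtype.ext (hw.trans ?_)
    simp only [casimirOp, LinearMap.sum_apply, Module.End.mul_apply, Submodule.coe_sum]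
    exact Finset.sum_congr rfl fun a ha => Finset.sum_congr rfl fun b hb => (hF a ha b hb).symm
  obtain ⟨F, hF⟩ := hex u
  obtain ⟨G, hG⟩ := hex v
  rw [hsum u u' F hF hu, hsum v v' G hG hv, core_sum_inner c, core_inner_sum c]
  refine Finset.sum_congr rfl fun a ha => ?_
  rw [core_sum_inner c, core_inner_sum c]
  exact Finset.sum_congr rfl fun b hb => hskew a b ha hb u v _ _ (hF a ha b hb) (hG a ha b hb)

/-- The orthogonal complement of an invariant subspace is invariant. -/
theorem InvariantInner.soStable_orthogonal {d : ℕ} (hc : InvariantInner d V c)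
    (hV : SoStable d V) {A : Submodule ℂ (Pol N)} (hA : SoStable d A) :
    SoStable d ((coreOrthogonal c (A.comap V.subtype)).map V.subtype) := by
  rintro a b hab hb _ ⟨w, hw, rfl⟩
  refine ⟨⟨_, hV a b hab hb _ w.2⟩, fun x hx => ?_, rfl⟩
  have h1 := hc a b hab hb x w ⟨_, hV a b hab hb _ x.2⟩ ⟨_, hV a b hab hb _ w.2⟩ rfl rfl
  rw [hw _ (hA a b hab hb _ hx), zero_add] at h1
  exact h1

end Invariant

/-! ### The Gelfand-Tsetlin basis in dimension `2n + 1` -/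

section Basis

variable {n : ℕ} {S : Submodule ℂ (Cl (2 * n + 1))}

theorem IsGTBasis.subset {N d : ℕ} {V : Submodule ℂ (Pol N)} {E : Set (Pol N)}
    (hE : IsGTBasis d V E) : E ⊆ V := hE.span_eq ▸ Submodule.subset_span

theorem SpinStable.X_mul_mem (hn : 1 ≤ n) (hS : SpinStable S) {j k : ℕ} (hj : j ≤ k) {ε : ℂ}
    {P : Pol (2 * n + 1)} (hP : P ∈ monogenics (2 * n) (k - j) (thetaPart S ε)) :
    X (2 * n) j (k - j) * P ∈ monogenics (2 * n + 1) k S :=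
  X_mul_mem_monogenics_sub hS.e_last_mul_mem (by omega) hj (monogenics_mono (thetaPart_le ε) hP)

theorem SpinStable.soStable_succ (hS : SpinStable S) (k : ℕ) :
    SoStable (2 * n) (monogenics (2 * n + 1) k S) :=
  soStable_monogenics_succ (z := Fin.last (2 * n)) (fun a b _ _ _ hu => hS.ee_mem a b hu) k

/-- Components of different degrees are orthogonal. -/
theorem SpinStable.inner_eq_zero_of_ne (hn : 1 ≤ n) (hS : SpinStable S) {k : ℕ}
    {c : InnerProductSpace.Core ℂ (monogenics (2 * n + 1) k S)}
    (hc : InvariantInner (2 * n) (monogenics (2 * n + 1) k S) c)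
    {j j' : ℕ} (hj : j ≤ k) (hj' : j' ≤ k) (hne : j ≠ j')
    {P P' : Pol (2 * n + 1)} (hP : P ∈ monogenics (2 * n) (k - j) S)
    (hP' : P' ∈ monogenics (2 * n) (k - j') S) {u v : monogenics (2 * n + 1) k S}
    (hu : (u : Pol (2 * n + 1)) = X (2 * n) j (k - j) * P)
    (hv : (v : Pol (2 * n + 1)) = X (2 * n) j' (k - j') * P') : c.inner u v = 0 := by
  have hSl := hS.e_last_mul_mem
  refine core_inner_eq_zero_of_eigen c (conj_casimirValue (2 * n) (k - j))
    (β := casimirValue (2 * n) (k - j')) (fun h => ?_) ?_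
  · have := casimirValue_injective (by omega) h
    omega
  · refine InvariantInner.casimir (z := Fin.last (2 * n)) hc (hS.soStable_succ k) ?_ ?_
    · rw [Submodule.coe_smul, hu]
      exact (casop_X_mul_monogenic hSl hP j).symm
    · rw [Submodule.coe_smul, hv]
      exact (casop_X_mul_monogenic hSl hP' j').symm

/-- Components of the same degree and opposite parity are orthogonal. -/
theorem IsBasicSpinor.inner_eq_zero_of_sign_ne (hn : 1 ≤ n) (hS : IsBasicSpinor S) {k : ℕ}
    {c : InnerProductSpace.Core ℂ (monogenics (2 * n + 1) k S)}
    (hc : InvariantInner (2 * n) (monogenics (2 * n + 1) k S) c)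
    {j : ℕ} (hj : j ≤ k) {ε ε' : ℂ} (hε : ε = 1 ∨ ε = -1) (hε' : ε' = 1 ∨ ε' = -1) (hne : ε ≠ ε')
    {P P' : Pol (2 * n + 1)} (hP : P ∈ monogenics (2 * n) (k - j) (thetaPart S ε))
    (hP' : P' ∈ monogenics (2 * n) (k - j) (thetaPart S ε')) {u v : monogenics (2 * n + 1) k S}
    (hu : (u : Pol (2 * n + 1)) = X (2 * n) j (k - j) * P)
    (hv : (v : Pol (2 * n + 1)) = X (2 * n) j (k - j) * P') : c.inner u v = 0 := by
  set L := ladder (2 * n) j (k - j) with hL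
  set M := fun δ : ℂ => monogenics (2 * n) (k - j) (thetaPart S δ) with hM
  set A : Submodule ℂ (monogenics (2 * n + 1) k S) := ((M ε).map L).comap (Submodule.subtype _) with hA
  have hfin : FiniteDimensional ℂ (monogenics (2 * n + 1) k S) :=
    have := finiteDimensional_homPoly (2 * n + 1) k S
    Submodule.finiteDimensional_of_le inf_le_left
  have hMst : SoStable (2 * n) ((M ε).map L) :=
    (hS.stable.soStable_thetaPart _ ε).map (intertwines_ladder j (k - j))
  by_cases hv0 : v = 0
  · rw [hv0, core_inner_zero_right c]
  have hP0 : P' ≠ 0 := fun h => hv0 (Subtype.ext (by rw [hv, h, mul_zero, Submodule.coe_zero]))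
  -- The Casimir operator takes the same value on both signs, so submodules are used instead. The
  -- vector v - a is nonzero and lies in the so(2n)-stable complement of A; hence the preimage of
  -- that complement contains some nonzero M_{k-j}(R^{2n},S^δ).
  obtain ⟨a, haA, ha⟩ := exists_sub_mem_coreOrthogonal c A v
  obtain ⟨Q, hQ, hQa⟩ := haA
  have hQa' : X (2 * n) j (k - j) * Q = a := hQa
  have hva : (v - a : monogenics (2 * n + 1) k S) ≠ 0 := by
    intro h
    have h0 : (v : Pol (2 * n + 1)) - a = 0 := congrArg Subtype.val h
    have h1 : X (2 * n) j (k - j) * P' = X (2 * n) j (k - j) * Q := by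
      rw [← hv, hQa', sub_eq_zero.1 h0]
    exact hne (hS.stable.ladder_index_unique hn hj hj hP0 hP' hQ h1).2.symm
  set W := (coreOrthogonal c A).map (Submodule.subtype _) with hW
  have hWst : SoStable (2 * n) W := hc.soStable_orthogonal (hS.stable.soStable_succ k) hMst
  have hT0 : monogenics (2 * n) (k - j) S ⊓ W.comap L ≠ ⊥ := by
    intro h
    have hmem : P' - Q ∈ monogenics (2 * n) (k - j) S ⊓ W.comap L := by
      refine ⟨Submodule.sub_mem _ (monogenics_mono (thetaPart_le ε') hP')
        (monogenics_mono (thetaPart_le ε) hQ), v - a, ha, ?_⟩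
      change ((v - a : monogenics (2 * n + 1) k S) : Pol (2 * n + 1)) = X (2 * n) j (k - j) * (P' - Q)
      rw [mul_sub, ← hv, hQa', Submodule.coe_sub]
    rw [h, Submodule.mem_bot, sub_eq_zero] at hmem
    refine hva (Subtype.ext ?_)
    rw [Submodule.coe_sub, hv, ← hQa', hmem, sub_self, Submodule.coe_zero]
  obtain ⟨δ, hδ, hle, hδ0⟩ := hS.exists_thetaPart_le hn inf_le_left
    ((hS.stable.soStable _).inf (hWst.comap (intertwines_ladder j (k - j)))) hT0
  have horth : ∀ R ∈ M δ, ∀ w : monogenics (2 * n + 1) k S,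
      (w : Pol (2 * n + 1)) = X (2 * n) j (k - j) * R →
        ∀ b ∈ A, c.inner b w = 0 := by
    intro R hR w hw b hb
    obtain ⟨w', hw', hww⟩ := (hle hR).2
    obtain rfl : w' = w := Subtype.ext (hww.trans hw.symm)
    exact hw' b hb
  -- If δ = ε, a nonzero vector of A would be orthogonal to itself. The only remaining sign is ε',
  -- so the whole ε'-component is orthogonal to A.
  have hδε : δ ≠ ε := by
    rintro rfl
    obtain ⟨R, hR, hR0⟩ := Submodule.exists_mem_ne_zero_of_ne_bot hδ0
    set w : monogenics (2 * n + 1) k S := ⟨_, hS.stable.X_mul_mem hn hj hR⟩ with hw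
    have hww := horth R hR w rfl w ⟨R, hR, rfl⟩
    have h0 : X (2 * n) j (k - j) * R = 0 := congrArg Subtype.val (c.definite w hww)
    exact hR0 (hS.stable.ladder_injective hn j δ R hR h0)
  obtain rfl : δ = ε' := by
    rcases hε with rfl | rfl <;> rcases hε' with rfl | rfl <;> rcases hδ with rfl | rfl <;> simp_all
  exact horth P' hP' v hv u ⟨P, hP, hu.symm⟩

variable {k : ℕ} {B : ℕ → ℂ → Set (Pol (2 * n + 1))}

/-- Elements coming from the same component are orthogonal. -/
theorem SpinStable.inner_eq_zero_of_basis (hn : 1 ≤ n) (hS : SpinStable S)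
    {c : InnerProductSpace.Core ℂ (monogenics (2 * n + 1) k S)}
    (hc : InvariantInner (2 * n) (monogenics (2 * n + 1) k S) c)
    {j : ℕ} (hj : j ≤ k) {ε : ℂ} {E : Set (Pol (2 * n + 1))}
    (hE : IsGTBasis (2 * n) (monogenics (2 * n) (k - j) (thetaPart S ε)) E)
    {P P' : Pol (2 * n + 1)} (hP : P ∈ E) (hP' : P' ∈ E) (hne : P ≠ P')
    {u v : monogenics (2 * n + 1) k S}
    (hu : (u : Pol (2 * n + 1)) = X (2 * n) j (k - j) * P)
    (hv : (v : Pol (2 * n + 1)) = X (2 * n) j (k - j) * P') : c.inner u v = 0 := by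
  set M := monogenics (2 * n) (k - j) (thetaPart S ε) with hM
  let f : M →ₗ[ℂ] monogenics (2 * n + 1) k S :=
    (ladder (2 * n) j (k - j)).restrict fun _ hQ => hS.X_mul_mem hn hj hQ
  have hf : Function.Injective f := by
    intro x y hxy
    have h1 : X (2 * n) j (k - j) * (x : Pol (2 * n + 1)) = X (2 * n) j (k - j) * y :=
      congrArg Subtype.val hxy
    exact Subtype.ext (sub_eq_zero.1 (hS.ladder_injective hn j ε _ (M.sub_mem x.2 y.2)
      (by rw [LinearMap.mulLeft_apply, mul_sub, h1, sub_self])))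
  have hinv : InvariantInner (2 * n) M (pullbackCore c f hf) := by
    intro a b hab hb x y x' y' hx hy
    refine hc a b hab hb (f x) (f y) (f x') (f y') ?_ ?_
    · change X (2 * n) j (k - j) * (x' : Pol (2 * n + 1)) = rot a b (X (2 * n) j (k - j) * _)
      rw [hx]
      exact (intertwines_ladder j (k - j) a b hab hb _).symm
    · change X (2 * n) j (k - j) * (y' : Pol (2 * n + 1)) = rot a b (X (2 * n) j (k - j) * _)
      rw [hy]
      exact (intertwines_ladder j (k - j) a b hab hb _).symm
  have h := hE.orthogonal _ hinv ⟨P, hE.subset hP⟩ ⟨P', hE.subset hP'⟩ hP hP'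
    fun h => hne (congrArg Subtype.val h)
  have hu' : f ⟨P, hE.subset hP⟩ = u := Subtype.ext hu.symm
  have hv' : f ⟨P', hE.subset hP'⟩ = v := Subtype.ext hv.symm
  rw [← hu', ← hv']
  exact h

/-- The products `X^{(j)} p` with basis elements `p`. -/
def ladderSet (k : ℕ) (B : ℕ → ℂ → Set (Pol (2 * n + 1))) : Set (Pol (2 * n + 1)) :=
  ⋃ j ∈ Set.Iic k, (ladder (2 * n) j (k - j) '' B (k - j) 1 ∪
    ladder (2 * n) j (k - j) '' B (k - j) (-1))

theorem mem_ladderSet {Q : Pol (2 * n + 1)} : Q ∈ ladderSet k B ↔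
    ∃ j ≤ k, ∃ ε : ℂ, (ε = 1 ∨ ε = -1) ∧ ∃ P ∈ B (k - j) ε, X (2 * n) j (k - j) * P = Q := by
  simp only [ladderSet, Set.mem_iUnion, Set.mem_Iic, exists_prop, Set.mem_union, Set.mem_image,
    LinearMap.mulLeft_apply, or_and_right, exists_or, exists_eq_left]

variable (hB : ∀ j ≤ k, ∀ ε : ℂ, (ε = 1 ∨ ε = -1) →
  IsGTBasis (2 * n) (monogenics (2 * n) j (thetaPart S ε)) (B j ε))

include hB

/-- The components of M_k(R^{2n+1},S) correspond bijectively to triples (j, ε, W') with W' a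
component of M_{k-j}(R^{2n},S^ε), through W' ↦ X^{(j)} W'; the given selections are transported
along this bijection. -/
theorem IsBasicSpinor.ladderSet_select (hn : 1 ≤ n) (hS : IsBasicSpinor S) :
    ∃ f : {W : Submodule ℂ (Pol (2 * n + 1)) //
        GTComponent (2 * n + 1) (monogenics (2 * n + 1) k S) W} → Pol (2 * n + 1),
      (∀ W, f W ∈ W.1 ∧ f W ≠ 0) ∧ ladderSet k B = Set.range f := by
  have hsel : ∀ j ≤ k, ∀ ε : ℂ, (ε = 1 ∨ ε = -1) →
      ∃ F : Submodule ℂ (Pol (2 * n + 1)) → Pol (2 * n + 1),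
        (∀ W, GTComponent (2 * n) (monogenics (2 * n) j (thetaPart S ε)) W → F W ∈ W ∧ F W ≠ 0) ∧
        ∀ P, P ∈ B j ε ↔
          ∃ W, GTComponent (2 * n) (monogenics (2 * n) j (thetaPart S ε)) W ∧ F W = P := by
    intro j hj ε hε
    classical
    obtain ⟨f, hf, hr⟩ := (hB j hj ε hε).select
    refine ⟨fun W => if h : GTComponent (2 * n) _ W then f ⟨W, h⟩ else 0, fun W hW => ?_,
      fun P => ?_⟩
    · simpa only [dif_pos hW] using hf ⟨W, hW⟩
    · rw [hr]
      constructor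
      · rintro ⟨W, rfl⟩
        exact ⟨W.1, W.2, dif_pos W.2⟩
      · rintro ⟨W, hW, rfl⟩
        exact ⟨⟨W, hW⟩, by simp only [dif_pos hW]⟩
  choose! F hF hFB using hsel
  set M := fun (j : ℕ) (ε : ℂ) => monogenics (2 * n) (k - j) (thetaPart S ε) with hM
  set L := fun j : ℕ => ladder (2 * n) j (k - j) with hL
  have hFle : ∀ j ε W, j ≤ k → (ε = 1 ∨ ε = -1) → GTComponent (2 * n) (M j ε) W →
      F (k - j) ε W ∈ W ∧ F (k - j) ε W ≠ 0 := fun j ε W _ hε hW =>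
    hF (k - j) (Nat.sub_le _ _) ε hε W hW
  have huniq : ∀ j ε W j' ε' W', j ≤ k → (ε = 1 ∨ ε = -1) → j' ≤ k → (ε' = 1 ∨ ε' = -1) →
      GTComponent (2 * n) (M j ε) W → GTComponent (2 * n) (M j' ε') W' →
      W.map (L j) = W'.map (L j') → j = j' ∧ ε = ε' ∧ W = W' := by
    intro j ε W j' ε' W' hj hε hj' hε' hW hW' h
    obtain ⟨h1, h2⟩ := hFle j ε W hj hε hW
    obtain ⟨P', hP', hPP⟩ : L j (F (k - j) ε W) ∈ W'.map (L j') :=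
      h ▸ Submodule.mem_map_of_mem h1
    obtain ⟨rfl, rfl⟩ := hS.stable.ladder_index_unique hn hj hj' h2 (hW.le h1) (hW'.le hP') hPP.symm
    exact ⟨rfl, rfl, eq_of_map_eq_map (hS.stable.ladder_injective hn j ε) hW.le hW'.le h⟩
  have hex : ∀ W : {W : Submodule ℂ (Pol (2 * n + 1)) //
      GTComponent (2 * n + 1) (monogenics (2 * n + 1) k S) W},
      ∃ j ε W', j ≤ k ∧ (ε = 1 ∨ ε = -1) ∧ GTComponent (2 * n) (M j ε) W' ∧
        W.1 = W'.map (L j) := by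
    rintro ⟨W, hW⟩
    obtain ⟨U, hUV, hU, hUW⟩ := hW.exists_step (by omega)
    obtain ⟨j, hj, ε, hε, rfl⟩ := hS.exists_eq_map_ladder hn hUV hU
    obtain ⟨W', hW', rfl⟩ := hUW.exists_of_map (hS.stable.soStable_thetaPart _ ε)
      (intertwines_ladder j (k - j)) (hS.stable.ladder_injective hn j ε)
    exact ⟨j, ε, W', hj, hε, hW', rfl⟩
  choose J Ε W' hJ hE hW' hWW using hex
  refine ⟨fun W => L (J W) (F (k - J W) (Ε W) (W' W)), fun W => ?_, ?_⟩
  · obtain ⟨h1, h2⟩ := hFle _ _ _ (hJ W) (hE W) (hW' W)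
    refine ⟨hWW W ▸ Submodule.mem_map_of_mem h1, fun h0 => h2 ?_⟩
    exact hS.stable.ladder_injective hn _ _ _ ((hW' W).le h1) h0
  · ext Q
    rw [mem_ladderSet]
    constructor
    · rintro ⟨j, hj, ε, hε, P, hP, rfl⟩
      obtain ⟨W, hW, rfl⟩ := (hFB _ (Nat.sub_le k j) ε hε P).1 hP
      obtain ⟨h1, h2⟩ := hFle j ε W hj hε hW
      -- The selected vector is nonzero, which supplies the nonvanishing required for
      -- irreducibility.
      have hne : M j ε ≠ ⊥ := (Submodule.ne_bot_iff _).2 ⟨_, hW.le h1, h2⟩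
      have hirr := hS.soIrreducible_ladder hn j hne
      have hcomp : GTComponent (2 * n + 1) (monogenics (2 * n + 1) k S) (W.map (L j)) := by
        refine GTComponent.step ?_ hirr
          (hW.map (intertwines_ladder j (k - j)) (hS.stable.ladder_injective hn j ε))
        rintro _ ⟨R, hR, rfl⟩
        exact hS.stable.X_mul_mem hn hj hR
      refine ⟨⟨_, hcomp⟩, ?_⟩
      -- The triple chosen for this component must be (j, ε, W), so the selection returns the
      -- prescribed product.
      obtain ⟨h3, h4, h5⟩ := huniq _ _ _ _ _ _ (hJ ⟨_, hcomp⟩) (hE ⟨_, hcomp⟩) hj hε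
        (hW' ⟨_, hcomp⟩) hW (hWW ⟨_, hcomp⟩).symm
      change L _ (F _ _ _) = _
      rw [h3, h4, h5]
      rfl
    · rintro ⟨W, rfl⟩
      exact ⟨J W, hJ W, Ε W, hE W, _,
        (hFB _ (Nat.sub_le _ _) _ (hE W) _).2 ⟨_, hW' W, rfl⟩, rfl⟩

theorem SpinStable.ladderSet_span (hn : 1 ≤ n) (hS : SpinStable S) :
    Submodule.span ℂ (ladderSet k B) = monogenics (2 * n + 1) k S := by
  refine le_antisymm (Submodule.span_le.2 fun Q hQ => ?_) fun Q hQ => ?_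
  · obtain ⟨j, hj, ε, hε, P, hP, rfl⟩ := mem_ladderSet.1 hQ
    exact hS.X_mul_mem hn hj ((hB _ (Nat.sub_le _ _) ε hε).subset hP)
  · obtain ⟨f, hf, rfl⟩ := exists_eq_sum_X_mul hS.e_last_mul_mem (by omega) hQ
    have key : ∀ j ≤ k, ∀ ε : ℂ, (ε = 1 ∨ ε = -1) →
        ∀ P ∈ monogenics (2 * n) (k - j) (thetaPart S ε),
          X (2 * n) j (k - j) * P ∈ Submodule.span ℂ (ladderSet k B) := by
      intro j hj ε hε P hP
      rw [← (hB _ (Nat.sub_le k j) ε hε).span_eq] at hP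
      have h1 := Submodule.mem_map_of_mem (f := ladder (2 * n) j (k - j)) hP
      rw [Submodule.map_span] at h1
      refine Submodule.span_mono ?_ h1
      rintro _ ⟨R, hR, rfl⟩
      exact mem_ladderSet.2 ⟨j, hj, ε, hε, R, hR, rfl⟩
    refine Submodule.sum_mem _ fun j hj => ?_
    have hj' : j ≤ k := by have := Finset.mem_range.1 hj; omega
    have h1 : f j = const (thetaProj n 1) * f j + const (thetaProj n (-1)) * f j := by
      rw [← add_mul, ← const_add, thetaProj_add, const_one, one_mul]
    rw [h1, mul_add]
    exact Submodule.add_mem _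
      (key j hj' 1 (Or.inl rfl) _ (const_thetaProj_mul_mem hS (by norm_num) (hf j hj')))
      (key j hj' (-1) (Or.inr rfl) _ (const_thetaProj_mul_mem hS (by norm_num) (hf j hj')))

/-- Within one index, injectivity and the θ-eigenvalue give independence; different indices j lie in
different eigenspaces of the so(2n) Casimir operator. -/
theorem SpinStable.ladderSet_linearIndependent (hn : 1 ≤ n) (hS : SpinStable S) :
    LinearIndepOn ℂ id (ladderSet k B) := by
  have himage : ∀ j ≤ k, ∀ ε : ℂ, (ε = 1 ∨ ε = -1) →
      LinearIndepOn ℂ id (ladder (2 * n) j (k - j) '' B (k - j) ε) := by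
    intro j hj ε hε
    have hb := hB _ (Nat.sub_le k j) ε hε
    refine LinearIndepOn.id_imageₛ hb.linearIndependent ?_
    rw [hb.span_eq]
    intro x hx y hy hxy
    exact sub_eq_zero.1 (hS.ladder_injective hn j ε _ (Submodule.sub_mem _ hx hy)
      (by rw [map_sub, hxy, sub_self]))
  have hspan : ∀ j ≤ k, ∀ ε : ℂ, (ε = 1 ∨ ε = -1) →
      Submodule.span ℂ (ladder (2 * n) j (k - j) '' B (k - j) ε)
        = (monogenics (2 * n) (k - j) (thetaPart S ε)).map (ladder (2 * n) j (k - j)) := by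
    intro j hj ε hε
    rw [← Submodule.map_span, (hB _ (Nat.sub_le k j) ε hε).span_eq]
  rw [ladderSet, Set.biUnion_eq_iUnion]
  refine linearIndepOn_id_iUnion_finite (fun j => ?_) fun j t _ hjt => ?_
  · refine (himage j j.2 1 (Or.inl rfl)).union (himage j j.2 (-1) (Or.inr rfl)) ?_
    rw [Set.image_id, Set.image_id, hspan j j.2 1 (Or.inl rfl), hspan j j.2 (-1) (Or.inr rfl),
      Submodule.disjoint_def]
    rintro _ ⟨P, hP, rfl⟩ ⟨P', hP', h⟩
    by_contra h0
    have hP0 : P ≠ 0 := fun h => h0 (by rw [h, map_zero])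
    have := (hS.ladder_index_unique hn j.2 j.2 hP0 hP hP' h.symm).2
    norm_num at this
  · have hind : iSupIndep fun j : Set.Iic k =>
        (casop (2 * n)).eigenspace (casimirValue (2 * n) (k - j)) := by
      refine (casop (2 * n)).eigenspaces_iSupIndep.comp fun x y hxy => Subtype.ext ?_
      have := casimirValue_injective (by omega) hxy
      have := x.2.out
      have := y.2.out
      omega
    have hle : ∀ j : Set.Iic k, Submodule.span ℂ (ladder (2 * n) j (k - j) '' B (k - j) 1 ∪
        ladder (2 * n) j (k - j) '' B (k - j) (-1))
          ≤ (casop (2 * n)).eigenspace (casimirValue (2 * n) (k - j)) := by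
      intro j
      have h1 : ∀ ε : ℂ, (ε = 1 ∨ ε = -1) → ladder (2 * n) j (k - j) '' B (k - j) ε
          ⊆ (casop (2 * n)).eigenspace (casimirValue (2 * n) (k - j)) := by
        rintro ε hε _ ⟨P, hP, rfl⟩
        have hPM := (hB _ (Nat.sub_le k j) ε hε).subset hP
        exact Module.End.mem_eigenspace_iff.2 (casop_X_mul_monogenic hS.e_last_mul_mem
          (monogenics_mono (thetaPart_le ε) hPM) j)
      exact Submodule.span_le.2 (Set.union_subset (h1 1 (Or.inl rfl)) (h1 (-1) (Or.inr rfl)))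
    exact (hind.disjoint_biSup hjt).mono (hle j) (iSup₂_mono fun i _ => hle i)

theorem IsBasicSpinor.isGTBasis_ladderSet (hn : 1 ≤ n) (hS : IsBasicSpinor S) :
    IsGTBasis (2 * n + 1) (monogenics (2 * n + 1) k S) (ladderSet k B) where
  select := hS.ladderSet_select hB hn
  linearIndependent := hS.stable.ladderSet_linearIndependent hB hn
  span_eq := hS.stable.ladderSet_span hB hn
  orthogonal c hc u v hu hv huv := by
    -- Only so(2n)-invariance of the inner product is needed for orthogonality.
    have hc' := hc.mono (Nat.le_succ (2 * n))
    obtain ⟨j, hj, ε, hε, P, hP, hPu⟩ := mem_ladderSet.1 hu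
    obtain ⟨j', hj', ε', hε', P', hP', hPv⟩ := mem_ladderSet.1 hv
    have hb := hB _ (Nat.sub_le k j) ε hε
    have hb' := hB _ (Nat.sub_le k j') ε' hε'
    by_cases hjj : j = j'
    · subst hjj
      by_cases hεε : ε = ε'
      · subst hεε
        refine hS.stable.inner_eq_zero_of_basis hn hc' hj hb hP hP' (fun h => huv ?_) hPu.symm
          hPv.symm
        exact Subtype.ext (by rw [← hPu, ← hPv, h])
      · exact hS.inner_eq_zero_of_sign_ne hn hc' hj hε hε' hεε (hb.subset hP) (hb'.subset hP')
          hPu.symm hPv.symm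
    · exact hS.stable.inner_eq_zero_of_ne hn hc' hj hj' hjj
        (monogenics_mono (thetaPart_le ε) (hb.subset hP))
        (monogenics_mono (thetaPart_le ε') (hb'.subset hP')) hPu.symm hPv.symm

end Basis

end GTMonogenic

end

/-! ### The main theorem -/

theorem mainTheorem9 (n : ℕ) (hn : 1 ≤ n)
    (S : Submodule ℂ (GTMonogenic.Cl (2 * n + 1))) (hS : GTMonogenic.IsBasicSpinor S)
    (k : ℕ) (Bplus Bminus : ℕ → Set (GTMonogenic.Pol (2 * n + 1)))
    (hplus : ∀ j ≤ k, GTMonogenic.IsGTBasis (2 * n)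
      (GTMonogenic.monogenics (2 * n) j (GTMonogenic.thetaPart S 1)) (Bplus j))
    (hminus : ∀ j ≤ k, GTMonogenic.IsGTBasis (2 * n)
      (GTMonogenic.monogenics (2 * n) j (GTMonogenic.thetaPart S (-1))) (Bminus j)) :
    GTMonogenic.IsGTBasis (2 * n + 1) (GTMonogenic.monogenics (2 * n + 1) k S)
      (⋃ j ∈ Set.Iic k,
        ((fun p => GTMonogenic.X (2 * n) j (k - j) * p) '' Bplus (k - j) ∪
          (fun p => GTMonogenic.X (2 * n) j (k - j) * p) '' Bminus (k - j))) := by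
  have hne : (-1 : ℂ) ≠ 1 := by norm_num
  -- The two families of bases are merged into one indexed by the sign ε; its value outside ±1 is
  -- irrelevant.
  have h := hS.isGTBasis_ladderSet (k := k) (B := fun j ε => if ε = 1 then Bplus j else Bminus j)
    (fun j hj ε hε => by
      rcases hε with rfl | rfl
      · rw [if_pos rfl]; exact hplus j hj
      · rw [if_neg hne]; exact hminus j hj) hn
  simp only [GTMonogenic.ladderSet, if_pos, if_neg hne] at h
  exact h
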